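/- Let $(M,g)$ be a smooth four-dimensional Lorentzian manifold of signature $(-,+,+,+)$ satisfying the vacuum Einstein equations with cosmological constant $\Lambda\in\mathbb R$, $$R_{\mu\nu}-\tfrac12 R\,g_{\mu\nu}+\Lambda g_{\mu\nu}=0 ,$$ and let $\Sigma$ be a smooth (possibly only immersed) spacelike hypersurface in $M$ with a smooth field $n$ of unit normals, $g(n,n)=-1$. Let $\gamma_{ij}$ be the induced Riemannian metric on $\Sigma$, let "$|$" denote its covariant derivative, and let $K_{ij}=-g(\nabla_i n,\partial_j)$ be the extrinsic curvature. Let $W_{\alpha\beta\mu\nu}$ be the Weyl tensor of $g$, where the Riemann tensor is $R^{\alpha}{}_{\beta\mu\nu}=\partial_\mu\Gamma^{\alpha}_{\beta\nu}-\partial_\nu\Gamma^{\alpha}_{\beta\mu}+\Gamma^{\alpha}_{\mu\sigma}\Gamma^{\sigma}_{\beta\nu}-\Gamma^{\alpha}_{\nu\sigma}\Gamma^{\sigma}_{\beta\mu}$ and $R_{\beta\nu}=R^{\alpha}{}_{\beta\alpha\nu}$, and let $W^{*}{}_{\alpha\beta\mu\nu}=\tfrac12 W_{\alpha\beta\rho\sigma}\varepsilon^{\rho\sigma}{}_{\mu\nu}$.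 Let $E_{ij}$ and $B_{ij}$ be the restrictions to $\Sigma$ of the electric and magnetic parts $$E_{\alpha\beta}=W_{\alpha\mu\nu\beta}\,n^\mu n^\nu ,\qquad B_{\alpha\beta}=W^{*}{}_{\alpha\mu\nu\beta}\,n^\mu n^\nu .$$ Here $\varepsilon_{\alpha\beta\mu\nu}$ and $\varepsilon_{ijk}$ are the Levi-Civita tensors of $g$ and $\gamma$ for (local) orientations of $M$ and $\Sigma$ related by $\varepsilon_{ijk}=n^\mu\varepsilon_{\mu ijk}$. Then at every point of $\Sigma$ $$E^{i}{}_{j|i}=(K\wedge B)_j ,\qquad B^{i}{}_{j|i}=-(K\wedge E)_j ,$$ where $(A\wedge B)_a=\varepsilon_a{}^{bc}A_b{}^{d}B_{dc}$ for symmetric tensors $A$, $B$ on $\Sigma$. -/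

import Mathlib

open scoped Manifold ContDiff

noncomputable section

namespace GravitoEM

/-! ### Tensor calculus in local coordinates

A field of components on coordinate space is a function of the coordinates `x : Coord n`, followed
by its indices, written in the order of the indices of the tensor. A metric is given by the matrix
`h x` of its components `h_ij(x)`, so that `(h x)⁻¹ i j` is `h^ij(x)`. -/

abbrev Coord (n : ℕ) : Type := EuclideanSpace ℝ (Fin n)

/-- The partial derivative `∂_i F`. -/
def pd {n : ℕ} (i : Fin n) (F : Coord n → ℝ) (x : Coord n) : ℝ :=
  fderiv ℝ F x (EuclideanSpace.single i 1)

section metric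

variable {n : ℕ} (h : Coord n → Matrix (Fin n) (Fin n) ℝ) (x : Coord n)

/-- The Christoffel symbol `Γ^k_ij` of the metric `h`. -/
def christoffel (k i j : Fin n) : ℝ :=
  (1 / 2) * ∑ l, (h x)⁻¹ k l *
    (pd i (fun y => h y j l) x + pd j (fun y => h y i l) x - pd l (fun y => h y i j) x)

/-- The Riemann tensor
`R^a_bcd = ∂_c Γ^a_bd - ∂_d Γ^a_bc + Γ^a_ce Γ^e_bd - Γ^a_de Γ^e_bc`. -/
def riemannUp (a b c d : Fin n) : ℝ :=
  pd c (fun y => christoffel h y a b d) x - pd d (fun y => christoffel h y a b c) x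
    + ∑ e, (christoffel h x a c e * christoffel h x e b d
      - christoffel h x a d e * christoffel h x e b c)

/-- The Riemann tensor with all indices lowered, `R_abcd`. -/
def riemann (a b c d : Fin n) : ℝ := ∑ e, h x a e * riemannUp h x e b c d

/-- The Ricci tensor `R_bd = R^a_bad`. -/
def ricci (b d : Fin n) : ℝ := ∑ a, riemannUp h x a b a d

/-- The scalar curvature `R = h^bd R_bd`. -/
def scalarCurvature : ℝ := ∑ b, ∑ d, (h x)⁻¹ b d * ricci h x b d

/-- The sign of `a : Fin n → Fin n` if `a` is a permutation, and `0` otherwise. -/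
def permSymbol (a : Fin n → Fin n) : ℝ := ((1 : Matrix (Fin n) (Fin n) ℝ).submatrix a id).det

/-- The covariant Levi-Civita tensor `ε_{a₁…aₙ}` of `h` for the orientation in which the coordinate
frame is positive (`s = 1`) or negative (`s = -1`): `ε_{1…n} = s √|det h|`. -/
def leviCivita (s : ℤˣ) (a : Fin n → Fin n) : ℝ :=
  ((s : ℤ) : ℝ) * Real.sqrt |(h x).det| * permSymbol a

/-- Raising the first index of a tensor of rank two: `T^i_j = h^ik T_kj`. -/
def raiseFirst (T : Coord n → Fin n → Fin n → ℝ) (y : Coord n) (i j : Fin n) : ℝ :=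
  ∑ k, (h y)⁻¹ i k * T y k j

/-- The covariant derivative `D_k T^i_j = ∂_k T^i_j + Γ^i_kl T^l_j - Γ^l_kj T^i_l`
of a tensor `T^i_j`. -/
def covDerivMixed (T : Coord n → Fin n → Fin n → ℝ) (k i j : Fin n) : ℝ :=
  pd k (fun y => T y i j) x
    + ∑ l, (christoffel h x i k l * T x l j - christoffel h x l k j * T x i l)

/-- The covariant divergence `T^i_{j|i}` of a tensor `T_ij`. -/
def divergence (T : Coord n → Fin n → Fin n → ℝ) (j : Fin n) : ℝ :=
  ∑ i, covDerivMixed h x (raiseFirst h T) i i j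

end metric

/-- `(A ∧ B)_a = ε_a^{bc} A_b^d B_dc` for the three-dimensional metric `h`, where `ε` is its
Levi-Civita tensor for the orientation `s`. -/
def wedge (h : Coord 3 → Matrix (Fin 3) (Fin 3) ℝ) (s : ℤˣ) (x : Coord 3)
    (A B : Coord 3 → Fin 3 → Fin 3 → ℝ) (a : Fin 3) : ℝ :=
  ∑ b, ∑ c, ∑ d,
    (∑ b', ∑ c', leviCivita h x s ![a, b', c'] * (h x)⁻¹ b' b * (h x)⁻¹ c' c)
      * (∑ e, A x b e * (h x)⁻¹ e d) * B x d c

section fourDim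

variable (g : Coord 4 → Matrix (Fin 4) (Fin 4) ℝ) (y : Coord 4)

/-- The Weyl tensor in dimension four,
`W_αβμν = R_αβμν - (g_α[μ R_ν]β - g_β[μ R_ν]α) + (1/3) R g_α[μ g_ν]β`. -/
def weyl (α β μ ν : Fin 4) : ℝ :=
  riemann g y α β μ ν
    - ((1 / 2) * (g y α μ * ricci g y ν β - g y α ν * ricci g y μ β)
      - (1 / 2) * (g y β μ * ricci g y ν α - g y β ν * ricci g y μ α))
    + (1 / 3) * scalarCurvature g y * ((1 / 2) * (g y α μ * g y ν β - g y α ν * g y μ β))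

/-- The dual Weyl tensor `W*_αβμν = (1/2) W_αβρσ ε^ρσ_μν`, for the orientation `s`. -/
def dualWeyl (s : ℤˣ) (α β μ ν : Fin 4) : ℝ :=
  (1 / 2) * ∑ ρ, ∑ σ, weyl g y α β ρ σ *
    ∑ κ, ∑ τ, (g y)⁻¹ ρ κ * (g y)⁻¹ σ τ * leviCivita g y s ![κ, τ, μ, ν]

end fourDim

/-! ### A parametrized hypersurface `f` with unit normal `N` in four-dimensional coordinates -/

section hypersurface

variable (g : Coord 4 → Matrix (Fin 4) (Fin 4) ℝ) (f N : Coord 3 → Coord 4) (x : Coord 3)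

/-- The components `e_i^μ = ∂_i f^μ` of the coordinate tangent vectors. -/
def tangentComp (i : Fin 3) (μ : Fin 4) : ℝ := pd i (fun z => f z μ) x

/-- The restriction `T_ij = e_i^α e_j^β T_αβ` of a covariant tensor to the hypersurface. -/
def restrict (T : Fin 4 → Fin 4 → ℝ) (i j : Fin 3) : ℝ :=
  ∑ α, ∑ β, tangentComp f x i α * tangentComp f x j β * T α β

/-- The induced metric `γ_ij`. -/
def inducedMetric : Matrix (Fin 3) (Fin 3) ℝ := Matrix.of (restrict f x (g (f x)))

/-- The derivative `∇_i n^μ = ∂_i n^μ + Γ^μ_αβ e_i^α n^β` of the normal along the hypersurface. -/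
def normalDeriv (i : Fin 3) (μ : Fin 4) : ℝ :=
  pd i (fun z => N z μ) x
    + ∑ α, ∑ β, christoffel g (f x) μ α β * tangentComp f x i α * N x β

/-- The extrinsic curvature `K_ij = - g(∇_i n, e_j)`. In an adapted foliation this is
`K_ij = (1 / 2N) (N_{i|j} + N_{j|i} - ∂_t γ_ij)`. -/
def extrinsicCurvature (i j : Fin 3) : ℝ :=
  -∑ μ, ∑ ν, g (f x) μ ν * normalDeriv g f N x i μ * tangentComp f x j ν

/-- The electric part `E_αβ = W_αμνβ n^μ n^ν` of the Weyl tensor, restricted to the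
hypersurface. -/
def electricPart (i j : Fin 3) : ℝ :=
  restrict f x (fun α β => ∑ μ, ∑ ν, weyl g (f x) α μ ν β * N x μ * N x ν) i j

/-- The magnetic part `B_αβ = W*_αμνβ n^μ n^ν` of the Weyl tensor, restricted to the
hypersurface; `s` is the orientation of the four-dimensional space. -/
def magneticPart (s : ℤˣ) (i j : Fin 3) : ℝ :=
  restrict f x (fun α β => ∑ μ, ∑ ν, dualWeyl g (f x) s α μ ν β * N x μ * N x ν) i j

/-- The determinant of the components of the frame `(n, e_1, e_2, e_3)`. -/
def frameDet : ℝ :=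
  Matrix.det (Matrix.of (Fin.cons (fun μ => N x μ) (fun i => tangentComp f x i) :
    Fin 4 → Fin 4 → ℝ))

/-- The orientations `s₄` of the four-dimensional space and `s₃` of the hypersurface are related by
`ε_ijk = n^μ ε_μijk`: a frame `(v_1, v_2, v_3)` of the hypersurface is positive iff
`(n, v_1, v_2, v_3)` is positive. -/
def OrientationsCompatible (s₄ s₃ : ℤˣ) : Prop :=
  0 < ((s₄ : ℤ) : ℝ) * ((s₃ : ℤ) : ℝ) * frameDet f N x

end hypersurface

/-! ### Spacetimes and spacelike hypersurfaces -/

/-- A smooth Lorentzian metric of signature `(-,+,+,+)` on a four-dimensional manifold. -/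
structure LorentzMetric (M : Type*) [TopologicalSpace M] [ChartedSpace (Coord 4) M]
    [IsManifold (𝓡 4) ∞ M] where
  val (p : M) : TangentSpace (𝓡 4) p →L[ℝ] TangentSpace (𝓡 4) p →L[ℝ] ℝ
  symm (p : M) (v w : TangentSpace (𝓡 4) p) : val p v w = val p w v
  signature (p : M) : ∃ b : Module.Basis (Fin 4) ℝ (TangentSpace (𝓡 4) p),
    ∀ i j, val p (b i) (b j) = if i = j then (if i = 0 then -1 else 1) else 0
  smooth : ContMDiff (𝓡 4) ((𝓡 4).prod 𝓘(ℝ, Coord 4 →L[ℝ] Coord 4 →L[ℝ] ℝ)) ∞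
    (fun p => Bundle.TotalSpace.mk' (Coord 4 →L[ℝ] Coord 4 →L[ℝ] ℝ)
      (E := fun p : M => TangentSpace (𝓡 4) p →L[ℝ] TangentSpace (𝓡 4) p →L[ℝ] ℝ) p (val p))

section spacetime

variable {M : Type*} [TopologicalSpace M] [ChartedSpace (Coord 4) M] [IsManifold (𝓡 4) ∞ M]

/-- The components `g_μν` of the metric in the chart `φ`, as functions of the coordinates. -/
def LorentzMetric.comp (g : LorentzMetric M) (φ : OpenPartialHomeomorph M (Coord 4))
    (y : Coord 4) : Matrix (Fin 4) (Fin 4) ℝ :=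
  Matrix.of fun μ ν => g.val (φ.symm y)
    (mfderiv (𝓡 4) (𝓡 4) φ.symm y (EuclideanSpace.single μ (1 : ℝ) : Coord 4))
    (mfderiv (𝓡 4) (𝓡 4) φ.symm y (EuclideanSpace.single ν (1 : ℝ) : Coord 4))

/-- The Einstein vacuum equations `R_μν - (1/2) R g_μν + Λ g_μν = 0`, in all smooth charts. -/
def LorentzMetric.IsVacuum (g : LorentzMetric M) (Λ : ℝ) : Prop :=
  ∀ φ ∈ IsManifold.maximalAtlas (𝓡 4) ∞ M, ∀ y ∈ φ.target, ∀ μ ν : Fin 4,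
    ricci (g.comp φ) y μ ν - (1 / 2) * scalarCurvature (g.comp φ) y * g.comp φ y μ ν
      + Λ * g.comp φ y μ ν = 0

/-- A smooth (immersed) spacelike hypersurface with a smooth field of unit normals `n`. -/
structure SpacelikeHypersurface (g : LorentzMetric M) (S : Type*) [TopologicalSpace S]
    [ChartedSpace (Coord 3) S] [IsManifold (𝓡 3) ∞ S] where
  incl : S → M
  smooth_incl : ContMDiff (𝓡 3) (𝓡 4) ∞ incl
  spacelike (p : S) (v : TangentSpace (𝓡 3) p) (hv : v ≠ 0) :
    0 < g.val (incl p) (mfderiv (𝓡 3) (𝓡 4) incl p v) (mfderiv (𝓡 3) (𝓡 4) incl p v)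
  normal (p : S) : TangentSpace (𝓡 4) (incl p)
  smooth_normal : ContMDiff (𝓡 3) (𝓡 4).tangent ∞
    (fun p => (⟨incl p, normal p⟩ : TangentBundle (𝓡 4) M))
  normal_unit (p : S) : g.val (incl p) (normal p) (normal p) = -1
  normal_orthogonal (p : S) (v : TangentSpace (𝓡 3) p) :
    g.val (incl p) (normal p) (mfderiv (𝓡 3) (𝓡 4) incl p v) = 0

namespace SpacelikeHypersurface

variable {S : Type*} [TopologicalSpace S] [ChartedSpace (Coord 3) S] [IsManifold (𝓡 3) ∞ S]
  {g : LorentzMetric M} (H : SpacelikeHypersurface g S)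
  (φ : OpenPartialHomeomorph M (Coord 4)) (ψ : OpenPartialHomeomorph S (Coord 3))

/-- The hypersurface in the charts `ψ` of `S` and `φ` of `M`. -/
def param (x : Coord 3) : Coord 4 := φ (H.incl (ψ.symm x))

/-- The components of the unit normal in the chart `φ`, as functions of the coordinates `ψ`. -/
def normalComp (x : Coord 3) : Coord 4 :=
  mfderiv (𝓡 4) (𝓡 4) φ (H.incl (ψ.symm x)) (H.normal (ψ.symm x))

/-- The induced metric `γ_ij` in the chart `ψ`. -/
def γ : Coord 3 → Matrix (Fin 3) (Fin 3) ℝ := inducedMetric (g.comp φ) (H.param φ ψ)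

/-- The extrinsic curvature `K_ij` in the chart `ψ`. -/
def K : Coord 3 → Fin 3 → Fin 3 → ℝ :=
  extrinsicCurvature (g.comp φ) (H.param φ ψ) (H.normalComp φ ψ)

/-- The electric part `E_ij` of the Weyl tensor in the chart `ψ`. -/
def E : Coord 3 → Fin 3 → Fin 3 → ℝ :=
  electricPart (g.comp φ) (H.param φ ψ) (H.normalComp φ ψ)

/-- The magnetic part `B_ij` of the Weyl tensor in the chart `ψ`. -/
def B (s₄ : ℤˣ) : Coord 3 → Fin 3 → Fin 3 → ℝ :=
  fun x => magneticPart (g.comp φ) (H.param φ ψ) (H.normalComp φ ψ) x s₄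

end SpacelikeHypersurface

end spacetime

end GravitoEM

end

/-!
The divergence of the electric and the magnetic part of the Weyl tensor on a spacelike hypersurface
of a vacuum spacetime comes from one general fact, applied to the Weyl tensor `W` and to its dual
`W*`.

*Both tensors are divergence free.* The vacuum equations say `Ric = Λ g`, so the contracted second
Bianchi identity gives `∇_α R^α_βμν = ∇_μ R_βν - ∇_ν R_βμ = 0` (`sum_covRiemannUp`). Here `W`
differs from the Riemann tensor by a constant multiple of the parallel tensor
`g_αμ g_βν - g_αν g_βμ` (`weyl_of_vacuum`), hence `∇^α W_αβμν = 0` (`div_weyl`). The dual is taken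
on the second pair of indices and the Levi-Civita tensor is parallel (`pd_leviCivita`), hence
`∇^α W*_αβμν = 0` as well (`div_dualWeyl`).

*The divergence on the hypersurface.* Let `T` be divergence free and skew in each pair of indices,
with electric part `T(e_i, n, n, e_j)` in the frame of the unit normal `n` and the coordinate
vectors `e_i`. In its derivative along the hypersurface, the Gauss formula
`∇_i e_j = Γ^l_ij e_l - K_ij n` and the Weingarten formula `∇_i n = -K_i^l e_l` convert all
derivatives of the frame into terms in `K`. The intrinsic connection terms cancel; `∇T` contributes
the full divergence, because `(∇_n T)(n, n, ·, ·) = 0`; the terms with `T(n, n, ·, ·)` or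
`T(·, ·, n, n)` and the term `K^{kl} T(e_k, e_l, n, e_j)` vanish by skewness. What remains is
`D^i T(e_i, n, n, e_j) = -K^{kl} T(e_k, n, e_l, e_j)` (`IsLocalHypersurface.divergence_electric`).
No symmetry of `T` under exchange of its pairs is used.

*Dualization in the frame.* Since `ε(n, e_a, e_b, e_c) = ε_abc`, expanding the definition of `W*` in
the frame gives `B_kj = (1/2) W(e_k, n, e_a, e_b) ε^ab_j` and `W*(e_k, n, e_l, e_j) = -E_k^b ε_blj`
(`magnetic_frame`, `dualWeyl_tangent_frame`). With `T = W`, the first relation and the contraction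
of two Levi-Civita tensors turn `-K^{kl} W(e_k, n, e_l, e_j)` into `(K ∧ B)_j`; with `T = W*`, the
second relation turns `-K^{kl} W*(e_k, n, e_l, e_j)` into `-(K ∧ E)_j`.

All this takes place in coordinates, for a metric on an open set of `ℝ⁴` and a parametrized
hypersurface, collected in the predicate `IsLocalHypersurface`. The components of a spacelike
hypersurface of a Lorentzian manifold in any pair of charts satisfy this predicate
(`SpacelikeHypersurface.isLocalHypersurface`).
-/

noncomputable section

namespace GravitoEM

open Filter Topology

/-! ### Partial derivatives -/

section pd

variable {n : ℕ} {F G : Coord n → ℝ} {x : Coord n}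

lemma pd_congr (h : F =ᶠ[𝓝 x] G) (i : Fin n) : pd i F x = pd i G x := by
  rw [pd, pd, h.fderiv_eq]

@[simp] lemma pd_const (c : ℝ) (i : Fin n) : pd i (fun _ => c) x = 0 := by
  simp [pd]

lemma pd_add (hF : DifferentiableAt ℝ F x) (hG : DifferentiableAt ℝ G x) (i : Fin n) :
    pd i (fun y => F y + G y) x = pd i F x + pd i G x := by
  simp [pd, fderiv_fun_add hF hG]

lemma pd_sub (hF : DifferentiableAt ℝ F x) (hG : DifferentiableAt ℝ G x) (i : Fin n) :
    pd i (fun y => F y - G y) x = pd i F x - pd i G x := by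
  simp [pd, fderiv_fun_sub hF hG]

lemma pd_neg (i : Fin n) : pd i (fun y => -F y) x = -pd i F x := by
  simp [pd]

lemma pd_mul (hF : DifferentiableAt ℝ F x) (hG : DifferentiableAt ℝ G x) (i : Fin n) :
    pd i (fun y => F y * G y) x = pd i F x * G x + F x * pd i G x := by
  simp [pd, fderiv_fun_mul hF hG]; ring

lemma pd_const_mul (hF : DifferentiableAt ℝ F x) (c : ℝ) (i : Fin n) :
    pd i (fun y => c * F y) x = c * pd i F x := by
  simp [pd, fderiv_const_mul hF]

lemma pd_sum {ι : Type*} {s : Finset ι} {A : ι → Coord n → ℝ}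
    (hA : ∀ a ∈ s, DifferentiableAt ℝ (A a) x) (i : Fin n) :
    pd i (fun y => ∑ a ∈ s, A a y) x = ∑ a ∈ s, pd i (A a) x := by
  simp [pd, fderiv_fun_sum hA]

lemma pd_prod {ι : Type*} [DecidableEq ι] {s : Finset ι} {A : ι → Coord n → ℝ}
    (hA : ∀ a ∈ s, DifferentiableAt ℝ (A a) x) (i : Fin n) :
    pd i (fun y => ∏ a ∈ s, A a y) x = ∑ a ∈ s, (∏ b ∈ s.erase a, A b x) * pd i (A a) x := by
  rw [pd, (HasFDerivAt.finsetProd fun a ha => (hA a ha).hasFDerivAt).fderiv]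
  simp [pd]

lemma contDiffAt_pd (hF : ContDiffAt ℝ ∞ F x) (i : Fin n) : ContDiffAt ℝ ∞ (pd i F) x := by
  have h : ContDiffAt ℝ ∞ (fderiv ℝ F) x := hF.fderiv_right (by simp)
  exact h.clm_apply contDiffAt_const

/-- Partial derivatives commute. -/
lemma pd_comm (hF : ContDiffAt ℝ ∞ F x) (i j : Fin n) :
    pd i (pd j F) x = pd j (pd i F) x := by
  have h : DifferentiableAt ℝ (fderiv ℝ F) x :=
    (hF.fderiv_right (m := ∞) (by simp)).differentiableAt (by simp)
  have key : ∀ k l : Fin n, pd k (pd l F) x =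
      fderiv ℝ (fderiv ℝ F) x (EuclideanSpace.single k 1) (EuclideanSpace.single l 1) := by
    intro k l
    change fderiv ℝ (fun y => fderiv ℝ F y (EuclideanSpace.single l 1)) x _ = _
    rw [fderiv_clm_apply h (differentiableAt_const _)]
    simp
  rw [key, key]
  exact (hF.isSymmSndFDerivAt
    (by simpa using WithTop.coe_le_coe.mpr (le_top : (2 : ℕ∞) ≤ ⊤))).eq _ _

end pd

section matrix

variable {n : ℕ} {x : Coord n} {ι : Type*} [Fintype ι] [DecidableEq ι]
  {A : Coord n → Matrix ι ι ℝ}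

lemma contDiffAt_det (hA : ∀ i j, ContDiffAt ℝ ∞ (fun y => A y i j) x) :
    ContDiffAt ℝ ∞ (fun y => (A y).det) x := by
  simp only [Matrix.det_apply']
  exact ContDiffAt.sum fun σ _ => contDiffAt_const.mul (contDiffAt_prod fun i _ => hA _ _)

lemma contDiffAt_inv_apply (hA : ∀ i j, ContDiffAt ℝ ∞ (fun y => A y i j) x)
    (hdet : (A x).det ≠ 0) (i j : ι) : ContDiffAt ℝ ∞ (fun y => (A y)⁻¹ i j) x := by
  simp only [Matrix.inv_def, Matrix.smul_apply, Ring.inverse_eq_inv', smul_eq_mul,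
    Matrix.adjugate_apply]
  refine ((contDiffAt_det hA).inv hdet).mul (contDiffAt_det fun k l => ?_)
  simp only [Matrix.updateRow_apply]
  split_ifs
  · exact contDiffAt_const
  · exact hA k l

lemma eventually_det_ne_zero (hA : ∀ i j, ContDiffAt ℝ ∞ (fun y => A y i j) x)
    (hdet : (A x).det ≠ 0) : ∀ᶠ y in 𝓝 x, (A y).det ≠ 0 :=
  (contDiffAt_det hA).continuousAt.eventually_ne hdet

/-- Replacing each column of `A` in turn by that of `B`, and summing the determinants. -/
lemma sum_det_updateCol (A B : Matrix ι ι ℝ) :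
    ∑ j, (A.updateCol j (fun i => B i j)).det = (A.adjugate * B).trace := by
  simp only [Matrix.trace, Matrix.diag, ← Matrix.cramer_apply, Matrix.mul_apply]
  refine Finset.sum_congr rfl fun j _ => ?_
  rw [Matrix.cramer_eq_adjugate_mulVec]
  rfl

/-- Jacobi's formula for the derivative of a determinant. -/
lemma pd_det (hA : ∀ i j, DifferentiableAt ℝ (fun y => A y i j) x) (k : Fin n) :
    pd k (fun y => (A y).det) x
      = ((A x).adjugate * Matrix.of fun i j => pd k (fun y => A y i j) x).trace := by
  have hd : ∀ σ : Equiv.Perm ι, DifferentiableAt ℝ (fun y => ∏ i, A y (σ i) i) x := fun σ =>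
    (HasFDerivAt.finsetProd fun i _ => (hA (σ i) i).hasFDerivAt).differentiableAt
  rw [← sum_det_updateCol]
  simp only [Matrix.det_apply']
  rw [pd_sum fun σ _ => (hd σ).const_mul _, Finset.sum_comm]
  refine Finset.sum_congr rfl fun σ _ => ?_
  rw [pd_const_mul (hd σ), pd_prod fun i _ => hA _ _, Finset.mul_sum]
  refine Finset.sum_congr rfl fun j _ => ?_
  rw [← Finset.mul_prod_erase Finset.univ _ (Finset.mem_univ j), Matrix.updateCol_self, mul_comm
    (∏ b ∈ _, _)]
  congr 2
  refine Finset.prod_congr rfl fun i hi => ?_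
  rw [Matrix.updateCol_ne (Finset.ne_of_mem_erase hi)]

end matrix

/-! ### Metric compatibility -/

section metric

variable {n : ℕ} {h : Coord n → Matrix (Fin n) (Fin n) ℝ} {x : Coord n}

lemma inv_symm (hsym : ∀ y i j, h y i j = h y j i) (i j : Fin n) :
    (h x)⁻¹ i j = (h x)⁻¹ j i := by
  have : (h x).transpose = h x := by ext i j; exact hsym x j i
  conv_lhs => rw [← this, ← Matrix.transpose_nonsing_inv]
  rfl

lemma sum_inv_mul (hdet : (h x).det ≠ 0) (i j : Fin n) :
    ∑ k, (h x)⁻¹ i k * h x k j = if i = j then 1 else 0 := by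
  rw [← Matrix.mul_apply, Matrix.nonsing_inv_mul _ (isUnit_iff_ne_zero.mpr hdet), Matrix.one_apply]

lemma sum_mul_inv (hdet : (h x).det ≠ 0) (i j : Fin n) :
    ∑ k, h x i k * (h x)⁻¹ k j = if i = j then 1 else 0 := by
  rw [← Matrix.mul_apply, Matrix.mul_nonsing_inv _ (isUnit_iff_ne_zero.mpr hdet), Matrix.one_apply]

lemma christoffel_symm (hsym : ∀ y i j, h y i j = h y j i) (k i j : Fin n) :
    christoffel h x k i j = christoffel h x k j i := by
  unfold christoffel
  congr 1
  refine Finset.sum_congr rfl fun l _ => ?_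
  rw [show (fun y => h y i j) = fun y => h y j i from funext fun y => hsym y i j]
  ring

/-- The Christoffel symbol with its upper index lowered. -/
lemma sum_mul_christoffel (hdet : (h x).det ≠ 0) (l i j : Fin n) :
    ∑ k, h x l k * christoffel h x k i j = (1 / 2) * (pd i (fun y => h y j l) x
      + pd j (fun y => h y i l) x - pd l (fun y => h y i j) x) := by
  have : ∀ k, h x l k * christoffel h x k i j = ∑ m, (1 / 2) * (h x l k * (h x)⁻¹ k m) *
      (pd i (fun y => h y j m) x + pd j (fun y => h y i m) x - pd m (fun y => h y i j) x) := by
    intro k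
    rw [christoffel, Finset.mul_sum, Finset.mul_sum]
    exact Finset.sum_congr rfl fun m _ => by ring
  simp only [this]
  rw [Finset.sum_comm]
  simp only [← Finset.sum_mul, ← Finset.mul_sum, sum_mul_inv hdet]
  simp

/-- The metric is parallel: `∂_k h_ij = Γ^s_ki h_sj + Γ^s_kj h_is`. -/
lemma pd_metric (hsym : ∀ y i j, h y i j = h y j i) (hdet : (h x).det ≠ 0) (k i j : Fin n) :
    pd k (fun y => h y i j) x
      = ∑ s, (christoffel h x s k i * h x s j + christoffel h x s k j * h x i s) := by
  have h1 := sum_mul_christoffel hdet j k i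
  have h2 := sum_mul_christoffel hdet i k j
  have e : ∀ a b, (fun y => h y a b) = fun y => h y b a := fun a b => funext fun y => hsym y a b
  rw [Finset.sum_add_distrib]
  have h1' : ∑ s, christoffel h x s k i * h x s j = ∑ s, h x j s * christoffel h x s k i :=
    Finset.sum_congr rfl fun s _ => by rw [hsym x s j]; ring
  have h2' : ∑ s, christoffel h x s k j * h x i s = ∑ s, h x i s * christoffel h x s k j :=
    Finset.sum_congr rfl fun s _ => by ring
  rw [h1', h2', h1, h2, e j i, e k i, e k j]
  ring

/-- The inverse metric is parallel: `∂_k h^ij = -Γ^i_ks h^sj - Γ^j_ks h^is`. -/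
lemma pd_inv (hsym : ∀ y i j, h y i j = h y j i) (hdet : (h x).det ≠ 0)
    (hsm : ∀ i j, ContDiffAt ℝ ∞ (fun y => h y i j) x) (k i j : Fin n) :
    pd k (fun y => (h y)⁻¹ i j) x
      = -∑ s, (christoffel h x i k s * (h x)⁻¹ s j + christoffel h x j k s * (h x)⁻¹ i s) := by
  set D : Matrix (Fin n) (Fin n) ℝ := Matrix.of fun a b => pd k (fun y => (h y)⁻¹ a b) x with hD
  set C : Matrix (Fin n) (Fin n) ℝ := Matrix.of fun a b => christoffel h x a k b with hC
  have hu : IsUnit (h x).det := isUnit_iff_ne_zero.mpr hdet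
  have hG : (Matrix.of fun a b => pd k (fun y => h y a b) x) = C.transpose * h x + h x * C := by
    ext a b
    simp only [Matrix.of_apply, Matrix.add_apply, Matrix.mul_apply, Matrix.transpose_apply, hC,
      pd_metric hsym hdet, Finset.sum_add_distrib]
    congr 1
    exact Finset.sum_congr rfl fun s _ => mul_comm _ _
  have d1 : ∀ a b, DifferentiableAt ℝ (fun y => h y a b) x := fun a b =>
    (hsm a b).differentiableAt (by simp)
  have d2 : ∀ a b, DifferentiableAt ℝ (fun y => (h y)⁻¹ a b) x := fun a b =>
    (contDiffAt_inv_apply hsm hdet a b).differentiableAt (by simp)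
  have key : D * h x + (h x)⁻¹ * (C.transpose * h x + h x * C) = 0 := by
    ext a b
    have : pd k (fun y => ∑ m, (h y)⁻¹ a m * h y m b) x = 0 := by
      rw [pd_congr (G := fun _ => if a = b then 1 else 0), pd_const]
      filter_upwards [eventually_det_ne_zero hsm hdet] with y hy
      exact sum_inv_mul hy a b
    rw [pd_sum fun m _ => (d2 a m).fun_mul (d1 m b)] at this
    simp only [pd_mul (d2 _ _) (d1 _ _), Finset.sum_add_distrib] at this
    rw [← hG]
    simpa only [Matrix.add_apply, Matrix.mul_apply, Matrix.of_apply, hD,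
      Matrix.zero_apply] using this
  have h3 : D = -(C * (h x)⁻¹ + (h x)⁻¹ * C.transpose) := by
    have h4 : (D * h x + (h x)⁻¹ * (C.transpose * h x + h x * C)) * (h x)⁻¹ = 0 := by
      rw [key, zero_mul]
    have e1 : (D * h x + (h x)⁻¹ * (C.transpose * h x + h x * C)) * (h x)⁻¹
        = D * (h x * (h x)⁻¹) + (h x)⁻¹ * C.transpose * (h x * (h x)⁻¹)
          + ((h x)⁻¹ * h x) * C * (h x)⁻¹ := by noncomm_ring
    rw [e1, Matrix.mul_nonsing_inv _ hu, Matrix.nonsing_inv_mul _ hu] at h4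
    rw [eq_neg_iff_add_eq_zero, ← h4]
    noncomm_ring
  have h5 := congrFun (congrFun h3 i) j
  simp only [hD, hC, Matrix.of_apply, Matrix.neg_apply, Matrix.add_apply, Matrix.mul_apply,
    Matrix.transpose_apply] at h5
  rw [h5, Finset.sum_add_distrib]
  congr 2
  exact Finset.sum_congr rfl fun s _ => mul_comm _ _

lemma contDiffAt_christoffel (hsm : ∀ i j, ContDiffAt ℝ ∞ (fun y => h y i j) x)
    (hdet : (h x).det ≠ 0) (k i j : Fin n) :
    ContDiffAt ℝ ∞ (fun y => christoffel h y k i j) x := by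
  unfold christoffel
  refine contDiffAt_const.mul (ContDiffAt.sum fun l _ =>
    (contDiffAt_inv_apply hsm hdet k l).mul ?_)
  exact ((contDiffAt_pd (hsm j l) i).add (contDiffAt_pd (hsm i l) j)).sub
    (contDiffAt_pd (hsm i j) l)

lemma contDiffAt_riemannUp (hsm : ∀ i j, ContDiffAt ℝ ∞ (fun y => h y i j) x)
    (hdet : (h x).det ≠ 0) (a b c d : Fin n) :
    ContDiffAt ℝ ∞ (fun y => riemannUp h y a b c d) x := by
  have hΓ := contDiffAt_christoffel hsm hdet
  unfold riemannUp
  exact ((contDiffAt_pd (hΓ a b d) c).sub (contDiffAt_pd (hΓ a b c) d)).add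
    (ContDiffAt.sum fun e _ => ((hΓ _ _ _).mul (hΓ _ _ _)).sub ((hΓ _ _ _).mul (hΓ _ _ _)))

lemma contDiffAt_riemann (hsm : ∀ i j, ContDiffAt ℝ ∞ (fun y => h y i j) x)
    (hdet : (h x).det ≠ 0) (a b c d : Fin n) :
    ContDiffAt ℝ ∞ (fun y => riemann h y a b c d) x := by
  unfold riemann
  exact ContDiffAt.sum fun e _ => (hsm a e).mul (contDiffAt_riemannUp hsm hdet e b c d)

/-- The volume element is parallel: `∂_k √|det h| = Γ^s_ks √|det h|`. -/
lemma pd_sqrt_abs_det (hsym : ∀ y i j, h y i j = h y j i) (hdet : (h x).det ≠ 0)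
    (hsm : ∀ i j, ContDiffAt ℝ ∞ (fun y => h y i j) x) (k : Fin n) :
    pd k (fun y => √|(h y).det|) x = (∑ s, christoffel h x s k s) * √|(h x).det| := by
  set C : Matrix (Fin n) (Fin n) ℝ := Matrix.of fun a b => christoffel h x a k b with hC
  have hG : (Matrix.of fun a b => pd k (fun y => h y a b) x) = C.transpose * h x + h x * C := by
    ext a b
    simp only [Matrix.of_apply, Matrix.add_apply, Matrix.mul_apply, Matrix.transpose_apply, hC,
      pd_metric hsym hdet, Finset.sum_add_distrib]
    congr 1
    exact Finset.sum_congr rfl fun s _ => mul_comm _ _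
  have hd : DifferentiableAt ℝ (fun y => (h y).det) x :=
    (contDiffAt_det hsm).differentiableAt (by simp)
  have hp : pd k (fun y => (h y).det) x = (h x).det * (2 * C.trace) := by
    rw [pd_det (fun i j => (hsm i j).differentiableAt (by simp)), hG, mul_add, Matrix.trace_add,
      ← mul_assoc, Matrix.trace_mul_comm, ← mul_assoc, Matrix.mul_adjugate, ← mul_assoc,
      Matrix.adjugate_mul]
    simp only [Matrix.smul_mul, Matrix.one_mul, Matrix.trace_smul, Matrix.trace_transpose,
      smul_eq_mul]
    ring
  have hpos : 0 < |(h x).det| := abs_pos.mpr hdet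
  have h1 := (hd.hasFDerivAt.abs hdet).sqrt hpos.ne'
  rw [pd, h1.fderiv]
  have hp' : fderiv ℝ (fun y => (h y).det) x (EuclideanSpace.single k 1)
    = (h x).det * (2 * C.trace) := hp
  simp only [smul_apply, hp', smul_eq_mul]
  have hs : (SignType.sign (h x).det : ℝ) * (h x).det = |(h x).det| := sign_mul_self _
  have hq : √|(h x).det| * √|(h x).det| = |(h x).det| := Real.mul_self_sqrt hpos.le
  have hq0 : √|(h x).det| ≠ 0 := (Real.sqrt_pos.mpr hpos).ne'
  have ht : ∑ s, christoffel h x s k s = C.trace := rfl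
  rw [ht]
  field_simp
  linear_combination (C.trace) * hs - C.trace * hq

end metric

/-! ### The Bianchi identities -/

section curvature

variable {n : ℕ}

/-- The entrywise partial derivative of a matrix-valued function. -/
def matrixPd {ι : Type*} (k : Fin n) (A : Coord n → Matrix ι ι ℝ) (x : Coord n) : Matrix ι ι ℝ :=
  Matrix.of fun a b => pd k (fun y => A y a b) x

/-- The matrix `(Γ_c)^a_b = Γ^a_cb` of the connection in the direction `c`. -/
def connMatrix (h : Coord n → Matrix (Fin n) (Fin n) ℝ) (c : Fin n) (x : Coord n) :
    Matrix (Fin n) (Fin n) ℝ :=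
  Matrix.of fun a b => christoffel h x a c b

/-- The curvature as a matrix-valued two-form, `(R_cd)^a_b = R^a_bcd`. -/
def curvMatrix (h : Coord n → Matrix (Fin n) (Fin n) ℝ) (c d : Fin n) (x : Coord n) :
    Matrix (Fin n) (Fin n) ℝ :=
  Matrix.of fun a b => riemannUp h x a b c d

section matrixPd

variable {ι : Type*} {A B : Coord n → Matrix ι ι ℝ} {x : Coord n}

lemma matrixPd_congr (h : ∀ᶠ y in 𝓝 x, A y = B y) (k : Fin n) :
    matrixPd k A x = matrixPd k B x := by
  ext a b
  exact pd_congr (h.mono fun y hy => by rw [hy]) k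

lemma matrixPd_add (hA : ∀ a b, ContDiffAt ℝ ∞ (fun y => A y a b) x)
    (hB : ∀ a b, ContDiffAt ℝ ∞ (fun y => B y a b) x) (k : Fin n) :
    matrixPd k (fun y => A y + B y) x = matrixPd k A x + matrixPd k B x := by
  ext a b
  exact pd_add ((hA a b).differentiableAt (by simp)) ((hB a b).differentiableAt (by simp)) k

lemma matrixPd_sub (hA : ∀ a b, ContDiffAt ℝ ∞ (fun y => A y a b) x)
    (hB : ∀ a b, ContDiffAt ℝ ∞ (fun y => B y a b) x) (k : Fin n) :
    matrixPd k (fun y => A y - B y) x = matrixPd k A x - matrixPd k B x := by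
  ext a b
  exact pd_sub ((hA a b).differentiableAt (by simp)) ((hB a b).differentiableAt (by simp)) k

lemma matrixPd_transpose (k : Fin n) :
    matrixPd k (fun y => (A y).transpose) x = (matrixPd k A x).transpose := rfl

lemma matrixPd_comm (hA : ∀ a b, ContDiffAt ℝ ∞ (fun y => A y a b) x) (k l : Fin n) :
    matrixPd k (matrixPd l A) x = matrixPd l (matrixPd k A) x := by
  ext a b
  exact pd_comm (hA a b) k l

lemma contDiffAt_matrixPd (hA : ∀ a b, ContDiffAt ℝ ∞ (fun y => A y a b) x) (k : Fin n) (a b : ι) :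
    ContDiffAt ℝ ∞ (fun y => matrixPd k A y a b) x :=
  contDiffAt_pd (hA a b) k

variable [Fintype ι]

lemma contDiffAt_matrix_mul (hA : ∀ a b, ContDiffAt ℝ ∞ (fun y => A y a b) x)
    (hB : ∀ a b, ContDiffAt ℝ ∞ (fun y => B y a b) x) (a b : ι) :
    ContDiffAt ℝ ∞ (fun y => (A y * B y) a b) x := by
  simp only [Matrix.mul_apply]
  exact ContDiffAt.sum fun c _ => (hA a c).mul (hB c b)

lemma matrixPd_mul (hA : ∀ a b, ContDiffAt ℝ ∞ (fun y => A y a b) x)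
    (hB : ∀ a b, ContDiffAt ℝ ∞ (fun y => B y a b) x) (k : Fin n) :
    matrixPd k (fun y => A y * B y) x = matrixPd k A x * B x + A x * matrixPd k B x := by
  have dA := fun a b => (hA a b).differentiableAt (by simp)
  have dB := fun a b => (hB a b).differentiableAt (by simp)
  ext a b
  simp only [matrixPd, Matrix.of_apply, Matrix.add_apply, Matrix.mul_apply]
  rw [pd_sum fun c _ => (dA a c).fun_mul (dB c b), ← Finset.sum_add_distrib]
  exact Finset.sum_congr rfl fun c _ => pd_mul (dA a c) (dB c b) k

end matrixPd

variable {h : Coord n → Matrix (Fin n) (Fin n) ℝ} {x : Coord n}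

/-- The structure equation `R_cd = ∂_c Γ_d - ∂_d Γ_c + [Γ_c, Γ_d]`. -/
lemma curvMatrix_eq (hsym : ∀ y i j, h y i j = h y j i) (c d : Fin n) (x : Coord n) :
    curvMatrix h c d x = matrixPd c (connMatrix h d) x - matrixPd d (connMatrix h c) x
      + (connMatrix h c x * connMatrix h d x - connMatrix h d x * connMatrix h c x) := by
  ext a b
  simp only [curvMatrix, connMatrix, matrixPd, Matrix.of_apply, Matrix.add_apply,
    Matrix.sub_apply, Matrix.mul_apply, riemannUp, ← Finset.sum_sub_distrib]
  have e : ∀ d, (fun y => christoffel h y a b d) = fun y => christoffel h y a d b :=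
    fun d => funext fun y => christoffel_symm hsym a b d
  rw [e, e]
  congr 1
  refine Finset.sum_congr rfl fun s _ => ?_
  rw [christoffel_symm hsym s b d, christoffel_symm hsym s b c]

lemma matrixPd_metric (hsym : ∀ y i j, h y i j = h y j i) (hdet : (h x).det ≠ 0) (k : Fin n) :
    matrixPd k h x = (connMatrix h k x).transpose * h x + h x * connMatrix h k x := by
  ext a b
  simp only [matrixPd, connMatrix, Matrix.of_apply, Matrix.add_apply, Matrix.mul_apply,
    Matrix.transpose_apply, pd_metric hsym hdet, Finset.sum_add_distrib]
  congr 1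
  exact Finset.sum_congr rfl fun s _ => mul_comm _ _

lemma matrixPd_inv (hsym : ∀ y i j, h y i j = h y j i) (hdet : (h x).det ≠ 0)
    (hsm : ∀ i j, ContDiffAt ℝ ∞ (fun y => h y i j) x) (k : Fin n) :
    matrixPd k (fun y => (h y)⁻¹) x
      = -(connMatrix h k x * (h x)⁻¹ + (h x)⁻¹ * (connMatrix h k x).transpose) := by
  ext a b
  simp only [matrixPd, connMatrix, Matrix.of_apply, Matrix.add_apply, Matrix.mul_apply,
    Matrix.transpose_apply, Matrix.neg_apply, pd_inv hsym hdet hsm, Finset.sum_add_distrib]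
  congr 2
  exact Finset.sum_congr rfl fun s _ => mul_comm _ _

/-- The second Bianchi identity `D_[e R_cd] = 0`, where `D_e R = ∂_e R + [Γ_e, R]`. -/
lemma second_bianchi (hsym : ∀ y i j, h y i j = h y j i) (hdet : (h x).det ≠ 0)
    (hsm : ∀ i j, ContDiffAt ℝ ∞ (fun y => h y i j) x) (e c d : Fin n) :
    (matrixPd e (curvMatrix h c d) x
        + (connMatrix h e x * curvMatrix h c d x - curvMatrix h c d x * connMatrix h e x))
      + (matrixPd c (curvMatrix h d e) x
        + (connMatrix h c x * curvMatrix h d e x - curvMatrix h d e x * connMatrix h c x))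
      + (matrixPd d (curvMatrix h e c) x
        + (connMatrix h d x * curvMatrix h e c x - curvMatrix h e c x * connMatrix h d x)) = 0 := by
  have hΓ : ∀ c a b, ContDiffAt ℝ ∞ (fun y => connMatrix h c y a b) x :=
    fun c a b => contDiffAt_christoffel hsm hdet a c b
  have hM : ∀ c d a b, ContDiffAt ℝ ∞ (fun y => (connMatrix h c y * connMatrix h d y) a b) x :=
    fun c d => contDiffAt_matrix_mul (hΓ c) (hΓ d)
  have hP : ∀ c d a b, ContDiffAt ℝ ∞ (fun y => matrixPd c (connMatrix h d) y a b) x :=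
    fun c d => contDiffAt_matrixPd (hΓ d) c
  have key : ∀ e c d, matrixPd e (curvMatrix h c d) x =
      matrixPd e (matrixPd c (connMatrix h d)) x - matrixPd e (matrixPd d (connMatrix h c)) x
      + (matrixPd e (connMatrix h c) x * connMatrix h d x
          + connMatrix h c x * matrixPd e (connMatrix h d) x
        - (matrixPd e (connMatrix h d) x * connMatrix h c x
          + connMatrix h d x * matrixPd e (connMatrix h c) x)) := by
    intro e c d
    rw [show curvMatrix h c d = _ from funext (curvMatrix_eq hsym c d),
      matrixPd_add (A := fun y => matrixPd c (connMatrix h d) y - matrixPd d (connMatrix h c) y)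
        (B := fun y => connMatrix h c y * connMatrix h d y - connMatrix h d y * connMatrix h c y)
        (fun a b => (hP c d a b).sub (hP d c a b))
        (fun a b => (hM c d a b).sub (hM d c a b)),
      matrixPd_sub (hP c d) (hP d c), matrixPd_sub (hM c d) (hM d c),
      matrixPd_mul (hΓ c) (hΓ d), matrixPd_mul (hΓ d) (hΓ c)]
  rw [key, key, key, matrixPd_comm (hΓ d) e c, matrixPd_comm (hΓ c) d e, matrixPd_comm (hΓ e) c d,
    curvMatrix_eq hsym, curvMatrix_eq hsym, curvMatrix_eq hsym]
  noncomm_ring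

lemma riemannUp_antisymm_right (a b c d : Fin n) :
    riemannUp h x a b c d = -riemannUp h x a b d c := by
  simp only [riemannUp, Finset.sum_sub_distrib]
  ring

lemma riemann_antisymm_right (a b c d : Fin n) : riemann h x a b c d = -riemann h x a b d c := by
  simp only [riemann, riemannUp_antisymm_right _ b c d, mul_neg, Finset.sum_neg_distrib]

/-- The curvature is skew with respect to the metric, since the second partial derivatives of the
metric commute. -/
lemma riemann_antisymm_left (hsym : ∀ y i j, h y i j = h y j i) (hdet : (h x).det ≠ 0)
    (hsm : ∀ i j, ContDiffAt ℝ ∞ (fun y => h y i j) x) (a b c d : Fin n) :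
    riemann h x a b c d = -riemann h x b a c d := by
  have hΓ : ∀ c a b, ContDiffAt ℝ ∞ (fun y => connMatrix h c y a b) x :=
    fun c a b => contDiffAt_christoffel hsm hdet a c b
  have hΓt : ∀ c a b, ContDiffAt ℝ ∞ (fun y => (connMatrix h c y).transpose a b) x :=
    fun c a b => hΓ c b a
  have key : ∀ c d, matrixPd c (matrixPd d h) x =
      (matrixPd c (connMatrix h d) x).transpose * h x
        + (connMatrix h d x).transpose *
          ((connMatrix h c x).transpose * h x + h x * connMatrix h c x)
        + (((connMatrix h c x).transpose * h x + h x * connMatrix h c x) * connMatrix h d x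
          + h x * matrixPd c (connMatrix h d) x) := by
    intro c d
    rw [matrixPd_congr ((eventually_det_ne_zero hsm hdet).mono fun y hy =>
        matrixPd_metric hsym hy d) c,
      matrixPd_add (contDiffAt_matrix_mul (hΓt d) hsm) (contDiffAt_matrix_mul hsm (hΓ d)),
      matrixPd_mul (hΓt d) hsm, matrixPd_mul hsm (hΓ d), matrixPd_transpose,
      matrixPd_metric hsym hdet]
  have h0 : h x * curvMatrix h c d x + (curvMatrix h c d x).transpose * h x = 0 := by
    have h1 := matrixPd_comm hsm c d
    rw [key, key, ← sub_eq_zero] at h1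
    rw [curvMatrix_eq hsym, ← h1]
    simp only [Matrix.transpose_add, Matrix.transpose_sub, Matrix.transpose_mul]
    noncomm_ring
  have h2 := congrFun (congrFun h0 a) b
  simp only [Matrix.add_apply, Matrix.mul_apply, Matrix.transpose_apply, curvMatrix,
    Matrix.of_apply, Matrix.zero_apply] at h2
  rw [eq_neg_iff_add_eq_zero, ← h2]
  simp only [riemann]
  congr 1
  exact Finset.sum_congr rfl fun s _ => by rw [hsym, mul_comm]

/-- The covariant derivative `∇_l R^a_bcd`. -/
def covRiemannUp (h : Coord n → Matrix (Fin n) (Fin n) ℝ) (x : Coord n) (l a b c d : Fin n) : ℝ :=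
  pd l (fun y => riemannUp h y a b c d) x
    + ∑ s, (christoffel h x a l s * riemannUp h x s b c d
      - christoffel h x s l b * riemannUp h x a s c d
      - christoffel h x s l c * riemannUp h x a b s d
      - christoffel h x s l d * riemannUp h x a b c s)

/-- The contracted Bianchi identity: the curvature of an Einstein metric is divergence free. -/
lemma sum_covRiemannUp (hsym : ∀ y i j, h y i j = h y j i) (hdet : (h x).det ≠ 0)
    (hsm : ∀ i j, ContDiffAt ℝ ∞ (fun y => h y i j) x) {Λ : ℝ}
    (hric : ∀ᶠ y in 𝓝 x, ∀ i j, ricci h y i j = Λ * h y i j) (b c d : Fin n) :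
    ∑ a, covRiemannUp h x a a b c d = 0 := by
  have hR := fun a b c d =>
    (contDiffAt_riemannUp hsm hdet a b c d).differentiableAt (by simp)
  -- The trace of `D_c R_d·` is `-∇_c R_bd`, up to the connection term for the traced form index.
  have htr : ∀ c d, ∑ a, (matrixPd c (curvMatrix h d a) x
        + (connMatrix h c x * curvMatrix h d a x - curvMatrix h d a x * connMatrix h c x)) a b
      = -(Λ * ∑ s, christoffel h x s c d * h x b s)
        + ∑ a, ∑ s, christoffel h x a c s * riemannUp h x s b d a := by
    intro c d
    have e1 : ∑ a, pd c (fun y => riemannUp h y a b d a) x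
        = -(Λ * ∑ s, (christoffel h x s c b * h x s d + christoffel h x s c d * h x b s)) := by
      have : ∑ a, pd c (fun y => riemannUp h y a b d a) x = pd c (fun y => -ricci h y b d) x := by
        rw [← pd_sum fun a _ => hR a b d a]
        congr 1
        funext y
        rw [ricci, ← Finset.sum_neg_distrib]
        exact Finset.sum_congr rfl fun a _ => riemannUp_antisymm_right _ _ _ _
      rw [this, pd_neg, pd_congr (hric.mono fun y hy => hy b d),
        pd_const_mul ((hsm b d).differentiableAt (by simp)), pd_metric hsym hdet]
    have e2 : ∑ a, ∑ s, riemannUp h x a s d a * christoffel h x s c b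
        = -(Λ * ∑ s, christoffel h x s c b * h x s d) := by
      rw [Finset.sum_comm, Finset.mul_sum, ← Finset.sum_neg_distrib]
      refine Finset.sum_congr rfl fun s _ => ?_
      rw [← Finset.sum_mul]
      have : ∑ a, riemannUp h x a s d a = -(Λ * h x s d) := by
        rw [← hric.self_of_nhds s d, ricci, ← Finset.sum_neg_distrib]
        exact Finset.sum_congr rfl fun a _ => riemannUp_antisymm_right _ _ _ _
      rw [this]; ring
    simp only [matrixPd, curvMatrix, connMatrix, Matrix.add_apply, Matrix.sub_apply,
      Matrix.of_apply, Matrix.mul_apply, Finset.sum_add_distrib, Finset.sum_sub_distrib, e1, e2]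
    ring
  have hB : ∑ a, ((matrixPd a (curvMatrix h c d) x
        + (connMatrix h a x * curvMatrix h c d x - curvMatrix h c d x * connMatrix h a x)) a b
      + (matrixPd c (curvMatrix h d a) x
        + (connMatrix h c x * curvMatrix h d a x - curvMatrix h d a x * connMatrix h c x)) a b
      - (matrixPd d (curvMatrix h c a) x
        + (connMatrix h d x * curvMatrix h c a x - curvMatrix h c a x * connMatrix h d x)) a b)
      = 0 := by
    refine Finset.sum_eq_zero fun a _ => ?_
    have h1 := congrFun (congrFun (second_bianchi hsym hdet hsm a c d) a) b
    have h2 : curvMatrix h a c = fun y => -curvMatrix h c a y := by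
      funext y; ext i j; exact riemannUp_antisymm_right _ _ _ _
    have h3 : matrixPd d (fun y => -curvMatrix h c a y) x = -matrixPd d (curvMatrix h c a) x := by
      ext i j; exact pd_neg d
    rw [h2, h3] at h1
    simp only [Matrix.add_apply, Matrix.sub_apply, Matrix.neg_apply, Matrix.zero_apply,
      Matrix.mul_neg, Matrix.neg_mul] at h1 ⊢
    linarith
  rw [Finset.sum_sub_distrib, Finset.sum_add_distrib, htr, htr] at hB
  have e3 : ∑ s, christoffel h x s c d * h x b s = ∑ s, christoffel h x s d c * h x b s :=
    Finset.sum_congr rfl fun s _ => by rw [christoffel_symm hsym]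
  have e4 : ∀ c d, ∑ a, ∑ s, christoffel h x a c s * riemannUp h x s b d a
      = ∑ a, ∑ s, christoffel h x s a c * riemannUp h x a b d s := by
    intro c d
    rw [Finset.sum_comm]
    exact Finset.sum_congr rfl fun s _ => Finset.sum_congr rfl fun a _ => by
      rw [christoffel_symm hsym]
  rw [e3, e4, e4] at hB
  have e5 : ∑ a, ∑ s, christoffel h x s a c * riemannUp h x a b s d
      = -∑ a, ∑ s, christoffel h x s a c * riemannUp h x a b d s := by
    simp only [riemannUp_antisymm_right _ b _ d, mul_neg, Finset.sum_neg_distrib]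
  rw [← hB]
  simp only [covRiemannUp, matrixPd, curvMatrix, connMatrix, Matrix.add_apply, Matrix.sub_apply,
    Matrix.of_apply, Matrix.mul_apply, Finset.sum_add_distrib, Finset.sum_sub_distrib, e5]
  have e6 : ∑ a, ∑ s, riemannUp h x a s c d * christoffel h x s a b
      = ∑ a, ∑ s, christoffel h x s a b * riemannUp h x a s c d := by simp only [mul_comm]
  rw [e6]
  ring

end curvature

/-! ### Divergence-free Weyl tensors -/

section covDeriv

variable {n : ℕ}

/-- The covariant derivative `∇_l T_abcd` of a covariant tensor of rank four. -/
def covDeriv (h : Coord n → Matrix (Fin n) (Fin n) ℝ)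
    (T : Coord n → Fin n → Fin n → Fin n → Fin n → ℝ) (x : Coord n) (l a b c d : Fin n) : ℝ :=
  pd l (fun y => T y a b c d) x
    - ∑ s, (christoffel h x s l a * T x s b c d + christoffel h x s l b * T x a s c d
      + christoffel h x s l c * T x a b s d + christoffel h x s l d * T x a b c s)

variable {h : Coord n → Matrix (Fin n) (Fin n) ℝ} {x : Coord n}
  {T S : Coord n → Fin n → Fin n → Fin n → Fin n → ℝ}

lemma covDeriv_congr (hTS : ∀ᶠ y in 𝓝 x, ∀ a b c d, T y a b c d = S y a b c d)
    (l a b c d : Fin n) : covDeriv h T x l a b c d = covDeriv h S x l a b c d := by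
  simp only [covDeriv, hTS.self_of_nhds]
  rw [pd_congr (hTS.mono fun y hy => hy a b c d)]

lemma covDeriv_sub_mul (hT : ∀ a b c d, DifferentiableAt ℝ (fun y => T y a b c d) x)
    (hS : ∀ a b c d, DifferentiableAt ℝ (fun y => S y a b c d) x) (r : ℝ) (l a b c d : Fin n) :
    covDeriv h (fun y a b c d => T y a b c d - r * S y a b c d) x l a b c d
      = covDeriv h T x l a b c d - r * covDeriv h S x l a b c d := by
  simp only [covDeriv]
  rw [pd_sub (hT a b c d) ((hS a b c d).const_mul r), pd_const_mul (hS a b c d)]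
  simp only [mul_sub, Finset.sum_add_distrib, Finset.sum_sub_distrib, mul_left_comm _ r,
    ← Finset.mul_sum]
  ring

lemma covDeriv_antisymm_left (hT : ∀ᶠ y in 𝓝 x, ∀ a b c d, T y a b c d = -T y b a c d)
    (l a b c d : Fin n) : covDeriv h T x l a b c d = -covDeriv h T x l b a c d := by
  have h0 := hT.self_of_nhds
  simp only [covDeriv]
  rw [pd_congr (hT.mono fun y hy => hy a b c d), pd_neg]
  have : ∀ s, christoffel h x s l a * T x s b c d + christoffel h x s l b * T x a s c d
      + christoffel h x s l c * T x a b s d + christoffel h x s l d * T x a b c s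
      = -(christoffel h x s l b * T x s a c d + christoffel h x s l a * T x b s c d
      + christoffel h x s l c * T x b a s d + christoffel h x s l d * T x b a c s) := by
    intro s
    rw [h0 s b, h0 a s, h0 a b s d, h0 a b c s]
    ring
  simp only [this, Finset.sum_neg_distrib]
  ring

/-- Lowering an index commutes with the covariant derivative, since the metric is parallel. -/
lemma covDeriv_riemann (hsym : ∀ y i j, h y i j = h y j i) (hdet : (h x).det ≠ 0)
    (hsm : ∀ i j, ContDiffAt ℝ ∞ (fun y => h y i j) x) (l a b c d : Fin n) :
    covDeriv h (riemann h) x l a b c d = ∑ e, h x a e * covRiemannUp h x l e b c d := by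
  have dh := fun a b => (hsm a b).differentiableAt (by simp)
  have dR := fun a b c d =>
    (contDiffAt_riemannUp hsm hdet a b c d).differentiableAt (by simp)
  have e1 : pd l (fun y => riemann h y a b c d) x
      = ∑ s, christoffel h x s l a * riemann h x s b c d
        + ∑ e, ∑ s, h x a e * (christoffel h x e l s * riemannUp h x s b c d)
        + ∑ e, h x a e * pd l (fun y => riemannUp h y e b c d) x := by
    simp only [riemann]
    rw [pd_sum fun e _ => (dh a e).fun_mul (dR e b c d)]
    simp only [pd_mul (dh _ _) (dR _ _ _ _), pd_metric hsym hdet, Finset.sum_add_distrib, add_mul,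
      Finset.sum_mul, Finset.mul_sum]
    congr 1
    congr 1
    · rw [Finset.sum_comm]
      exact Finset.sum_congr rfl fun _ _ => Finset.sum_congr rfl fun _ _ => by ring
    · rw [Finset.sum_comm]
      exact Finset.sum_congr rfl fun _ _ => Finset.sum_congr rfl fun _ _ => by ring
  have e2 : ∀ (F : Fin n → ℝ) (R : Fin n → Fin n → ℝ),
      ∑ s, F s * ∑ e, h x a e * R s e = ∑ e, ∑ s, h x a e * (F s * R s e) := by
    intro F R
    simp only [Finset.mul_sum]
    rw [Finset.sum_comm]
    exact Finset.sum_congr rfl fun _ _ => Finset.sum_congr rfl fun _ _ => by ring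
  rw [covDeriv, e1]
  simp only [Finset.sum_add_distrib]
  simp only [covRiemannUp, mul_add, Finset.sum_add_distrib, Finset.sum_sub_distrib, mul_sub,
    Finset.mul_sum]
  rw [show ∑ s, christoffel h x s l b * riemann h x a s c d = _ from
      e2 (fun s => christoffel h x s l b) (fun s e => riemannUp h x e s c d),
    show ∑ s, christoffel h x s l c * riemann h x a b s d = _ from
      e2 (fun s => christoffel h x s l c) (fun s e => riemannUp h x e b s d),
    show ∑ s, christoffel h x s l d * riemann h x a b c s = _ from
      e2 (fun s => christoffel h x s l d) (fun s e => riemannUp h x e b c s)]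
  ring

/-- The curvature of an Einstein metric is divergence free, with all indices lowered. -/
lemma div_riemann (hsym : ∀ y i j, h y i j = h y j i) (hdet : (h x).det ≠ 0)
    (hsm : ∀ i j, ContDiffAt ℝ ∞ (fun y => h y i j) x) {Λ : ℝ}
    (hric : ∀ᶠ y in 𝓝 x, ∀ i j, ricci h y i j = Λ * h y i j) (b c d : Fin n) :
    ∑ l, ∑ a, (h x)⁻¹ l a * covDeriv h (riemann h) x l a b c d = 0 := by
  rw [← sum_covRiemannUp hsym hdet hsm hric b c d]
  refine Finset.sum_congr rfl fun l _ => ?_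
  simp only [covDeriv_riemann hsym hdet hsm, Finset.mul_sum, ← mul_assoc]
  rw [Finset.sum_comm]
  simp only [← Finset.sum_mul, sum_inv_mul hdet]
  simp

/-- The curvature tensor of constant curvature is parallel. -/
lemma covDeriv_metric_metric (hsym : ∀ y i j, h y i j = h y j i) (hdet : (h x).det ≠ 0)
    (hsm : ∀ i j, ContDiffAt ℝ ∞ (fun y => h y i j) x) (l a b c d : Fin n) :
    covDeriv h (fun y a b c d => h y a c * h y b d - h y a d * h y b c) x l a b c d = 0 := by
  have dh := fun a b => (hsm a b).differentiableAt (by simp)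
  simp only [covDeriv]
  rw [pd_sub ((dh _ _).fun_mul (dh _ _)) ((dh _ _).fun_mul (dh _ _)), pd_mul (dh _ _) (dh _ _),
    pd_mul (dh _ _) (dh _ _)]
  simp only [pd_metric hsym hdet, Finset.sum_mul, Finset.mul_sum, ← Finset.sum_add_distrib,
    ← Finset.sum_sub_distrib]
  exact Finset.sum_eq_zero fun s _ => by ring

end covDeriv

section weyl

variable {g : Coord 4 → Matrix (Fin 4) (Fin 4) ℝ} {y : Coord 4} {Λ : ℝ}

/-- Contracting the vacuum equations gives `R_μν = Λ g_μν`. -/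
lemma scalarCurvature_and_ricci_of_vacuum (hsym : ∀ y i j, g y i j = g y j i)
    (hdet : (g y).det ≠ 0)
    (hvac : ∀ μ ν, ricci g y μ ν - (1 / 2) * scalarCurvature g y * g y μ ν + Λ * g y μ ν = 0) :
    scalarCurvature g y = 4 * Λ ∧ ∀ μ ν, ricci g y μ ν = Λ * g y μ ν := by
  -- The trace of the metric is the dimension.
  have htr : ∑ μ, ∑ ν, (g y)⁻¹ μ ν * g y μ ν = 4 := by
    have : ∀ μ, ∑ ν, (g y)⁻¹ μ ν * g y μ ν = 1 := fun μ => by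
      simpa [hsym y _ μ] using sum_inv_mul hdet μ μ
    simp [this]
  have hR : scalarCurvature g y = ((1 / 2) * scalarCurvature g y - Λ) * 4 := by
    rw [← htr, Finset.mul_sum]
    conv_lhs => rw [scalarCurvature]
    refine Finset.sum_congr rfl fun μ _ => ?_
    rw [Finset.mul_sum]
    refine Finset.sum_congr rfl fun ν _ => ?_
    linear_combination (g y)⁻¹ μ ν * hvac μ ν
  have hR' : scalarCurvature g y = 4 * Λ := by linarith
  refine ⟨hR', fun μ ν => ?_⟩
  have := hvac μ ν
  rw [hR'] at this
  linarith

/-- In vacuum, the Weyl tensor is the Riemann tensor minus one of constant curvature `Λ / 3`. -/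
lemma weyl_of_vacuum (hsym : ∀ y i j, g y i j = g y j i)
    (hdet : (g y).det ≠ 0)
    (hvac : ∀ μ ν, ricci g y μ ν - (1 / 2) * scalarCurvature g y * g y μ ν + Λ * g y μ ν = 0)
    (α β μ ν : Fin 4) :
    weyl g y α β μ ν
      = riemann g y α β μ ν - Λ / 3 * (g y α μ * g y β ν - g y α ν * g y β μ) := by
  obtain ⟨h1, h2⟩ := scalarCurvature_and_ricci_of_vacuum hsym hdet hvac
  rw [weyl, h1]
  simp only [h2]
  rw [hsym y ν β, hsym y μ β, hsym y ν α, hsym y μ α]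
  ring

lemma weyl_antisymm_right (α β μ ν : Fin 4) : weyl g y α β μ ν = -weyl g y α β ν μ := by
  rw [weyl, weyl, riemann_antisymm_right]
  ring

lemma weyl_antisymm_left (hsym : ∀ y i j, g y i j = g y j i) (hdet : (g y).det ≠ 0)
    (hsm : ∀ i j, ContDiffAt ℝ ∞ (fun z => g z i j) y) (α β μ ν : Fin 4) :
    weyl g y α β μ ν = -weyl g y β α μ ν := by
  rw [weyl, weyl, riemann_antisymm_left hsym hdet hsm, hsym y ν β, hsym y ν α, hsym y μ β,
    hsym y μ α]
  ring

lemma contDiffAt_weyl (hdet : (g y).det ≠ 0)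
    (hsm : ∀ i j, ContDiffAt ℝ ∞ (fun z => g z i j) y) (α β μ ν : Fin 4) :
    ContDiffAt ℝ ∞ (fun z => weyl g z α β μ ν) y := by
  have hric : ∀ i j, ContDiffAt ℝ ∞ (fun z => ricci g z i j) y := fun i j =>
    ContDiffAt.sum fun a _ => contDiffAt_riemannUp hsm hdet a i a j
  have hsc : ContDiffAt ℝ ∞ (fun z => scalarCurvature g z) y :=
    ContDiffAt.sum fun a _ => ContDiffAt.sum fun b _ =>
      (contDiffAt_inv_apply hsm hdet a b).mul (hric a b)
  have hR := contDiffAt_riemann hsm hdet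
  unfold weyl
  fun_prop

/-- The Weyl tensor of a vacuum metric is divergence free. -/
lemma div_weyl (hsym : ∀ y i j, g y i j = g y j i) (hdet : (g y).det ≠ 0)
    (hsm : ∀ i j, ContDiffAt ℝ ∞ (fun z => g z i j) y)
    (hvac : ∀ᶠ z in 𝓝 y, ∀ μ ν,
      ricci g z μ ν - (1 / 2) * scalarCurvature g z * g z μ ν + Λ * g z μ ν = 0)
    (b c d : Fin 4) :
    ∑ l, ∑ a, (g y)⁻¹ l a * covDeriv g (weyl g) y l a b c d = 0 := by
  have hev := (eventually_det_ne_zero hsm hdet).and hvac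
  have hric : ∀ᶠ z in 𝓝 y, ∀ i j, ricci g z i j = Λ * g z i j :=
    hev.mono fun z hz => (scalarCurvature_and_ricci_of_vacuum hsym hz.1 hz.2).2
  have dh := fun a b => (hsm a b).differentiableAt (by simp)
  have key : ∀ l a, covDeriv g (weyl g) y l a b c d = covDeriv g (riemann g) y l a b c d := by
    intro l a
    rw [covDeriv_congr (hev.mono fun z hz => weyl_of_vacuum hsym hz.1 hz.2),
      covDeriv_sub_mul (T := riemann g)
        (S := fun y a b c d => g y a c * g y b d - g y a d * g y b c)
        (fun a b c d => (contDiffAt_riemann hsm hdet a b c d).differentiableAt (by simp))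
        (fun a b c d => ((dh _ _).fun_mul (dh _ _)).fun_sub ((dh _ _).fun_mul (dh _ _))),
      covDeriv_metric_metric hsym hdet hsm, mul_zero, sub_zero]
  simp only [key]
  exact div_riemann hsym hdet hsm hric b c d

end weyl

/-! ### The Levi-Civita tensor is parallel -/

section leviCivita

variable {n : ℕ}

/-- A matrix acts on the top-degree form `permSymbol` as a derivation by its trace. -/
lemma sum_permSymbol_update (C : Matrix (Fin n) (Fin n) ℝ) (a : Fin n → Fin n) :
    ∑ i, ∑ s, C s (a i) * permSymbol (Function.update a i s) = C.trace * permSymbol a := by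
  set P : Matrix (Fin n) (Fin n) ℝ := (1 : Matrix (Fin n) (Fin n) ℝ).submatrix a id with hP
  have hdet : ∀ i s, permSymbol (Function.update a i s) = P.adjugate s i := by
    intro i s
    rw [permSymbol, Matrix.adjugate_apply]
    congr 1
    ext j k
    by_cases hj : j = i
    · subst hj; simp [Matrix.one_apply, Pi.single_apply, eq_comm]
    · rw [Matrix.updateRow_ne hj, Matrix.submatrix_apply, hP, Matrix.submatrix_apply,
        Function.update_of_ne hj]
  have hC : ∀ i s, C s (a i) = (P * C.transpose) i s := by
    intro i s
    simp [hP, Matrix.mul_apply, Matrix.one_apply]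
  have : ∑ i, ∑ s, C s (a i) * permSymbol (Function.update a i s)
      = (P * C.transpose * P.adjugate).trace := by
    simp only [hdet, hC]
    rfl
  rw [this, mul_assoc, Matrix.trace_mul_comm, mul_assoc, Matrix.adjugate_mul, Matrix.mul_smul,
    Matrix.trace_smul, Matrix.mul_one, Matrix.trace_transpose, smul_eq_mul, mul_comm]
  rfl

variable {h : Coord n → Matrix (Fin n) (Fin n) ℝ} {x : Coord n}

lemma contDiffAt_sqrt_abs_det (hdet : (h x).det ≠ 0)
    (hsm : ∀ i j, ContDiffAt ℝ ∞ (fun y => h y i j) x) :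
    ContDiffAt ℝ ∞ (fun y => √|(h y).det|) x :=
  ((contDiffAt_det hsm).abs hdet).sqrt (abs_ne_zero.mpr hdet)

/-- The Levi-Civita tensor is parallel. -/
lemma pd_leviCivita (hsym : ∀ y i j, h y i j = h y j i) (hdet : (h x).det ≠ 0)
    (hsm : ∀ i j, ContDiffAt ℝ ∞ (fun y => h y i j) x) (s : ℤˣ) (l : Fin n) (a : Fin n → Fin n) :
    pd l (fun y => leviCivita h y s a) x
      = ∑ i, ∑ r, christoffel h x r l (a i) * leviCivita h x s (Function.update a i r) := by
  have hd := (contDiffAt_sqrt_abs_det hdet hsm).differentiableAt (by simp)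
  have h1 : pd l (fun y => leviCivita h y s a) x
      = (((s : ℤ) : ℝ) * permSymbol a) * pd l (fun y => √|(h y).det|) x := by
    rw [← pd_const_mul hd]
    congr 1
    funext y
    rw [leviCivita]; ring
  have h2 := sum_permSymbol_update (connMatrix h l x) a
  rw [h1, pd_sqrt_abs_det hsym hdet hsm,
    show ∑ r, christoffel h x r l r = (connMatrix h l x).trace from rfl,
    show ((s : ℤ) : ℝ) * permSymbol a * ((connMatrix h l x).trace * √|(h x).det|)
      = ((s : ℤ) : ℝ) * √|(h x).det| * ((connMatrix h l x).trace * permSymbol a) by ring, ← h2]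
  simp only [Finset.mul_sum, leviCivita, connMatrix, Matrix.of_apply]
  exact Finset.sum_congr rfl fun _ _ => Finset.sum_congr rfl fun _ _ => by ring

end leviCivita

section dualWeyl

variable {g : Coord 4 → Matrix (Fin 4) (Fin 4) ℝ} {y : Coord 4}

/-- The Levi-Civita tensor `ε_κτμν` as a matrix in its first two indices. -/
def epsLower (g : Coord 4 → Matrix (Fin 4) (Fin 4) ℝ) (s : ℤˣ) (μ ν : Fin 4) (y : Coord 4) :
    Matrix (Fin 4) (Fin 4) ℝ :=
  Matrix.of fun κ τ => leviCivita g y s ![κ, τ, μ, ν]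

/-- The Levi-Civita tensor `ε^ρσ_μν` as a matrix in its first two indices. -/
def epsMixed (g : Coord 4 → Matrix (Fin 4) (Fin 4) ℝ) (s : ℤˣ) (μ ν : Fin 4) (y : Coord 4) :
    Matrix (Fin 4) (Fin 4) ℝ :=
  (g y)⁻¹ * epsLower g s μ ν y * (g y)⁻¹

lemma epsMixed_apply (hsym : ∀ y i j, g y i j = g y j i) (s : ℤˣ) (μ ν ρ σ : Fin 4) (y : Coord 4) :
    epsMixed g s μ ν y ρ σ
      = ∑ κ, ∑ τ, (g y)⁻¹ ρ κ * (g y)⁻¹ σ τ * leviCivita g y s ![κ, τ, μ, ν] := by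
  simp only [epsMixed, epsLower, Matrix.mul_apply, Finset.sum_mul, Matrix.of_apply]
  rw [Finset.sum_comm]
  exact Finset.sum_congr rfl fun κ _ => Finset.sum_congr rfl fun τ _ => by
    rw [inv_symm hsym τ σ]; ring

lemma dualWeyl_eq (hsym : ∀ y i j, g y i j = g y j i) (s : ℤˣ) (α β μ ν : Fin 4) (y : Coord 4) :
    dualWeyl g y s α β μ ν = (1 / 2) * ∑ ρ, ∑ σ, weyl g y α β ρ σ * epsMixed g s μ ν y ρ σ := by
  simp only [dualWeyl, epsMixed_apply hsym]

lemma contDiffAt_epsLower (hdet : (g y).det ≠ 0)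
    (hsm : ∀ i j, ContDiffAt ℝ ∞ (fun z => g z i j) y) (s : ℤˣ) (μ ν κ τ : Fin 4) :
    ContDiffAt ℝ ∞ (fun z => epsLower g s μ ν z κ τ) y :=
  (contDiffAt_const.mul (contDiffAt_sqrt_abs_det hdet hsm)).mul contDiffAt_const

lemma contDiffAt_epsMixed (hdet : (g y).det ≠ 0)
    (hsm : ∀ i j, ContDiffAt ℝ ∞ (fun z => g z i j) y) (s : ℤˣ) (μ ν ρ σ : Fin 4) :
    ContDiffAt ℝ ∞ (fun z => epsMixed g s μ ν z ρ σ) y :=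
  contDiffAt_matrix_mul (contDiffAt_matrix_mul (contDiffAt_inv_apply hsm hdet)
    (contDiffAt_epsLower hdet hsm s μ ν)) (contDiffAt_inv_apply hsm hdet) ρ σ

/-- The Levi-Civita tensor is parallel, as an identity of matrices in the first two indices. -/
lemma matrixPd_epsLower (hsym : ∀ y i j, g y i j = g y j i) (hdet : (g y).det ≠ 0)
    (hsm : ∀ i j, ContDiffAt ℝ ∞ (fun z => g z i j) y) (s : ℤˣ) (l μ ν : Fin 4) :
    matrixPd l (epsLower g s μ ν) y
      = (connMatrix g l y).transpose * epsLower g s μ ν y + epsLower g s μ ν y * connMatrix g l y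
        + ∑ r, (christoffel g y r l μ • epsLower g s r ν y
          + christoffel g y r l ν • epsLower g s μ r y) := by
  ext κ τ
  simp only [matrixPd, epsLower, Matrix.of_apply, pd_leviCivita hsym hdet hsm, Fin.sum_univ_four,
    Matrix.add_apply, Matrix.mul_apply, Matrix.transpose_apply, connMatrix, Matrix.smul_apply,
    smul_eq_mul]
  have u0 : ∀ r, Function.update ![κ, τ, μ, ν] 0 r = ![r, τ, μ, ν] := fun r => by
    ext i; fin_cases i <;> rfl
  have u1 : ∀ r, Function.update ![κ, τ, μ, ν] 1 r = ![κ, r, μ, ν] := fun r => by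
    ext i; fin_cases i <;> rfl
  have u2 : ∀ r, Function.update ![κ, τ, μ, ν] 2 r = ![κ, τ, r, ν] := fun r => by
    ext i; fin_cases i <;> rfl
  have u3 : ∀ r, Function.update ![κ, τ, μ, ν] 3 r = ![κ, τ, μ, r] := fun r => by
    ext i; fin_cases i <;> rfl
  simp only [u0, u1, u2, u3, Matrix.cons_val]
  ring

/-- The mixed Levi-Civita tensor `ε^ρσ_μν` is parallel. -/
lemma matrixPd_epsMixed (hsym : ∀ y i j, g y i j = g y j i) (hdet : (g y).det ≠ 0)
    (hsm : ∀ i j, ContDiffAt ℝ ∞ (fun z => g z i j) y) (s : ℤˣ) (l μ ν : Fin 4) :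
    matrixPd l (epsMixed g s μ ν) y
      = -(connMatrix g l y * epsMixed g s μ ν y
          + epsMixed g s μ ν y * (connMatrix g l y).transpose)
        + ∑ r, (christoffel g y r l μ • epsMixed g s r ν y
          + christoffel g y r l ν • epsMixed g s μ r y) := by
  have hM := contDiffAt_inv_apply hsm hdet
  have hE := contDiffAt_epsLower hdet hsm s μ ν
  have hu : IsUnit (g y).det := isUnit_iff_ne_zero.mpr hdet
  have e : ∑ r, (christoffel g y r l μ • epsMixed g s r ν y
        + christoffel g y r l ν • epsMixed g s μ r y)
      = (g y)⁻¹ * (∑ r, (christoffel g y r l μ • epsLower g s r ν y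
        + christoffel g y r l ν • epsLower g s μ r y)) * (g y)⁻¹ := by
    rw [Finset.mul_sum, Finset.sum_mul]
    refine Finset.sum_congr rfl fun r _ => ?_
    simp only [epsMixed, mul_add, add_mul, Matrix.mul_smul, Matrix.smul_mul]
  rw [e]
  unfold epsMixed
  rw [matrixPd_mul (A := fun y => (g y)⁻¹ * epsLower g s μ ν y) (contDiffAt_matrix_mul hM hE) hM,
    matrixPd_mul hM hE, matrixPd_inv hsym hdet hsm, matrixPd_epsLower hsym hdet hsm]
  noncomm_ring

/-- `∇W*` is the dual of `∇W`, since the Levi-Civita tensor is parallel. -/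
lemma covDeriv_dualWeyl (hsym : ∀ y i j, g y i j = g y j i) (hdet : (g y).det ≠ 0)
    (hsm : ∀ i j, ContDiffAt ℝ ∞ (fun z => g z i j) y) (s : ℤˣ) (l α β μ ν : Fin 4) :
    covDeriv g (fun z => dualWeyl g z s) y l α β μ ν
      = (1 / 2) * ∑ ρ, ∑ σ, covDeriv g (weyl g) y l α β ρ σ * epsMixed g s μ ν y ρ σ := by
  have dW := fun α β ρ σ => (contDiffAt_weyl hdet hsm α β ρ σ).differentiableAt (by simp)
  have dX := fun ρ σ => (contDiffAt_epsMixed hdet hsm s μ ν ρ σ).differentiableAt (by simp)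
  have e1 : pd l (fun z => dualWeyl g z s α β μ ν) y = (1 / 2) * ∑ ρ, ∑ σ,
      (pd l (fun z => weyl g z α β ρ σ) y * epsMixed g s μ ν y ρ σ
        + weyl g y α β ρ σ * matrixPd l (epsMixed g s μ ν) y ρ σ) := by
    simp only [dualWeyl_eq hsym]
    rw [pd_const_mul, pd_sum]
    · congr 1
      refine Finset.sum_congr rfl fun ρ _ => ?_
      rw [pd_sum fun σ _ => (dW α β ρ σ).fun_mul (dX ρ σ)]
      exact Finset.sum_congr rfl fun σ _ => pd_mul (dW α β ρ σ) (dX ρ σ) l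
    · exact fun ρ _ => DifferentiableAt.fun_sum fun σ _ => (dW α β ρ σ).fun_mul (dX ρ σ)
    · exact DifferentiableAt.fun_sum fun ρ _ =>
        DifferentiableAt.fun_sum fun σ _ => (dW α β ρ σ).fun_mul (dX ρ σ)
  have c1 : ∑ ρ, ∑ σ, weyl g y α β ρ σ * ∑ r, christoffel g y ρ l r * epsMixed g s μ ν y r σ
      = ∑ ρ, ∑ σ, (∑ r, christoffel g y r l ρ * weyl g y α β r σ) * epsMixed g s μ ν y ρ σ := by
    simp only [Fin.sum_univ_four]
    ring
  have c2 : ∑ ρ, ∑ σ, weyl g y α β ρ σ * ∑ r, epsMixed g s μ ν y ρ r * christoffel g y σ l r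
      = ∑ ρ, ∑ σ, (∑ r, christoffel g y r l σ * weyl g y α β ρ r) * epsMixed g s μ ν y ρ σ := by
    simp only [Fin.sum_univ_four]
    ring
  have c3 : ∀ (F : Fin 4 → ℝ) (A X : Fin 4 → Fin 4 → Fin 4 → ℝ),
      ∑ r, F r * ((1 / 2) * ∑ ρ, ∑ σ, A r ρ σ * X r ρ σ)
        = (1 / 2) * ∑ ρ, ∑ σ, ∑ r, F r * (A r ρ σ * X r ρ σ) := by
    intro F A X
    simp only [Fin.sum_univ_four]
    ring
  rw [covDeriv, e1, matrixPd_epsMixed hsym hdet hsm]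
  simp only [dualWeyl_eq hsym, Finset.sum_add_distrib, covDeriv]
  rw [c3 _ (fun r => weyl g y r β) (fun _ => epsMixed g s μ ν y),
    c3 _ (fun r => weyl g y α r) (fun _ => epsMixed g s μ ν y),
    c3 _ (fun _ => weyl g y α β) (fun r => epsMixed g s r ν y),
    c3 _ (fun _ => weyl g y α β) (fun r => epsMixed g s μ r y)]
  simp only [Matrix.add_apply, Matrix.neg_apply, Matrix.mul_apply, Matrix.transpose_apply,
    Matrix.sum_apply, Matrix.smul_apply, connMatrix, Matrix.of_apply, smul_eq_mul, mul_add, mul_neg,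
    mul_sub, sub_mul, add_mul, neg_add, Finset.sum_add_distrib, Finset.sum_sub_distrib,
    Finset.sum_neg_distrib, c1, c2]
  simp only [Finset.mul_sum, Finset.sum_mul, mul_assoc, mul_left_comm (weyl g y _ _ _ _)]
  ring

lemma dualWeyl_antisymm_left (hsym : ∀ y i j, g y i j = g y j i) (hdet : (g y).det ≠ 0)
    (hsm : ∀ i j, ContDiffAt ℝ ∞ (fun z => g z i j) y) (s : ℤˣ) (α β μ ν : Fin 4) :
    dualWeyl g y s α β μ ν = -dualWeyl g y s β α μ ν := by
  simp only [dualWeyl, weyl_antisymm_left hsym hdet hsm α β, neg_mul, Finset.sum_neg_distrib,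
    mul_neg]

lemma permSymbol_comp_swap {n : ℕ} (a : Fin n → Fin n) {i j : Fin n} (hij : i ≠ j) :
    permSymbol (a ∘ Equiv.swap i j) = -permSymbol a := by
  have := Matrix.det_permute (Equiv.swap i j) ((1 : Matrix (Fin n) (Fin n) ℝ).submatrix a id)
  rw [Equiv.Perm.sign_swap hij] at this
  simpa [permSymbol, Matrix.submatrix_submatrix] using this

lemma dualWeyl_antisymm_right (s : ℤˣ) (α β μ ν : Fin 4) :
    dualWeyl g y s α β μ ν = -dualWeyl g y s α β ν μ := by
  have : ∀ κ τ, leviCivita g y s ![κ, τ, μ, ν] = -leviCivita g y s ![κ, τ, ν, μ] := by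
    intro κ τ
    have e : ![κ, τ, μ, ν] = ![κ, τ, ν, μ] ∘ Equiv.swap 2 3 := by
      ext i; fin_cases i <;> rfl
    rw [leviCivita, leviCivita, e, permSymbol_comp_swap _ (by decide)]
    ring
  simp only [dualWeyl, this, mul_neg, Finset.sum_neg_distrib]

/-- The dual Weyl tensor of a vacuum metric is divergence free: dualization affects the second pair
of indices, the divergence is taken on the first one, and the Levi-Civita tensor is parallel. -/
lemma div_dualWeyl {Λ : ℝ} (hsym : ∀ y i j, g y i j = g y j i) (hdet : (g y).det ≠ 0)
    (hsm : ∀ i j, ContDiffAt ℝ ∞ (fun z => g z i j) y)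
    (hvac : ∀ᶠ z in 𝓝 y, ∀ μ ν,
      ricci g z μ ν - (1 / 2) * scalarCurvature g z * g z μ ν + Λ * g z μ ν = 0)
    (s : ℤˣ) (b c d : Fin 4) :
    ∑ l, ∑ a, (g y)⁻¹ l a * covDeriv g (fun z => dualWeyl g z s) y l a b c d = 0 := by
  simp only [covDeriv_dualWeyl hsym hdet hsm]
  have h0 := div_weyl hsym hdet hsm hvac b
  have : ∑ l, ∑ a, (g y)⁻¹ l a *
        ((1 / 2) * ∑ ρ, ∑ σ, covDeriv g (weyl g) y l a b ρ σ * epsMixed g s c d y ρ σ)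
      = (1 / 2) * ∑ ρ, ∑ σ, (∑ l, ∑ a, (g y)⁻¹ l a * covDeriv g (weyl g) y l a b ρ σ)
        * epsMixed g s c d y ρ σ := by
    generalize covDeriv g (weyl g) y = D
    generalize epsMixed g s c d y = X
    simp only [Finset.mul_sum, Finset.sum_mul]
    calc _ = ∑ l, ∑ ρ, ∑ a, ∑ σ, (g y)⁻¹ l a * (1 / 2 * (D l a b ρ σ * X ρ σ)) :=
          Finset.sum_congr rfl fun _ _ => Finset.sum_comm
      _ = ∑ ρ, ∑ l, ∑ σ, ∑ a, (g y)⁻¹ l a * (1 / 2 * (D l a b ρ σ * X ρ σ)) := by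
          rw [Finset.sum_comm]
          exact Finset.sum_congr rfl fun _ _ => Finset.sum_congr rfl fun _ _ => Finset.sum_comm
      _ = ∑ ρ, ∑ σ, ∑ l, ∑ a, (g y)⁻¹ l a * (1 / 2 * (D l a b ρ σ * X ρ σ)) :=
          Finset.sum_congr rfl fun _ _ => Finset.sum_comm
      _ = _ := by
          refine Finset.sum_congr rfl fun _ _ => Finset.sum_congr rfl fun _ _ =>
            Finset.sum_congr rfl fun _ _ => Finset.sum_congr rfl fun _ _ => by ring
  rw [this]
  simp [h0]

lemma contDiffAt_dualWeyl (hsym : ∀ y i j, g y i j = g y j i) (hdet : (g y).det ≠ 0)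
    (hsm : ∀ i j, ContDiffAt ℝ ∞ (fun z => g z i j) y) (s : ℤˣ) (α β μ ν : Fin 4) :
    ContDiffAt ℝ ∞ (fun z => dualWeyl g z s α β μ ν) y := by
  simp only [dualWeyl_eq hsym]
  exact contDiffAt_const.mul (ContDiffAt.sum fun ρ _ => ContDiffAt.sum fun σ _ =>
    (contDiffAt_weyl hdet hsm α β ρ σ).mul (contDiffAt_epsMixed hdet hsm s μ ν ρ σ))

end dualWeyl

/-! ### The Gauss and Weingarten formulas -/

section hypersurface

/-- The data of a spacelike hypersurface in coordinates, near the parameter `x`: a metric `g` which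
is symmetric, smooth and nondegenerate near `f x`, a smooth parametrization `f` with positive
definite induced metric, and a smooth field `N` of unit timelike normals. -/
structure IsLocalHypersurface (g : Coord 4 → Matrix (Fin 4) (Fin 4) ℝ) (f N : Coord 3 → Coord 4)
    (x : Coord 3) : Prop where
  symm (y i j) : g y i j = g y j i
  det_ne : (g (f x)).det ≠ 0
  eventually_smooth_metric : ∀ᶠ y in 𝓝 (f x), ∀ i j, ContDiffAt ℝ ∞ (fun z => g z i j) y
  smooth_param (μ) : ContDiffAt ℝ ∞ (fun z => f z μ) x
  smooth_normal (μ) : ContDiffAt ℝ ∞ (fun z => N z μ) x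
  unit : ∀ᶠ z in 𝓝 x, ∑ μ, ∑ ν, g (f z) μ ν * N z μ * N z ν = -1
  orthogonal : ∀ᶠ z in 𝓝 x, ∀ i, ∑ μ, ∑ ν, g (f z) μ ν * N z μ * tangentComp f z i ν = 0
  posDef : (inducedMetric g f x).PosDef

/-- The scalar product `g(V, W)` at the point `y`. -/
def metricProd (g : Coord 4 → Matrix (Fin 4) (Fin 4) ℝ) (y : Coord 4) (V W : Fin 4 → ℝ) : ℝ :=
  ∑ μ, ∑ ν, g y μ ν * V μ * W ν

/-- The matrix `Γ^σ_λμ e_i^λ` of the connection along the `i`-th coordinate line. -/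
def connAlong (g : Coord 4 → Matrix (Fin 4) (Fin 4) ℝ) (f : Coord 3 → Coord 4) (x : Coord 3)
    (i : Fin 3) (σ μ : Fin 4) : ℝ :=
  ∑ l, tangentComp f x i l * christoffel g (f x) σ l μ

/-- The covariant derivative `∇_i V^μ` of a vector field along the hypersurface. -/
def covAlong (g : Coord 4 → Matrix (Fin 4) (Fin 4) ℝ) (f : Coord 3 → Coord 4)
    (V : Coord 3 → Fin 4 → ℝ) (x : Coord 3) (i : Fin 3) (μ : Fin 4) : ℝ :=
  pd i (fun z => V z μ) x + ∑ ν, connAlong g f x i μ ν * V x ν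

variable {g : Coord 4 → Matrix (Fin 4) (Fin 4) ℝ} {f N : Coord 3 → Coord 4} {x : Coord 3}

lemma normalDeriv_eq (i : Fin 3) (μ : Fin 4) :
    normalDeriv g f N x i μ = covAlong g f (fun z => N z) x i μ := by
  rw [normalDeriv, covAlong]
  congr 1
  rw [Finset.sum_comm]
  refine Finset.sum_congr rfl fun ν _ => ?_
  rw [connAlong, Finset.sum_mul]
  exact Finset.sum_congr rfl fun l _ => by ring

lemma tangentComp_eq_fderiv (hf : DifferentiableAt ℝ f x) (i : Fin 3) (μ : Fin 4) :
    tangentComp f x i μ = fderiv ℝ f x (EuclideanSpace.single i 1) μ := by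
  have h1 := ((EuclideanSpace.proj (𝕜 := ℝ) μ).hasFDerivAt (x := f x)).comp x hf.hasFDerivAt
  have h2 : fderiv ℝ (fun z => f z μ) x = (EuclideanSpace.proj (𝕜 := ℝ) μ).comp (fderiv ℝ f x) :=
    h1.fderiv
  rw [tangentComp, pd, h2]
  rfl

/-- The chain rule. -/
lemma pd_comp {G : Coord 4 → ℝ} (hG : DifferentiableAt ℝ G (f x))
    (hf : ∀ μ, ContDiffAt ℝ ∞ (fun z => f z μ) x) (i : Fin 3) :
    pd i (fun z => G (f z)) x = ∑ l, tangentComp f x i l * pd l G (f x) := by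
  have hd : DifferentiableAt ℝ f x :=
    differentiableAt_euclidean.mpr fun μ => (hf μ).differentiableAt (by simp)
  have hv : fderiv ℝ f x (EuclideanSpace.single i 1)
      = ∑ l, tangentComp f x i l • EuclideanSpace.single l (1 : ℝ) := by
    ext μ
    rw [← tangentComp_eq_fderiv hd]
    simp [Pi.single_apply]
  have h3 : fderiv ℝ (fun z => G (f z)) x = (fderiv ℝ G (f x)).comp (fderiv ℝ f x) :=
    (hG.hasFDerivAt.comp x hd.hasFDerivAt).fderiv
  rw [pd, h3, ContinuousLinearMap.comp_apply, hv, map_sum]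
  simp [pd]

/-- The matrix with rows `n, e_1, e_2, e_3`. -/
def frameMatrix (f N : Coord 3 → Coord 4) (x : Coord 3) : Matrix (Fin 4) (Fin 4) ℝ :=
  Matrix.of (Fin.cons (fun μ => N x μ) (fun i => tangentComp f x i) : Fin 4 → Fin 4 → ℝ)

lemma inducedMetric_apply (i j : Fin 3) (z : Coord 3) :
    inducedMetric g f z i j = metricProd g (f z) (tangentComp f z i) (tangentComp f z j) := by
  simp only [inducedMetric, restrict, metricProd, Matrix.of_apply]
  exact Finset.sum_congr rfl fun _ _ => Finset.sum_congr rfl fun _ _ => by ring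

lemma metricProd_symm (hsym : ∀ y i j, g y i j = g y j i) (y : Coord 4) (V W : Fin 4 → ℝ) :
    metricProd g y V W = metricProd g y W V := by
  rw [metricProd, Finset.sum_comm]
  exact Finset.sum_congr rfl fun _ _ => Finset.sum_congr rfl fun _ _ => by rw [hsym]; ring

lemma inducedMetric_symm (hsym : ∀ y i j, g y i j = g y j i) (z : Coord 3) (i j : Fin 3) :
    inducedMetric g f z i j = inducedMetric g f z j i := by
  rw [inducedMetric_apply, metricProd_symm hsym, inducedMetric_apply]

lemma extrinsicCurvature_eq_neg (i j : Fin 3) : extrinsicCurvature g f N x i j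
    = -metricProd g (f x) (covAlong g f (fun z => N z) x i) (tangentComp f x j) := by
  simp only [extrinsicCurvature, metricProd, normalDeriv_eq]

namespace IsLocalHypersurface

variable (H : IsLocalHypersurface g f N x)

include H

lemma smooth_metric (i j : Fin 4) : ContDiffAt ℝ ∞ (fun y => g y i j) (f x) :=
  H.eventually_smooth_metric.self_of_nhds i j

lemma contDiffAt_comp {G : Coord 4 → ℝ} (hG : ContDiffAt ℝ ∞ G (f x)) :
    ContDiffAt ℝ ∞ (fun z => G (f z)) x :=
  hG.comp x (contDiffAt_euclidean.mpr H.smooth_param)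

lemma contDiffAt_tangentComp (i : Fin 3) (μ : Fin 4) :
    ContDiffAt ℝ ∞ (fun z => tangentComp f z i μ) x :=
  contDiffAt_pd (H.smooth_param μ) i

lemma contDiffAt_inducedMetric (i j : Fin 3) :
    ContDiffAt ℝ ∞ (fun z => inducedMetric g f z i j) x := by
  simp only [inducedMetric_apply, metricProd]
  exact ContDiffAt.sum fun μ _ => ContDiffAt.sum fun ν _ =>
    ((H.contDiffAt_comp (H.smooth_metric μ ν)).mul (H.contDiffAt_tangentComp i μ)).mul
      (H.contDiffAt_tangentComp j ν)

lemma det_inducedMetric_pos : 0 < (inducedMetric g f x).det := H.posDef.det_pos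

/-- The product rule for the scalar product of two vector fields along the hypersurface. -/
lemma pd_metricProd {V W : Coord 3 → Fin 4 → ℝ} (hV : ∀ μ, ContDiffAt ℝ ∞ (fun z => V z μ) x)
    (hW : ∀ μ, ContDiffAt ℝ ∞ (fun z => W z μ) x) (i : Fin 3) :
    pd i (fun z => metricProd g (f z) (V z) (W z)) x
      = metricProd g (f x) (covAlong g f V x i) (W x)
        + metricProd g (f x) (V x) (covAlong g f W x i) := by
  have dV := fun μ => (hV μ).differentiableAt (by simp)
  have dW := fun μ => (hW μ).differentiableAt (by simp)
  have dg := fun μ ν => (H.contDiffAt_comp (H.smooth_metric μ ν)).differentiableAt (by simp)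
  have e1 : ∀ μ ν, pd i (fun z => g (f z) μ ν) x
      = ∑ s, (connAlong g f x i s μ * g (f x) s ν + connAlong g f x i s ν * g (f x) μ s) := by
    intro μ ν
    rw [pd_comp ((H.smooth_metric μ ν).differentiableAt (by simp)) H.smooth_param]
    simp only [pd_metric H.symm H.det_ne, connAlong, Finset.sum_mul, Finset.mul_sum,
      ← Finset.sum_add_distrib]
    rw [Finset.sum_comm]
    exact Finset.sum_congr rfl fun _ _ => Finset.sum_congr rfl fun _ _ => by ring
  have e2 : pd i (fun z => metricProd g (f z) (V z) (W z)) x = ∑ μ, ∑ ν,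
      (pd i (fun z => g (f z) μ ν) x * V x μ * W x ν
        + g (f x) μ ν * pd i (fun z => V z μ) x * W x ν
        + g (f x) μ ν * V x μ * pd i (fun z => W z ν) x) := by
    simp only [metricProd]
    rw [pd_sum fun μ _ => DifferentiableAt.fun_sum fun ν _ =>
      ((dg μ ν).fun_mul (dV μ)).fun_mul (dW ν)]
    refine Finset.sum_congr rfl fun μ _ => ?_
    rw [pd_sum fun ν _ => ((dg μ ν).fun_mul (dV μ)).fun_mul (dW ν)]
    refine Finset.sum_congr rfl fun ν _ => ?_
    rw [pd_mul ((dg μ ν).fun_mul (dV μ)) (dW ν), pd_mul (dg μ ν) (dV μ)]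
    ring
  rw [e2]
  simp only [e1, metricProd, covAlong, Fin.sum_univ_four]
  ring

/-- `∇_i e_j = ∇_j e_i`. -/
lemma covAlong_tangentComp_symm (i j : Fin 3) (μ : Fin 4) :
    covAlong g f (fun z => tangentComp f z j) x i μ
      = covAlong g f (fun z => tangentComp f z i) x j μ := by
  rw [covAlong, covAlong]
  congr 1
  · exact pd_comm (H.smooth_param μ) i j
  · simp only [connAlong, Finset.sum_mul]
    rw [Finset.sum_comm]
    refine Finset.sum_congr rfl fun l _ => Finset.sum_congr rfl fun ν _ => ?_
    rw [christoffel_symm H.symm]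
    ring

lemma pd_inducedMetric (k i j : Fin 3) :
    pd k (fun z => inducedMetric g f z i j) x
      = metricProd g (f x) (covAlong g f (fun z => tangentComp f z i) x k) (tangentComp f x j)
        + metricProd g (f x) (tangentComp f x i)
            (covAlong g f (fun z => tangentComp f z j) x k) := by
  simp only [inducedMetric_apply]
  exact H.pd_metricProd (H.contDiffAt_tangentComp i) (H.contDiffAt_tangentComp j) k

/-- The tangential part of `∇_i e_j` is given by the Christoffel symbols of the induced metric. -/
lemma metricProd_tangentComp_covAlong (l i j : Fin 3) :
    metricProd g (f x) (tangentComp f x l) (covAlong g f (fun z => tangentComp f z j) x i)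
      = ∑ k, inducedMetric g f x l k * christoffel (inducedMetric g f) x k i j := by
  rw [sum_mul_christoffel H.det_inducedMetric_pos.ne']
  have hs : ∀ a b, covAlong g f (fun z => tangentComp f z a) x b
      = covAlong g f (fun z => tangentComp f z b) x a :=
    fun a b => funext fun μ => H.covAlong_tangentComp_symm b a μ
  rw [H.pd_inducedMetric, H.pd_inducedMetric, H.pd_inducedMetric, hs l i, hs l j, hs i j,
    metricProd_symm H.symm _ _ (tangentComp f x l), metricProd_symm H.symm _ _ (tangentComp f x j)]
  ring

/-- The extrinsic curvature as a second fundamental form, `K_ij = g(n, ∇_i e_j)`, from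
differentiating `g(n, e_j) = 0`. -/
lemma extrinsicCurvature_eq (i j : Fin 3) : extrinsicCurvature g f N x i j
    = metricProd g (f x) (fun μ => N x μ) (covAlong g f (fun z => tangentComp f z j) x i) := by
  have h1 : pd i (fun z => metricProd g (f z) (fun μ => N z μ) (tangentComp f z j)) x = 0 := by
    rw [pd_congr (G := fun _ => 0), pd_const]
    exact H.orthogonal.mono fun z hz => hz j
  rw [H.pd_metricProd (V := fun z μ => N z μ) H.smooth_normal (H.contDiffAt_tangentComp j)] at h1
  rw [extrinsicCurvature_eq_neg]
  exact neg_eq_of_add_eq_zero_right h1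

/-- The extrinsic curvature is symmetric, because `∇_i e_j = ∇_j e_i`. -/
lemma extrinsicCurvature_symm (i j : Fin 3) :
    extrinsicCurvature g f N x i j = extrinsicCurvature g f N x j i := by
  rw [H.extrinsicCurvature_eq, H.extrinsicCurvature_eq]
  congr 1
  exact funext fun μ => H.covAlong_tangentComp_symm i j μ

/-- `∇_i n` is tangent to the hypersurface, from differentiating `g(n, n) = -1`. -/
lemma metricProd_normal_covAlong_normal (i : Fin 3) :
    metricProd g (f x) (fun μ => N x μ) (covAlong g f (fun z => N z) x i) = 0 := by
  have h1 : pd i (fun z => metricProd g (f z) (fun μ => N z μ) (fun μ => N z μ)) x = 0 := by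
    rw [pd_congr (G := fun _ => -1), pd_const]
    exact H.unit
  rw [H.pd_metricProd (V := fun z μ => N z μ) (W := fun z μ => N z μ) H.smooth_normal
    H.smooth_normal, metricProd_symm H.symm] at h1
  have : ∀ a : ℝ, a + a = 0 → a = 0 := fun a ha => by linarith
  exact this _ h1

/-- The Gram matrix of the frame `n, e_1, e_2, e_3`. -/
lemma frameMatrix_gram : frameMatrix f N x * g (f x) * (frameMatrix f N x).transpose
    = Matrix.of (Fin.cons (Fin.cons (-1) fun _ => 0)
        fun i => Fin.cons 0 (inducedMetric g f x i) : Fin 4 → Fin 4 → ℝ) := by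
  have h1 := H.unit.self_of_nhds
  have h2 := H.orthogonal.self_of_nhds
  have key : ∀ a b, (frameMatrix f N x * g (f x) * (frameMatrix f N x).transpose) a b
      = metricProd g (f x) (frameMatrix f N x a) (frameMatrix f N x b) := by
    intro a b
    simp only [Matrix.mul_apply, Matrix.transpose_apply, metricProd, Finset.sum_mul]
    rw [Finset.sum_comm]
    exact Finset.sum_congr rfl fun _ _ => Finset.sum_congr rfl fun _ _ => by ring
  ext a b
  rw [key]
  refine Fin.cases ?_ (fun i => ?_) a <;> refine Fin.cases ?_ (fun j => ?_) b
  · exact h1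
  · exact h2 j
  · exact (metricProd_symm H.symm _ _ _).trans (h2 i)
  · exact (inducedMetric_apply i j x).symm

/-- The determinant of the Gram matrix of the frame, `(det F)² det g = -det γ`. -/
lemma frameDet_sq_mul_det :
    frameDet f N x ^ 2 * (g (f x)).det = -(inducedMetric g f x).det := by
  have h1 := congrArg Matrix.det H.frameMatrix_gram
  rw [Matrix.det_mul, Matrix.det_mul, Matrix.det_transpose] at h1
  have h2 : (Matrix.of (Fin.cons (Fin.cons (-1) fun _ => 0)
        fun i => Fin.cons 0 (inducedMetric g f x i) : Fin 4 → Fin 4 → ℝ)).det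
      = -(inducedMetric g f x).det := by
    rw [Matrix.det_succ_row_zero, Fin.sum_univ_succ]
    simp only [Matrix.of_apply, Fin.cons_zero, Fin.cons_succ]
    simp only [mul_zero, zero_mul, Finset.sum_const_zero, add_zero, Fin.val_zero, pow_zero, one_mul,
      neg_one_mul, neg_inj]
    rfl
  rw [← h2, ← h1]
  change frameDet f N x ^ 2 * _ = frameDet f N x * _ * frameDet f N x
  ring

/-- Completeness of the frame: `g^μν = -n^μ n^ν + γ^ij e_i^μ e_j^ν`. -/
lemma inv_metric_eq (μ ν : Fin 4) : (g (f x))⁻¹ μ ν = -(N x μ * N x ν)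
    + ∑ i, ∑ j, (inducedMetric g f x)⁻¹ i j * tangentComp f x i μ * tangentComp f x j ν := by
  set F := frameMatrix f N x with hF
  set D : Matrix (Fin 4) (Fin 4) ℝ := Matrix.of (Fin.cons (Fin.cons (-1) fun _ => 0)
        fun i => Fin.cons 0 ((inducedMetric g f x)⁻¹ i) : Fin 4 → Fin 4 → ℝ) with hD
  have h1 : D * (F * g (f x) * F.transpose) = 1 := by
    rw [hF, H.frameMatrix_gram]
    have hi := sum_inv_mul H.det_inducedMetric_pos.ne'
    ext a b
    rw [Matrix.mul_apply, Fin.sum_univ_succ]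
    refine Fin.cases ?_ (fun i => ?_) a <;> refine Fin.cases ?_ (fun j => ?_) b <;>
      simp only [hD, Matrix.of_apply, Fin.cons_zero, Fin.cons_succ]
    · simp
    · simp [(Fin.succ_ne_zero j).symm]
    · simp
    · simp only [zero_mul, zero_add, hi, Matrix.one_apply, Fin.succ_inj]
  have h2 : F.transpose * D * F * g (f x) = 1 := by
    have : D * F * g (f x) * F.transpose = 1 := by rw [← h1]; noncomm_ring
    rw [← mul_eq_one_comm.mp this]
    noncomm_ring
  rw [Matrix.inv_eq_left_inv h2, Matrix.mul_apply, Fin.sum_univ_succ]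
  simp only [Matrix.mul_apply, Matrix.transpose_apply, Fin.sum_univ_succ (n := 3)]
  simp only [hD, hF, frameMatrix, Matrix.of_apply, Fin.cons_zero, Fin.cons_succ]
  simp only [mul_zero, mul_neg, mul_one, Finset.sum_const_zero, add_zero, zero_add, neg_mul,
    Finset.sum_mul]
  congr 1
  rw [Finset.sum_comm]
  exact Finset.sum_congr rfl fun _ _ => Finset.sum_congr rfl fun _ _ => by ring

/-- The expansion of a vector in the frame `n, e_1, e_2, e_3`. -/
lemma eq_frame_expansion (V : Fin 4 → ℝ) (μ : Fin 4) :
    V μ = -(metricProd g (f x) (fun μ => N x μ) V * N x μ)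
      + ∑ l, (∑ m, (inducedMetric g f x)⁻¹ l m * metricProd g (f x) (tangentComp f x m) V)
        * tangentComp f x l μ := by
  have h1 : V μ = ∑ ν, (g (f x))⁻¹ μ ν * ∑ r, g (f x) ν r * V r := by
    simp only [Finset.mul_sum, ← mul_assoc]
    rw [Finset.sum_comm]
    simp only [← Finset.sum_mul, sum_inv_mul H.det_ne]
    simp
  rw [h1]
  simp only [H.inv_metric_eq, metricProd, Fin.sum_univ_four, Fin.sum_univ_three]
  ring

/-- The Gauss formula `∇_i e_j = Γ^l_ij e_l - K_ij n`. -/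
lemma gauss_formula (i j : Fin 3) (μ : Fin 4) :
    covAlong g f (fun z => tangentComp f z j) x i μ
      = -(extrinsicCurvature g f N x i j * N x μ)
        + ∑ l, christoffel (inducedMetric g f) x l i j * tangentComp f x l μ := by
  rw [H.eq_frame_expansion (covAlong g f (fun z => tangentComp f z j) x i) μ,
    ← H.extrinsicCurvature_eq]
  congr 1
  refine Finset.sum_congr rfl fun l _ => ?_
  congr 1
  simp only [H.metricProd_tangentComp_covAlong, Finset.mul_sum, ← mul_assoc]
  rw [Finset.sum_comm]
  simp only [← Finset.sum_mul, sum_inv_mul H.det_inducedMetric_pos.ne']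
  simp

/-- The Weingarten formula `∇_i n = -K_i^l e_l`. -/
lemma weingarten_formula (i : Fin 3) (μ : Fin 4) :
    covAlong g f (fun z => N z) x i μ
      = -∑ l, (∑ m, (inducedMetric g f x)⁻¹ l m * extrinsicCurvature g f N x i m)
        * tangentComp f x l μ := by
  rw [H.eq_frame_expansion (covAlong g f (fun z => N z) x i) μ,
    H.metricProd_normal_covAlong_normal, zero_mul, neg_zero, zero_add, ← Finset.sum_neg_distrib]
  refine Finset.sum_congr rfl fun l _ => ?_
  rw [← neg_mul, ← Finset.sum_neg_distrib]
  congr 1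
  refine Finset.sum_congr rfl fun m _ => ?_
  rw [extrinsicCurvature_eq_neg, metricProd_symm H.symm]
  ring

end IsLocalHypersurface

end hypersurface

/-! ### The divergence of the electric part of a divergence-free tensor -/

section divergence

/-- Since the metric is parallel, `T^i_{j|i} = h^ik T_kj|i`. -/
lemma divergence_eq {n : ℕ} {h : Coord n → Matrix (Fin n) (Fin n) ℝ} {x : Coord n}
    (hsym : ∀ y i j, h y i j = h y j i) (hdet : (h x).det ≠ 0)
    (hsm : ∀ i j, ContDiffAt ℝ ∞ (fun y => h y i j) x) {T : Coord n → Fin n → Fin n → ℝ}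
    (hT : ∀ i j, ContDiffAt ℝ ∞ (fun y => T y i j) x) (j : Fin n) :
    divergence h x T j = ∑ i, ∑ k, (h x)⁻¹ i k * (pd i (fun y => T y k j) x
      - ∑ l, christoffel h x l i k * T x l j - ∑ l, christoffel h x l i j * T x k l) := by
  have dh := fun i j => (contDiffAt_inv_apply hsm hdet i j).differentiableAt (by simp)
  have dT := fun i j => (hT i j).differentiableAt (by simp)
  refine Finset.sum_congr rfl fun i _ => ?_
  have e1 : pd i (fun y => raiseFirst h T y i j) x
      = ∑ k, (h x)⁻¹ i k * pd i (fun y => T y k j) x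
        - ∑ l, christoffel h x i i l * raiseFirst h T x l j
        - ∑ k, (h x)⁻¹ i k * ∑ l, christoffel h x l i k * T x l j := by
    simp only [raiseFirst]
    rw [pd_sum fun k _ => (dh i k).fun_mul (dT k j)]
    simp only [pd_mul (dh _ _) (dT _ _), pd_inv hsym hdet hsm, Finset.sum_add_distrib, neg_mul,
      Finset.sum_neg_distrib, add_mul, neg_add, Finset.sum_mul, Finset.mul_sum]
    have c1 : ∑ k, ∑ l, christoffel h x i i l * (h x)⁻¹ l k * T x k j
        = ∑ l, ∑ k, christoffel h x i i l * ((h x)⁻¹ l k * T x k j) := by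
      rw [Finset.sum_comm]
      exact Finset.sum_congr rfl fun _ _ => Finset.sum_congr rfl fun _ _ => by ring
    have c2 : ∑ k, ∑ l, christoffel h x k i l * (h x)⁻¹ i l * T x k j
        = ∑ k, ∑ l, (h x)⁻¹ i k * (christoffel h x l i k * T x l j) := by
      rw [Finset.sum_comm]
      exact Finset.sum_congr rfl fun _ _ => Finset.sum_congr rfl fun _ _ => by ring
    rw [c1, c2]
    ring
  have e2 : ∑ l, christoffel h x l i j * raiseFirst h T x i l
      = ∑ k, (h x)⁻¹ i k * ∑ l, christoffel h x l i j * T x k l := by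
    simp only [raiseFirst, Finset.mul_sum]
    rw [Finset.sum_comm]
    exact Finset.sum_congr rfl fun _ _ => Finset.sum_congr rfl fun _ _ => by ring
  rw [covDerivMixed, e1, Finset.sum_sub_distrib, e2]
  simp only [mul_sub, Finset.sum_sub_distrib]
  ring

/-- The value `T(a, b, c, d)` of a covariant tensor of rank four on four vectors. -/
def contract4 (T : Fin 4 → Fin 4 → Fin 4 → Fin 4 → ℝ) (a b c d : Fin 4 → ℝ) : ℝ :=
  ∑ α, ∑ β, ∑ μ, ∑ ν, T α β μ ν * a α * b β * c μ * d ν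

section contract4

variable (T : Fin 4 → Fin 4 → Fin 4 → Fin 4 → ℝ) (a b c d v : Fin 4 → ℝ) (r : ℝ)
  (s : Fin 3 → ℝ) (w : Fin 3 → Fin 4 → ℝ)

lemma contract4_expand_fst : contract4 T (fun μ => -(r * v μ) + ∑ l, s l * w l μ) b c d
    = -(r * contract4 T v b c d) + ∑ l, s l * contract4 T (w l) b c d := by
  simp only [contract4, Fin.sum_univ_three, Finset.mul_sum, ← Finset.sum_add_distrib,
    ← Finset.sum_neg_distrib]
  exact Finset.sum_congr rfl fun _ _ => Finset.sum_congr rfl fun _ _ =>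
    Finset.sum_congr rfl fun _ _ => Finset.sum_congr rfl fun _ _ => by ring

lemma contract4_expand_snd : contract4 T a (fun μ => -∑ l, s l * w l μ) c d
    = -∑ l, s l * contract4 T a (w l) c d := by
  simp only [contract4, Fin.sum_univ_three, Finset.mul_sum, ← Finset.sum_add_distrib,
    ← Finset.sum_neg_distrib]
  exact Finset.sum_congr rfl fun _ _ => Finset.sum_congr rfl fun _ _ =>
    Finset.sum_congr rfl fun _ _ => Finset.sum_congr rfl fun _ _ => by ring

lemma contract4_expand_thd : contract4 T a b (fun μ => -∑ l, s l * w l μ) d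
    = -∑ l, s l * contract4 T a b (w l) d := by
  simp only [contract4, Fin.sum_univ_three, Finset.mul_sum, ← Finset.sum_add_distrib,
    ← Finset.sum_neg_distrib]
  exact Finset.sum_congr rfl fun _ _ => Finset.sum_congr rfl fun _ _ =>
    Finset.sum_congr rfl fun _ _ => Finset.sum_congr rfl fun _ _ => by ring

lemma contract4_expand_fth : contract4 T a b c (fun μ => -(r * v μ) + ∑ l, s l * w l μ)
    = -(r * contract4 T a b c v) + ∑ l, s l * contract4 T a b c (w l) := by
  simp only [contract4, Fin.sum_univ_three, Finset.mul_sum, ← Finset.sum_add_distrib,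
    ← Finset.sum_neg_distrib]
  exact Finset.sum_congr rfl fun _ _ => Finset.sum_congr rfl fun _ _ =>
    Finset.sum_congr rfl fun _ _ => Finset.sum_congr rfl fun _ _ => by ring

variable {T}

lemma contract4_antisymm_left (hT : ∀ α β μ ν, T α β μ ν = -T β α μ ν) :
    contract4 T a b c d = -contract4 T b a c d := by
  simp only [contract4]
  rw [Finset.sum_comm]
  simp only [← Finset.sum_neg_distrib]
  refine Finset.sum_congr rfl fun β _ => Finset.sum_congr rfl fun α _ =>
    Finset.sum_congr rfl fun μ _ => Finset.sum_congr rfl fun ν _ => ?_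
  rw [hT α β]; ring

lemma contract4_antisymm_right (hT : ∀ α β μ ν, T α β μ ν = -T α β ν μ) :
    contract4 T a b c d = -contract4 T a b d c := by
  simp only [contract4, ← Finset.sum_neg_distrib]
  refine Finset.sum_congr rfl fun α _ => Finset.sum_congr rfl fun β _ => ?_
  rw [Finset.sum_comm]
  refine Finset.sum_congr rfl fun μ _ => Finset.sum_congr rfl fun ν _ => ?_
  rw [hT α β]; ring

lemma contract4_self_left (hT : ∀ α β μ ν, T α β μ ν = -T β α μ ν) :
    contract4 T a a c d = 0 :=
  self_eq_neg.mp (contract4_antisymm_left a a c d hT)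

lemma contract4_self_right (hT : ∀ α β μ ν, T α β μ ν = -T α β ν μ) :
    contract4 T a b c c = 0 :=
  self_eq_neg.mp (contract4_antisymm_right a b c c hT)

end contract4

lemma sum_comm_rotate (F : Fin 4 → Fin 4 → Fin 4 → Fin 4 → ℝ) :
    ∑ α, ∑ β, ∑ μ, ∑ ν, F α β μ ν = ∑ β, ∑ μ, ∑ ν, ∑ α, F α β μ ν := by
  rw [Finset.sum_comm]
  refine Finset.sum_congr rfl fun β _ => ?_
  rw [Finset.sum_comm]
  exact Finset.sum_congr rfl fun μ _ => Finset.sum_comm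

lemma sum_mul_contract4 (r : Fin 4 → ℝ) (S : Fin 4 → Fin 4 → Fin 4 → Fin 4 → Fin 4 → ℝ)
    (a b c d : Fin 4 → ℝ) :
    ∑ l, r l * contract4 (S l) a b c d
      = contract4 (fun α β μ ν => ∑ l, r l * S l α β μ ν) a b c d := by
  simp only [contract4, Finset.mul_sum, Finset.sum_mul]
  rw [Finset.sum_comm]
  refine Finset.sum_congr rfl fun α _ => ?_
  rw [Finset.sum_comm]
  refine Finset.sum_congr rfl fun β _ => ?_
  rw [Finset.sum_comm]
  refine Finset.sum_congr rfl fun μ _ => ?_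
  rw [Finset.sum_comm]
  exact Finset.sum_congr rfl fun ν _ => Finset.sum_congr rfl fun l _ => by ring

/-- The transpose of a matrix acting on a slot of a tensor is the matrix acting on the vector. -/
lemma contract4_connection (T : Fin 4 → Fin 4 → Fin 4 → Fin 4 → ℝ) (A : Fin 4 → Fin 4 → ℝ)
    (a b c d : Fin 4 → ℝ) :
    contract4 (fun α β μ ν => ∑ s, (A s α * T s β μ ν + A s β * T α s μ ν
        + A s μ * T α β s ν + A s ν * T α β μ s)) a b c d
      = contract4 T (fun σ => ∑ s, A σ s * a s) b c d
        + contract4 T a (fun σ => ∑ s, A σ s * b s) c d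
        + contract4 T a b (fun σ => ∑ s, A σ s * c s) d
        + contract4 T a b c (fun σ => ∑ s, A σ s * d s) := by
  have L : ∀ (F v : Fin 4 → ℝ) (r : ℝ),
      ∑ α, (∑ s, A s α * F s) * v α * r = ∑ α, F α * (∑ s, A α s * v s) * r := by
    intro F v r
    simp only [Fin.sum_univ_four]; ring
  have e1 : contract4 (fun α β μ ν => ∑ s, A s α * T s β μ ν) a b c d
      = contract4 T (fun σ => ∑ s, A σ s * a s) b c d := by
    simp only [contract4]
    refine (sum_comm_rotate _).trans (Eq.trans ?_ (sum_comm_rotate _).symm)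
    refine Finset.sum_congr rfl fun β _ => Finset.sum_congr rfl fun μ _ =>
      Finset.sum_congr rfl fun ν _ => ?_
    simpa only [mul_assoc] using L (fun s => T s β μ ν) a (b β * c μ * d ν)
  have e2 : contract4 (fun α β μ ν => ∑ s, A s β * T α s μ ν) a b c d
      = contract4 T a (fun σ => ∑ s, A σ s * b s) c d := by
    simp only [contract4]
    refine Finset.sum_congr rfl fun α _ => ?_
    rw [Finset.sum_comm, Finset.sum_comm (f := fun β μ => ∑ ν, T α β μ ν * a α * _ * c μ * d ν)]
    refine Finset.sum_congr rfl fun μ _ => ?_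
    rw [Finset.sum_comm, Finset.sum_comm (f := fun β ν => T α β μ ν * a α * _ * c μ * d ν)]
    refine Finset.sum_congr rfl fun ν _ => ?_
    have := L (fun s => T α s μ ν) b (a α * c μ * d ν)
    convert this using 2 <;> ring
  have e3 : contract4 (fun α β μ ν => ∑ s, A s μ * T α β s ν) a b c d
      = contract4 T a b (fun σ => ∑ s, A σ s * c s) d := by
    simp only [contract4]
    refine Finset.sum_congr rfl fun α _ => Finset.sum_congr rfl fun β _ => ?_
    rw [Finset.sum_comm, Finset.sum_comm (f := fun μ ν => T α β μ ν * a α * b β * _ * d ν)]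
    refine Finset.sum_congr rfl fun ν _ => ?_
    have := L (fun s => T α β s ν) c (a α * b β * d ν)
    convert this using 2 <;> ring
  have e4 : contract4 (fun α β μ ν => ∑ s, A s ν * T α β μ s) a b c d
      = contract4 T a b c (fun σ => ∑ s, A σ s * d s) := by
    simp only [contract4]
    refine Finset.sum_congr rfl fun α _ => Finset.sum_congr rfl fun β _ =>
      Finset.sum_congr rfl fun μ _ => ?_
    have := L (fun s => T α β μ s) d (a α * b β * c μ)
    convert this using 2 <;> ring
  rw [← e1, ← e2, ← e3, ← e4]
  simp only [contract4, ← Finset.sum_add_distrib]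
  refine Finset.sum_congr rfl fun α _ => Finset.sum_congr rfl fun β _ =>
    Finset.sum_congr rfl fun μ _ => Finset.sum_congr rfl fun ν _ => ?_
  simp only [Finset.sum_add_distrib]
  ring

variable {g : Coord 4 → Matrix (Fin 4) (Fin 4) ℝ} {f N : Coord 3 → Coord 4} {x : Coord 3}

namespace IsLocalHypersurface

/-- The tangential trace of a bilinear form whose full trace and normal component vanish. -/
lemma sum_tangential_eq_zero (H : IsLocalHypersurface g f N x) (D : Fin 4 → Fin 4 → ℝ)
    (htr : ∑ l, ∑ α, (g (f x))⁻¹ l α * D l α = 0) (hnn : ∑ l, ∑ α, N x l * N x α * D l α = 0) :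
    ∑ i, ∑ k, (inducedMetric g f x)⁻¹ i k * ∑ l, tangentComp f x i l
      * ∑ α, tangentComp f x k α * D l α = 0 := by
  simp only [H.inv_metric_eq, add_mul, Finset.sum_add_distrib, neg_mul, Finset.sum_neg_distrib, hnn,
    neg_zero, zero_add] at htr
  rw [← htr]
  simp only [Fin.sum_univ_four, Fin.sum_univ_three]
  ring

variable (H : IsLocalHypersurface g f N x) {T : Coord 4 → Fin 4 → Fin 4 → Fin 4 → Fin 4 → ℝ}
  (hT : ∀ α β μ ν, ContDiffAt ℝ ∞ (fun y => T y α β μ ν) (f x))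

include H hT

lemma contDiffAt_contract4 {a b c d : Coord 3 → Fin 4 → ℝ}
    (ha : ∀ μ, ContDiffAt ℝ ∞ (fun z => a z μ) x) (hb : ∀ μ, ContDiffAt ℝ ∞ (fun z => b z μ) x)
    (hc : ∀ μ, ContDiffAt ℝ ∞ (fun z => c z μ) x) (hd : ∀ μ, ContDiffAt ℝ ∞ (fun z => d z μ) x) :
    ContDiffAt ℝ ∞ (fun z => contract4 (T (f z)) (a z) (b z) (c z) (d z)) x :=
  ContDiffAt.sum fun α _ => ContDiffAt.sum fun β _ => ContDiffAt.sum fun μ _ =>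
    ContDiffAt.sum fun ν _ => ((((H.contDiffAt_comp (hT α β μ ν)).mul (ha α)).mul (hb β)).mul
      (hc μ)).mul (hd ν)

/-- The product rule for the value of a spacetime tensor on vector fields along the
hypersurface. -/
lemma pd_contract4 {a b c d : Coord 3 → Fin 4 → ℝ}
    (ha : ∀ μ, ContDiffAt ℝ ∞ (fun z => a z μ) x) (hb : ∀ μ, ContDiffAt ℝ ∞ (fun z => b z μ) x)
    (hc : ∀ μ, ContDiffAt ℝ ∞ (fun z => c z μ) x) (hd : ∀ μ, ContDiffAt ℝ ∞ (fun z => d z μ) x)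
    (i : Fin 3) :
    pd i (fun z => contract4 (T (f z)) (a z) (b z) (c z) (d z)) x
      = ∑ l, tangentComp f x i l
          * contract4 (covDeriv g T (f x) l) (a x) (b x) (c x) (d x)
        + contract4 (T (f x)) (covAlong g f a x i) (b x) (c x) (d x)
        + contract4 (T (f x)) (a x) (covAlong g f b x i) (c x) (d x)
        + contract4 (T (f x)) (a x) (b x) (covAlong g f c x i) (d x)
        + contract4 (T (f x)) (a x) (b x) (c x) (covAlong g f d x i) := by
  have da := fun μ => (ha μ).differentiableAt (by simp)
  have db := fun μ => (hb μ).differentiableAt (by simp)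
  have dc := fun μ => (hc μ).differentiableAt (by simp)
  have dd := fun μ => (hd μ).differentiableAt (by simp)
  have dT := fun α β μ ν => (H.contDiffAt_comp (hT α β μ ν)).differentiableAt (by simp)
  have d0 := fun α β μ ν => ((((dT α β μ ν).fun_mul (da α)).fun_mul (db β)).fun_mul (dc μ)).fun_mul
    (dd ν)
  have e1 : pd i (fun z => contract4 (T (f z)) (a z) (b z) (c z) (d z)) x
      = ∑ α, ∑ β, ∑ μ, ∑ ν,
        (pd i (fun z => T (f z) α β μ ν) x * a x α * b x β * c x μ * d x ν
        + T (f x) α β μ ν * pd i (fun z => a z α) x * b x β * c x μ * d x ν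
        + T (f x) α β μ ν * a x α * pd i (fun z => b z β) x * c x μ * d x ν
        + T (f x) α β μ ν * a x α * b x β * pd i (fun z => c z μ) x * d x ν
        + T (f x) α β μ ν * a x α * b x β * c x μ * pd i (fun z => d z ν) x) := by
    simp only [contract4]
    rw [pd_sum fun α _ => DifferentiableAt.fun_sum fun β _ => DifferentiableAt.fun_sum fun μ _ =>
      DifferentiableAt.fun_sum fun ν _ => d0 α β μ ν]
    refine Finset.sum_congr rfl fun α _ => ?_
    rw [pd_sum fun β _ => DifferentiableAt.fun_sum fun μ _ =>
      DifferentiableAt.fun_sum fun ν _ => d0 α β μ ν]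
    refine Finset.sum_congr rfl fun β _ => ?_
    rw [pd_sum fun μ _ => DifferentiableAt.fun_sum fun ν _ => d0 α β μ ν]
    refine Finset.sum_congr rfl fun μ _ => ?_
    rw [pd_sum fun ν _ => d0 α β μ ν]
    refine Finset.sum_congr rfl fun ν _ => ?_
    rw [pd_mul ((((dT α β μ ν).fun_mul (da α)).fun_mul (db β)).fun_mul (dc μ)) (dd ν),
      pd_mul (((dT α β μ ν).fun_mul (da α)).fun_mul (db β)) (dc μ),
      pd_mul ((dT α β μ ν).fun_mul (da α)) (db β), pd_mul (dT α β μ ν) (da α)]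
    ring
  have e2 : ∀ α β μ ν, pd i (fun z => T (f z) α β μ ν) x
      = ∑ l, tangentComp f x i l * covDeriv g T (f x) l α β μ ν
        + ∑ s, (connAlong g f x i s α * T (f x) s β μ ν + connAlong g f x i s β * T (f x) α s μ ν
          + connAlong g f x i s μ * T (f x) α β s ν
          + connAlong g f x i s ν * T (f x) α β μ s) := by
    intro α β μ ν
    rw [pd_comp ((hT α β μ ν).differentiableAt (by simp)) H.smooth_param]
    have : ∀ l, pd l (fun y => T y α β μ ν) (f x) = covDeriv g T (f x) l α β μ ν
      + ∑ s, (christoffel g (f x) s l α * T (f x) s β μ ν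
        + christoffel g (f x) s l β * T (f x) α s μ ν + christoffel g (f x) s l μ * T (f x) α β s ν
        + christoffel g (f x) s l ν * T (f x) α β μ s) := fun l => by rw [covDeriv]; ring
    simp only [this, mul_add, Finset.sum_add_distrib]
    congr 1
    simp only [connAlong, Finset.mul_sum, Finset.sum_mul, mul_assoc]
    congr 1
    · congr 1
      · congr 1
        · exact Finset.sum_comm
        · exact Finset.sum_comm
      · exact Finset.sum_comm
    · exact Finset.sum_comm
  have e3 := contract4_connection (T (f x)) (connAlong g f x i) (a x) (b x) (c x) (d x)
  have e4 : ∑ l, tangentComp f x i l * contract4 (covDeriv g T (f x) l) (a x) (b x) (c x) (d x)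
      = contract4 (fun α β μ ν => ∑ l, tangentComp f x i l * covDeriv g T (f x) l α β μ ν)
          (a x) (b x) (c x) (d x) := by
    exact sum_mul_contract4 _ _ _ _ _ _
  have e5 : ∀ A B C D E A' B' C' D' X : ℝ, X = A' + B' + C' + D' →
      A + X + B + C + D + E = A + (B + A') + (C + B') + (D + C') + (E + D') := by
    intros; subst_vars; ring
  rw [e1, e4]
  have s1 : contract4 (T (f x)) (covAlong g f a x i) (b x) (c x) (d x)
      = contract4 (T (f x)) (fun μ => pd i (fun z => a z μ) x) (b x) (c x) (d x)
        + contract4 (T (f x)) (fun σ => ∑ s, connAlong g f x i σ s * a x s) (b x) (c x) (d x) := by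
    simp only [contract4, ← Finset.sum_add_distrib, covAlong]
    exact Finset.sum_congr rfl fun _ _ => Finset.sum_congr rfl fun _ _ =>
      Finset.sum_congr rfl fun _ _ => Finset.sum_congr rfl fun _ _ => by ring
  have s2 : contract4 (T (f x)) (a x) (covAlong g f b x i) (c x) (d x)
      = contract4 (T (f x)) (a x) (fun μ => pd i (fun z => b z μ) x) (c x) (d x)
        + contract4 (T (f x)) (a x) (fun σ => ∑ s, connAlong g f x i σ s * b x s) (c x) (d x) := by
    simp only [contract4, ← Finset.sum_add_distrib, covAlong]
    exact Finset.sum_congr rfl fun _ _ => Finset.sum_congr rfl fun _ _ =>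
      Finset.sum_congr rfl fun _ _ => Finset.sum_congr rfl fun _ _ => by ring
  have s3 : contract4 (T (f x)) (a x) (b x) (covAlong g f c x i) (d x)
      = contract4 (T (f x)) (a x) (b x) (fun μ => pd i (fun z => c z μ) x) (d x)
        + contract4 (T (f x)) (a x) (b x) (fun σ => ∑ s, connAlong g f x i σ s * c x s) (d x) := by
    simp only [contract4, ← Finset.sum_add_distrib, covAlong]
    exact Finset.sum_congr rfl fun _ _ => Finset.sum_congr rfl fun _ _ =>
      Finset.sum_congr rfl fun _ _ => Finset.sum_congr rfl fun _ _ => by ring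
  have s4 : contract4 (T (f x)) (a x) (b x) (c x) (covAlong g f d x i)
      = contract4 (T (f x)) (a x) (b x) (c x) (fun μ => pd i (fun z => d z μ) x)
        + contract4 (T (f x)) (a x) (b x) (c x) (fun σ => ∑ s, connAlong g f x i σ s * d x s) := by
    simp only [contract4, ← Finset.sum_add_distrib, covAlong]
    exact Finset.sum_congr rfl fun _ _ => Finset.sum_congr rfl fun _ _ =>
      Finset.sum_congr rfl fun _ _ => Finset.sum_congr rfl fun _ _ => by ring
  rw [s1, s2, s3, s4, ← e5 _ _ _ _ _ _ _ _ _ _ e3]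
  simp only [contract4, ← Finset.sum_add_distrib]
  refine Finset.sum_congr rfl fun α _ => Finset.sum_congr rfl fun β _ =>
    Finset.sum_congr rfl fun μ _ => Finset.sum_congr rfl fun ν _ => ?_
  rw [e2]
  ring

/-- The divergence of the electric part `T(e_i, n, n, e_j)` of a divergence-free tensor which is
skew in its first and in its last pair of indices. -/
lemma divergence_electric (hskew : ∀ᶠ y in 𝓝 (f x), ∀ α β μ ν, T y α β μ ν = -T y β α μ ν)
    (hskew' : ∀ α β μ ν, T (f x) α β μ ν = -T (f x) α β ν μ)
    (hdiv : ∀ β μ ν, ∑ l, ∑ α, (g (f x))⁻¹ l α * covDeriv g T (f x) l α β μ ν = 0) (j : Fin 3) :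
    divergence (inducedMetric g f) x (fun z k j => contract4 (T (f z)) (tangentComp f z k)
        (fun μ => N z μ) (fun μ => N z μ) (tangentComp f z j)) j
      = -∑ k, ∑ l, (∑ i, ∑ m, (inducedMetric g f x)⁻¹ i k * (inducedMetric g f x)⁻¹ l m
          * extrinsicCurvature g f N x i m)
        * contract4 (T (f x)) (tangentComp f x k) (fun μ => N x μ) (tangentComp f x l)
            (tangentComp f x j) := by
  set γ := inducedMetric g f with hγ
  set n : Fin 4 → ℝ := fun μ => N x μ with hn
  set e := tangentComp f x with he
  set K := extrinsicCurvature g f N x with hK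
  have hs := hskew.self_of_nhds
  have hinv : ∀ i j, (γ x)⁻¹ i j = (γ x)⁻¹ j i := inv_symm (inducedMetric_symm H.symm)
  refine (divergence_eq (inducedMetric_symm H.symm) H.det_inducedMetric_pos.ne'
    H.contDiffAt_inducedMetric (fun k j => H.contDiffAt_contract4 hT (H.contDiffAt_tangentComp k)
      H.smooth_normal H.smooth_normal (H.contDiffAt_tangentComp j)) j).trans ?_
  -- The frame formulas cancel all connection terms of the hypersurface.
  have h1 : ∀ i k, pd i (fun z => contract4 (T (f z)) (tangentComp f z k)
        (fun μ => N z μ) (fun μ => N z μ) (tangentComp f z j)) x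
      - ∑ l, christoffel γ x l i k * contract4 (T (f x)) (e l) n n (e j)
      - ∑ l, christoffel γ x l i j * contract4 (T (f x)) (e k) n n (e l)
      = ∑ l, e i l * contract4 (covDeriv g T (f x) l) (e k) n n (e j)
        - ∑ l, (∑ m, (γ x)⁻¹ l m * K i m) * contract4 (T (f x)) (e k) (e l) n (e j)
        - ∑ l, (∑ m, (γ x)⁻¹ l m * K i m) * contract4 (T (f x)) (e k) n (e l) (e j) := by
    intro i k
    rw [H.pd_contract4 hT (H.contDiffAt_tangentComp k) H.smooth_normal H.smooth_normal
      (H.contDiffAt_tangentComp j)]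
    rw [show covAlong g f (fun z => tangentComp f z k) x i = _ from funext (H.gauss_formula i k),
      show covAlong g f (fun z => tangentComp f z j) x i = _ from funext (H.gauss_formula i j),
      show covAlong g f (fun z μ => N z μ) x i = _ from funext (H.weingarten_formula i),
      contract4_expand_fst, contract4_expand_snd, contract4_expand_thd, contract4_expand_fth,
      contract4_self_left _ _ _ hs, contract4_self_right _ _ _ hskew']
    ring
  refine (Finset.sum_congr rfl fun i _ => Finset.sum_congr rfl fun k _ =>
    congrArg ((γ x)⁻¹ i k * ·) (h1 i k)).trans ?_
  simp only [mul_sub, Finset.sum_sub_distrib]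
  -- The divergence of `T` and its skewness remove the derivative term.
  have h2 : ∑ i, ∑ k, (γ x)⁻¹ i k * ∑ l, e i l * contract4 (covDeriv g T (f x) l) (e k) n n (e j)
      = 0 := by
    have hsum : ∀ l, contract4 (covDeriv g T (f x) l) n n n (e j) = 0 := fun l =>
      contract4_self_left _ _ _ (covDeriv_antisymm_left hskew l)
    have hlin : ∀ l a, contract4 (covDeriv g T (f x) l) a n n (e j)
        = ∑ α, a α * ∑ β, ∑ μ, ∑ ν, covDeriv g T (f x) l α β μ ν * n β * n μ * e j ν := by
      intro l a
      simp only [contract4, Finset.mul_sum]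
      exact Finset.sum_congr rfl fun _ _ => Finset.sum_congr rfl fun _ _ =>
        Finset.sum_congr rfl fun _ _ => Finset.sum_congr rfl fun _ _ => by ring
    have htr : ∑ l, ∑ α, (g (f x))⁻¹ l α *
        ∑ β, ∑ μ, ∑ ν, covDeriv g T (f x) l α β μ ν * n β * n μ * e j ν = 0 := by
      have : ∀ l α, (g (f x))⁻¹ l α *
          ∑ β, ∑ μ, ∑ ν, covDeriv g T (f x) l α β μ ν * n β * n μ * e j ν
          = ∑ β, ∑ μ, ∑ ν, (g (f x))⁻¹ l α * covDeriv g T (f x) l α β μ ν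
            * (n β * n μ * e j ν) := by
        intro l α
        simp only [Finset.mul_sum]
        exact Finset.sum_congr rfl fun _ _ => Finset.sum_congr rfl fun _ _ =>
          Finset.sum_congr rfl fun _ _ => by ring
      simp only [this]
      have c : ∀ F : Fin 4 → Fin 4 → Fin 4 → Fin 4 → Fin 4 → ℝ,
          ∑ l, ∑ α, ∑ β, ∑ μ, ∑ ν, F l α β μ ν = ∑ β, ∑ μ, ∑ ν, ∑ l, ∑ α, F l α β μ ν := by
        intro F
        exact (Finset.sum_congr rfl fun l _ => sum_comm_rotate (F l)).trans (sum_comm_rotate _)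
      rw [c]
      simp only [← Finset.sum_mul, hdiv]
      simp
    simp only [hlin] at hsum ⊢
    refine H.sum_tangential_eq_zero _ htr ?_
    refine Finset.sum_eq_zero fun l _ => ?_
    rw [← mul_zero (n l), ← hsum l, Finset.mul_sum]
    exact Finset.sum_congr rfl fun _ _ => by ring
  -- Symmetry of `K` against skewness of `T` in its first pair.
  have h3 : ∑ i, ∑ k, (γ x)⁻¹ i k *
      ∑ l, (∑ m, (γ x)⁻¹ l m * K i m) * contract4 (T (f x)) (e k) (e l) n (e j) = 0 := by
    set P : Fin 3 → Fin 3 → ℝ := fun k l => contract4 (T (f x)) (e k) (e l) n (e j) with hP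
    have hPs : ∀ k l, P k l = -P l k := fun k l => contract4_antisymm_left _ _ _ _ hs
    set M : Fin 3 → Fin 3 → ℝ := fun k l => ∑ i, ∑ m, (γ x)⁻¹ i k * (γ x)⁻¹ l m * K i m with hM
    have hMs : ∀ k l, M k l = M l k := by
      intro k l
      simp only [hM]
      rw [Finset.sum_comm]
      refine Finset.sum_congr rfl fun m _ => Finset.sum_congr rfl fun i _ => ?_
      rw [show K i m = K m i from H.extrinsicCurvature_symm i m, hinv i k, hinv l m]
      ring
    have h4 : ∑ i, ∑ k, (γ x)⁻¹ i k * ∑ l, (∑ m, (γ x)⁻¹ l m * K i m) * P k l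
        = ∑ k, ∑ l, M k l * P k l := by
      simp only [hM, Fin.sum_univ_three]
      ring
    have h5 : ∑ k, ∑ l, M k l * P k l = -∑ k, ∑ l, M k l * P k l := by
      conv_lhs => rw [Finset.sum_comm]
      simp only [← Finset.sum_neg_distrib]
      refine Finset.sum_congr rfl fun l _ => Finset.sum_congr rfl fun k _ => ?_
      rw [hMs, hPs]; ring
    rw [h4]
    exact self_eq_neg.mp h5
  rw [h2, h3, sub_zero, zero_sub, neg_inj]
  simp only [Fin.sum_univ_three]
  ring

end IsLocalHypersurface

end divergence

/-! ### The Levi-Civita tensor in the frame of the hypersurface -/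

section frame

lemma permSymbol_fin_three (a b c : Fin 3) : permSymbol ![a, b, c]
    = ((a : ℕ) - (b : ℕ) : ℝ) * ((b : ℕ) - (c : ℕ)) * ((c : ℕ) - (a : ℕ)) / 2 := by
  rw [permSymbol, Matrix.det_fin_three]
  simp only [Matrix.submatrix_apply, Matrix.one_apply, id, Matrix.cons_val]
  fin_cases a <;> fin_cases b <;> fin_cases c <;> simp <;> norm_num

lemma permSymbol_eq_zero {n : ℕ} (a : Fin n → Fin n) (k : Fin n) (hk : ∀ i, a i ≠ k) :
    permSymbol a = 0 :=
  Matrix.det_eq_zero_of_column_eq_zero k fun i => by simp [hk i]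

lemma permSymbol_cons_zero {n : ℕ} (a : Fin n → Fin n) :
    permSymbol (Fin.cons 0 (fun i => (a i).succ) : Fin (n + 1) → Fin (n + 1)) = permSymbol a := by
  rw [permSymbol, Matrix.det_succ_row_zero, Fin.sum_univ_succ, permSymbol]
  simp [Matrix.one_apply, (Fin.succ_ne_zero _).symm]
  congr 1
  ext i j
  simp [Matrix.one_apply]

/-- Selecting rows of a matrix multiplies its determinant by the permutation symbol. -/
lemma det_of_rows {n : ℕ} (F : Matrix (Fin n) (Fin n) ℝ) (a : Fin n → Fin n) :
    (Matrix.of fun i => F (a i)).det = permSymbol a * F.det := by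
  rw [permSymbol, ← Matrix.det_mul]
  congr 1
  ext i j
  simp [Matrix.mul_apply, Matrix.one_apply]

lemma det_eq_sum_row {n : ℕ} (A : Matrix (Fin n) (Fin n) ℝ) (i : Fin n) :
    A.det = ∑ k, A i k * (A.updateRow i (Pi.single k 1)).det := by
  have := congrFun (congrFun A.mul_adjugate i) i
  simpa [Matrix.mul_apply, Matrix.adjugate_apply] using this.symm

/-- The Levi-Civita tensor on four vectors is their determinant, up to the volume factor. -/
lemma contract4_leviCivita (g : Coord 4 → Matrix (Fin 4) (Fin 4) ℝ) (y : Coord 4) (s : ℤˣ)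
    (a b c d : Fin 4 → ℝ) :
    contract4 (fun κ τ μ ν => leviCivita g y s ![κ, τ, μ, ν]) a b c d
      = ((s : ℤ) : ℝ) * √|(g y).det| * (Matrix.of ![a, b, c, d]).det := by
  have key : (Matrix.of ![a, b, c, d]).det
      = ∑ κ, ∑ τ, ∑ μ, ∑ ν, a κ * (b τ * (c μ * (d ν * permSymbol ![κ, τ, μ, ν]))) := by
    rw [det_eq_sum_row _ 0]
    refine Finset.sum_congr rfl fun κ _ => ?_
    rw [det_eq_sum_row _ 1, Finset.mul_sum]
    refine Finset.sum_congr rfl fun τ _ => ?_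
    rw [det_eq_sum_row _ 2, Finset.mul_sum, Finset.mul_sum]
    refine Finset.sum_congr rfl fun μ _ => ?_
    rw [det_eq_sum_row _ 3, Finset.mul_sum, Finset.mul_sum, Finset.mul_sum]
    refine Finset.sum_congr rfl fun ν _ => ?_
    have : ((((Matrix.of ![a, b, c, d]).updateRow 0 (Pi.single κ 1)).updateRow 1
        (Pi.single τ 1)).updateRow 2 (Pi.single μ 1)).updateRow 3 (Pi.single ν 1)
        = (1 : Matrix (Fin 4) (Fin 4) ℝ).submatrix ![κ, τ, μ, ν] id := by
      ext i j
      fin_cases i <;> simp [Matrix.updateRow_apply, Matrix.one_apply, Pi.single_apply, eq_comm] <;>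
        congr
    rw [this]
    simp [Matrix.updateRow_apply, permSymbol]
  rw [key]
  simp only [contract4, leviCivita, Finset.mul_sum]
  exact Finset.sum_congr rfl fun _ _ => Finset.sum_congr rfl fun _ _ =>
    Finset.sum_congr rfl fun _ _ => Finset.sum_congr rfl fun _ _ => by ring

/-- The contraction of two Levi-Civita tensors in dimension three over one index. -/
lemma sum_leviCivita_mul_leviCivita {h : Coord 3 → Matrix (Fin 3) (Fin 3) ℝ} {x : Coord 3}
    (hsym : ∀ y i j, h y i j = h y j i) (hpos : 0 < (h x).det) (s : ℤˣ) (j b p q : Fin 3) :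
    ∑ c, ∑ c', leviCivita h x s ![j, b, c'] * (h x)⁻¹ c' c * leviCivita h x s ![p, q, c]
      = h x j p * h x b q - h x j q * h x b p := by
  have hs : ((s : ℤ) : ℝ) * ((s : ℤ) : ℝ) = 1 := by
    rw [← Int.cast_mul, ← Units.val_mul, Int.units_mul_self]; simp
  have hr : √|(h x).det| * √|(h x).det| = (h x).det := by
    rw [Real.mul_self_sqrt (abs_nonneg _), abs_of_pos hpos]
  have key : ∑ c, ∑ c', permSymbol ![j, b, c'] * (h x).adjugate c' c * permSymbol ![p, q, c]
      = h x j p * h x b q - h x j q * h x b p := by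
    have h10 := hsym x 1 0
    have h20 := hsym x 2 0
    have h21 := hsym x 2 1
    simp only [permSymbol_fin_three, Matrix.adjugate_fin_three, Fin.sum_univ_three]
    fin_cases j <;> fin_cases b <;> fin_cases p <;> fin_cases q <;>
      simp [h10, h20, h21] <;> ring
  have e : ∀ c c', leviCivita h x s ![j, b, c'] * (h x)⁻¹ c' c * leviCivita h x s ![p, q, c]
      = permSymbol ![j, b, c'] * (h x).adjugate c' c * permSymbol ![p, q, c] := by
    intro c c'
    rw [leviCivita, leviCivita, Matrix.inv_def, Matrix.smul_apply, Ring.inverse_eq_inv',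
      smul_eq_mul]
    have : ((s : ℤ) : ℝ) * √|(h x).det| * permSymbol ![j, b, c']
        * ((h x).det⁻¹ * (h x).adjugate c' c)
        * (((s : ℤ) : ℝ) * √|(h x).det| * permSymbol ![p, q, c])
        = (((s : ℤ) : ℝ) * ((s : ℤ) : ℝ)) * ((√|(h x).det| * √|(h x).det|) * (h x).det⁻¹)
          * (permSymbol ![j, b, c'] * (h x).adjugate c' c * permSymbol ![p, q, c]) := by ring
    rw [this, hs, hr, mul_inv_cancel₀ hpos.ne', one_mul, one_mul]
  simp only [e, key]

end frame

/-! ### The dual Weyl tensor in the frame of the hypersurface -/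

section dualFrame

lemma sum_pull_last {ι : Type*} [Fintype ι] (F : Fin 4 → Fin 4 → Fin 4 → Fin 4 → ι → ℝ) :
    ∑ α, ∑ β, ∑ μ, ∑ ν, ∑ l, F α β μ ν l = ∑ l, ∑ α, ∑ β, ∑ μ, ∑ ν, F α β μ ν l := by
  symm
  rw [Finset.sum_comm]
  refine Finset.sum_congr rfl fun α _ => ?_
  rw [Finset.sum_comm]
  refine Finset.sum_congr rfl fun β _ => ?_
  rw [Finset.sum_comm]
  exact Finset.sum_congr rfl fun μ _ => Finset.sum_comm

lemma sum_sum_mul_comm {m n : ℕ} (G : Fin m → Fin m → ℝ) (P : Fin m → Fin m → Fin n → Fin n → ℝ) :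
    ∑ σ, ∑ τ, ∑ i, ∑ j, G i j * P i j σ τ = ∑ i, ∑ j, G i j * ∑ σ, ∑ τ, P i j σ τ := by
  simp only [Finset.mul_sum]
  calc _ = ∑ σ, ∑ i, ∑ τ, ∑ j, _ := Finset.sum_congr rfl fun σ _ => Finset.sum_comm
    _ = ∑ i, ∑ σ, ∑ τ, ∑ j, _ := Finset.sum_comm
    _ = ∑ i, ∑ σ, ∑ j, ∑ τ, _ := Finset.sum_congr rfl fun i _ => Finset.sum_congr rfl fun σ _ =>
        Finset.sum_comm
    _ = ∑ i, ∑ j, ∑ σ, ∑ τ, _ := Finset.sum_congr rfl fun i _ => Finset.sum_comm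

variable {g : Coord 4 → Matrix (Fin 4) (Fin 4) ℝ} {f N : Coord 3 → Coord 4} {x : Coord 3}

/-- The dual Weyl tensor on four vectors, as a double contraction of the Weyl tensor on the first
two of them and the Levi-Civita tensor on the last two. -/
lemma contract4_dualWeyl (y : Coord 4) (s : ℤˣ) (a b c d : Fin 4 → ℝ) :
    contract4 (dualWeyl g y s) a b c d = (1 / 2) * ∑ σ, ∑ τ, (g y)⁻¹ σ τ * ∑ ρ, ∑ κ,
      (∑ α, ∑ β, weyl g y α β ρ σ * a α * b β) * (g y)⁻¹ ρ κ
        * ∑ μ, ∑ ν, leviCivita g y s ![κ, τ, μ, ν] * c μ * d ν := by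
  have e1 : contract4 (dualWeyl g y s) a b c d = ∑ α, ∑ β, ∑ μ, ∑ ν, ∑ ρ, ∑ σ, ∑ κ, ∑ τ,
      (1 / 2) * (weyl g y α β ρ σ * a α * b β) * ((g y)⁻¹ ρ κ * (g y)⁻¹ σ τ)
        * (leviCivita g y s ![κ, τ, μ, ν] * c μ * d ν) := by
    simp only [contract4, dualWeyl, Finset.mul_sum, Finset.sum_mul]
    refine Finset.sum_congr rfl fun α _ => Finset.sum_congr rfl fun β _ =>
      Finset.sum_congr rfl fun μ _ => Finset.sum_congr rfl fun ν _ =>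
      Finset.sum_congr rfl fun ρ _ => Finset.sum_congr rfl fun σ _ =>
      Finset.sum_congr rfl fun κ _ => Finset.sum_congr rfl fun τ _ => by ring
  have e2 : ∀ ρ σ κ τ, ∑ α, ∑ β, ∑ μ, ∑ ν,
      (1 / 2) * (weyl g y α β ρ σ * a α * b β) * ((g y)⁻¹ ρ κ * (g y)⁻¹ σ τ)
        * (leviCivita g y s ![κ, τ, μ, ν] * c μ * d ν)
      = (1 / 2) * (∑ α, ∑ β, weyl g y α β ρ σ * a α * b β) * ((g y)⁻¹ ρ κ * (g y)⁻¹ σ τ)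
        * (∑ μ, ∑ ν, leviCivita g y s ![κ, τ, μ, ν] * c μ * d ν) := by
    intro ρ σ κ τ
    simp only [← Finset.mul_sum, ← Finset.sum_mul]
  have e3 : ∀ F : Fin 4 → Fin 4 → Fin 4 → Fin 4 → Fin 4 → Fin 4 → Fin 4 → Fin 4 → ℝ,
      ∑ α, ∑ β, ∑ μ, ∑ ν, ∑ ρ, ∑ σ, ∑ κ, ∑ τ, F α β μ ν ρ σ κ τ
        = ∑ ρ, ∑ σ, ∑ κ, ∑ τ, ∑ α, ∑ β, ∑ μ, ∑ ν, F α β μ ν ρ σ κ τ := by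
    intro F
    rw [sum_pull_last]
    refine Finset.sum_congr rfl fun ρ _ => ?_
    rw [sum_pull_last]
    refine Finset.sum_congr rfl fun σ _ => ?_
    rw [sum_pull_last]
    exact Finset.sum_congr rfl fun κ _ => sum_pull_last _
  rw [e1, e3]
  simp only [e2]
  have e4 : ∀ w o : Fin 4 → Fin 4 → ℝ, ∑ ρ, ∑ σ, ∑ κ, ∑ τ,
      (1 / 2) * w ρ σ * ((g y)⁻¹ ρ κ * (g y)⁻¹ σ τ) * o κ τ
      = (1 / 2) * ∑ σ, ∑ τ, (g y)⁻¹ σ τ * ∑ ρ, ∑ κ, w ρ σ * (g y)⁻¹ ρ κ * o κ τ := by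
    intro w o
    simp only [Finset.mul_sum]
    rw [Finset.sum_comm]
    refine Finset.sum_congr rfl fun σ _ => ?_
    calc _ = ∑ ρ, ∑ τ, ∑ κ, _ := Finset.sum_congr rfl fun ρ _ => Finset.sum_comm
      _ = ∑ τ, ∑ ρ, ∑ κ, _ := Finset.sum_comm
      _ = _ := by
        refine Finset.sum_congr rfl fun τ _ => Finset.sum_congr rfl fun ρ _ =>
          Finset.sum_congr rfl fun κ _ => ?_
        ring
  exact e4 (fun ρ σ => ∑ α, ∑ β, weyl g y α β ρ σ * a α * b β)
    (fun κ τ => ∑ μ, ∑ ν, leviCivita g y s ![κ, τ, μ, ν] * c μ * d ν)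

lemma contract4_leviCivita_eq_zero₁ (y : Coord 4) (s : ℤˣ) (u v d : Fin 4 → ℝ) :
    contract4 (fun κ τ μ ν => leviCivita g y s ![κ, τ, μ, ν]) u v u d = 0 := by
  rw [contract4_leviCivita,
    Matrix.det_zero_of_row_eq (M := Matrix.of ![u, v, u, d]) (i := 0) (j := 2) (by decide) rfl,
    mul_zero]

lemma contract4_leviCivita_eq_zero₂ (y : Coord 4) (s : ℤˣ) (u v d : Fin 4 → ℝ) :
    contract4 (fun κ τ μ ν => leviCivita g y s ![κ, τ, μ, ν]) u v v d = 0 := by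
  rw [contract4_leviCivita,
    Matrix.det_zero_of_row_eq (M := Matrix.of ![u, v, v, d]) (i := 1) (j := 2) (by decide) rfl,
    mul_zero]

lemma contract4_leviCivita_eq_zero₃ (y : Coord 4) (s : ℤˣ) (u c d : Fin 4 → ℝ) :
    contract4 (fun κ τ μ ν => leviCivita g y s ![κ, τ, μ, ν]) u u c d = 0 := by
  rw [contract4_leviCivita,
    Matrix.det_zero_of_row_eq (M := Matrix.of ![u, u, c, d]) (i := 0) (j := 1) (by decide) rfl,
    mul_zero]

lemma contract4_leviCivita_frame (y : Coord 4) (s : ℤˣ) (a b c d : Fin 4) :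
    contract4 (fun κ τ μ ν => leviCivita g y s ![κ, τ, μ, ν]) (frameMatrix f N x a)
        (frameMatrix f N x b) (frameMatrix f N x c) (frameMatrix f N x d)
      = ((s : ℤ) : ℝ) * √|(g y).det| * frameDet f N x * permSymbol ![a, b, c, d] := by
  rw [contract4_leviCivita]
  have : Matrix.of ![frameMatrix f N x a, frameMatrix f N x b, frameMatrix f N x c,
      frameMatrix f N x d] = Matrix.of fun i => frameMatrix f N x (![a, b, c, d] i) := by
    ext i j
    fin_cases i <;> rfl
  rw [this, det_of_rows]
  change _ * (_ * frameDet f N x) = _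
  ring

/-- Four tangent vectors of the hypersurface are linearly dependent. -/
lemma contract4_leviCivita_tangent (y : Coord 4) (s : ℤˣ) (a b c d : Fin 3) :
    contract4 (fun κ τ μ ν => leviCivita g y s ![κ, τ, μ, ν]) (tangentComp f x a)
      (tangentComp f x b) (tangentComp f x c) (tangentComp f x d) = 0 := by
  have h1 := contract4_leviCivita_frame (g := g) (f := f) (N := 0) (x := x) y s a.succ b.succ c.succ
    d.succ
  rw [permSymbol_eq_zero _ 0 (fun i => by fin_cases i <;> exact Fin.succ_ne_zero _), mul_zero] at h1
  exact h1

namespace IsLocalHypersurface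

variable (H : IsLocalHypersurface g f N x) {s₄ s₃ : ℤˣ} (hs : OrientationsCompatible f N x s₄ s₃)

include H

section

include hs

/-- The volume factor of `ε(n, e_a, e_b, e_c)` is that of `ε_abc`: this is the compatibility of the
orientations, together with `(det F)² det g = -det γ` for the frame `F = (n, e_1, e_2, e_3)`. -/
lemma volume_factor :
    ((s₄ : ℤ) : ℝ) * √|(g (f x)).det| * frameDet f N x
      = ((s₃ : ℤ) : ℝ) * √|(inducedMetric g f x).det| := by
  have hsq : ∀ s : ℤˣ, ((s : ℤ) : ℝ) * ((s : ℤ) : ℝ) = 1 := fun s => by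
    rw [← Int.cast_mul, ← Units.val_mul, Int.units_mul_self]; simp
  have habs : ∀ s : ℤˣ, |((s : ℤ) : ℝ)| = 1 := fun s => by
    have := hsq s
    rw [← abs_mul_abs_self] at this
    nlinarith [abs_nonneg ((s : ℤ) : ℝ)]
  have h1 : |frameDet f N x| = ((s₄ : ℤ) : ℝ) * ((s₃ : ℤ) : ℝ) * frameDet f N x := by
    have := abs_of_pos hs
    rwa [abs_mul, abs_mul, habs, habs, one_mul, one_mul] at this
  have h2 : √|(inducedMetric g f x).det| = |frameDet f N x| * √|(g (f x)).det| := by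
    rw [← abs_neg, ← H.frameDet_sq_mul_det, abs_mul, Real.sqrt_mul (abs_nonneg _), abs_pow,
      Real.sqrt_sq (abs_nonneg _)]
  rw [h2, h1]
  linear_combination (-((s₄ : ℤ) : ℝ) * √|(g (f x)).det| * frameDet f N x) * hsq s₃

/-- `ε(n, e_a, e_b, e_c) = ε_abc`. -/
lemma contract4_leviCivita_normal_fst (a b c : Fin 3) :
    contract4 (fun κ τ μ ν => leviCivita g (f x) s₄ ![κ, τ, μ, ν]) (fun μ => N x μ)
        (tangentComp f x a) (tangentComp f x b) (tangentComp f x c)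
      = leviCivita (inducedMetric g f) x s₃ ![a, b, c] := by
  refine (contract4_leviCivita_frame (f x) s₄ 0 a.succ b.succ c.succ).trans ?_
  have e : ![0, a.succ, b.succ, c.succ] = Fin.cons 0 fun i => (![a, b, c] i).succ := by
    ext i
    fin_cases i <;> rfl
  rw [H.volume_factor hs, leviCivita, e, permSymbol_cons_zero]

lemma contract4_leviCivita_normal_snd (a b c : Fin 3) :
    contract4 (fun κ τ μ ν => leviCivita g (f x) s₄ ![κ, τ, μ, ν]) (tangentComp f x a)
        (fun μ => N x μ) (tangentComp f x b) (tangentComp f x c)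
      = -leviCivita (inducedMetric g f) x s₃ ![a, b, c] := by
  rw [← H.contract4_leviCivita_normal_fst hs]
  refine (contract4_leviCivita_frame (f x) s₄ a.succ 0 b.succ c.succ).trans
    (Eq.trans ?_ (congrArg Neg.neg (contract4_leviCivita_frame (f x) s₄ 0 a.succ b.succ
      c.succ)).symm)
  have e : ![a.succ, 0, b.succ, c.succ] = ![0, a.succ, b.succ, c.succ] ∘ Equiv.swap 0 1 := by
    ext i; fin_cases i <;> rfl
  rw [e, permSymbol_comp_swap _ (by decide)]
  ring

lemma contract4_leviCivita_normal_thd (a b c : Fin 3) :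
    contract4 (fun κ τ μ ν => leviCivita g (f x) s₄ ![κ, τ, μ, ν]) (tangentComp f x a)
        (tangentComp f x b) (fun μ => N x μ) (tangentComp f x c)
      = leviCivita (inducedMetric g f) x s₃ ![a, b, c] := by
  rw [← H.contract4_leviCivita_normal_fst hs]
  refine (contract4_leviCivita_frame (f x) s₄ a.succ b.succ 0 c.succ).trans
    (Eq.trans ?_ (contract4_leviCivita_frame (f x) s₄ 0 a.succ b.succ c.succ).symm)
  have e : ![a.succ, b.succ, 0, c.succ]
      = (![0, a.succ, b.succ, c.succ] ∘ Equiv.swap 1 2) ∘ Equiv.swap 0 2 := by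
    ext i; fin_cases i <;> rfl
  rw [e, permSymbol_comp_swap _ (by decide), permSymbol_comp_swap _ (by decide), neg_neg]

end

/-- A contraction with the inverse metric, in the frame of the hypersurface. -/
lemma sum_mul_inv_metric_mul (p q : Fin 4 → ℝ) :
    ∑ ρ, ∑ κ, p ρ * (g (f x))⁻¹ ρ κ * q κ = -((∑ ρ, N x ρ * p ρ) * ∑ κ, N x κ * q κ)
      + ∑ i, ∑ j, (inducedMetric g f x)⁻¹ i j *
        ((∑ ρ, tangentComp f x i ρ * p ρ) * ∑ κ, tangentComp f x j κ * q κ) := by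
  simp only [H.inv_metric_eq, Fin.sum_univ_four, Fin.sum_univ_three]
  ring

/-- The dual Weyl tensor in the frame of the hypersurface. -/
lemma contract4_dualWeyl_frame (s : ℤˣ) (a b c d : Fin 4 → ℝ) :
    contract4 (dualWeyl g (f x) s) a b c d = (1 / 2) * (
      -(-(contract4 (weyl g (f x)) a b (fun μ => N x μ) (fun μ => N x μ)
          * contract4 (fun κ τ μ ν => leviCivita g (f x) s ![κ, τ, μ, ν]) (fun μ => N x μ)
            (fun μ => N x μ) c d)
        + ∑ k, ∑ l, (inducedMetric g f x)⁻¹ k l *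
          (contract4 (weyl g (f x)) a b (fun μ => N x μ) (tangentComp f x k)
            * contract4 (fun κ τ μ ν => leviCivita g (f x) s ![κ, τ, μ, ν]) (fun μ => N x μ)
              (tangentComp f x l) c d))
      + ∑ i, ∑ j, (inducedMetric g f x)⁻¹ i j *
        (-(contract4 (weyl g (f x)) a b (tangentComp f x i) (fun μ => N x μ)
          * contract4 (fun κ τ μ ν => leviCivita g (f x) s ![κ, τ, μ, ν]) (tangentComp f x j)
            (fun μ => N x μ) c d)
        + ∑ k, ∑ l, (inducedMetric g f x)⁻¹ k l *
          (contract4 (weyl g (f x)) a b (tangentComp f x i) (tangentComp f x k)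
            * contract4 (fun κ τ μ ν => leviCivita g (f x) s ![κ, τ, μ, ν]) (tangentComp f x j)
              (tangentComp f x l) c d))) := by
  set w : Fin 4 → Fin 4 → ℝ := fun ρ σ => ∑ α, ∑ β, weyl g (f x) α β ρ σ * a α * b β with hw
  set o : Fin 4 → Fin 4 → ℝ := fun κ τ => ∑ μ, ∑ ν, leviCivita g (f x) s ![κ, τ, μ, ν] * c μ * d ν
    with ho
  have ew : ∀ u v, contract4 (weyl g (f x)) a b u v = ∑ σ, v σ * ∑ ρ, u ρ * w ρ σ := by
    intro u v
    simp only [contract4, hw, Finset.mul_sum]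
    rw [sum_comm_rotate, sum_comm_rotate, Finset.sum_comm]
    refine Finset.sum_congr rfl fun _ _ => Finset.sum_congr rfl fun _ _ =>
      Finset.sum_congr rfl fun _ _ => Finset.sum_congr rfl fun _ _ => by ring
  have eo : ∀ u v, contract4 (fun κ τ μ ν => leviCivita g (f x) s ![κ, τ, μ, ν]) u v c d
      = ∑ τ, v τ * ∑ κ, u κ * o κ τ := by
    intro u v
    simp only [contract4, ho, Finset.mul_sum]
    rw [Finset.sum_comm]
    refine Finset.sum_congr rfl fun _ _ => Finset.sum_congr rfl fun _ _ =>
      Finset.sum_congr rfl fun _ _ => Finset.sum_congr rfl fun _ _ => by ring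
  rw [contract4_dualWeyl]
  congr 1
  have h1 : ∀ σ τ, (g (f x))⁻¹ σ τ * ∑ ρ, ∑ κ, w ρ σ * (g (f x))⁻¹ ρ κ * o κ τ
      = -((∑ ρ, N x ρ * w ρ σ) * (g (f x))⁻¹ σ τ * ∑ κ, N x κ * o κ τ)
      + ∑ i, ∑ j, (inducedMetric g f x)⁻¹ i j * ((∑ ρ, tangentComp f x i ρ * w ρ σ)
        * (g (f x))⁻¹ σ τ * ∑ κ, tangentComp f x j κ * o κ τ) := by
    intro σ τ
    rw [H.sum_mul_inv_metric_mul (fun ρ => w ρ σ) (fun κ => o κ τ), mul_add]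
    refine congrArg₂ _ (by ring) ?_
    · rw [Finset.mul_sum]
      refine Finset.sum_congr rfl fun i _ => ?_
      rw [Finset.mul_sum]
      exact Finset.sum_congr rfl fun j _ => by ring
  have h2 : ∑ σ, ∑ τ, (g (f x))⁻¹ σ τ * ∑ ρ, ∑ κ, w ρ σ * (g (f x))⁻¹ ρ κ * o κ τ
      = -(∑ σ, ∑ τ, (∑ ρ, N x ρ * w ρ σ) * (g (f x))⁻¹ σ τ * ∑ κ, N x κ * o κ τ)
      + ∑ i, ∑ j, (inducedMetric g f x)⁻¹ i j * ∑ σ, ∑ τ, ((∑ ρ, tangentComp f x i ρ * w ρ σ)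
        * (g (f x))⁻¹ σ τ * ∑ κ, tangentComp f x j κ * o κ τ) := by
    simp only [h1, Finset.sum_add_distrib, Finset.sum_neg_distrib]
    congr 1
    exact sum_sum_mul_comm _ _
  change ∑ σ, ∑ τ, (g (f x))⁻¹ σ τ * ∑ ρ, ∑ κ, w ρ σ * (g (f x))⁻¹ ρ κ * o κ τ = _
  rw [h2]
  simp only [ew, eo]
  rw [H.sum_mul_inv_metric_mul (fun σ => ∑ ρ, N x ρ * w ρ σ) (fun τ => ∑ κ, N x κ * o κ τ)]
  refine congrArg₂ _ rfl (Finset.sum_congr rfl fun i _ => Finset.sum_congr rfl fun j _ => ?_)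
  rw [H.sum_mul_inv_metric_mul (fun σ => ∑ ρ, tangentComp f x i ρ * w ρ σ)
    (fun τ => ∑ κ, tangentComp f x j κ * o κ τ)]

end IsLocalHypersurface

end dualFrame

/-! ### The divergence equations in coordinates -/

section coordinates

variable {g : Coord 4 → Matrix (Fin 4) (Fin 4) ℝ} {f N : Coord 3 → Coord 4} {x : Coord 3}

lemma restrict_eq_contract4 (T : Fin 4 → Fin 4 → Fin 4 → Fin 4 → ℝ) (z : Coord 3) (i j : Fin 3) :
    restrict f z (fun α β => ∑ μ, ∑ ν, T α μ ν β * N z μ * N z ν) i j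
      = contract4 T (tangentComp f z i) (fun μ => N z μ) (fun μ => N z μ) (tangentComp f z j) := by
  simp only [restrict, contract4, Finset.mul_sum]
  refine Finset.sum_congr rfl fun α _ => ?_
  rw [Finset.sum_comm]
  refine Finset.sum_congr rfl fun μ _ => ?_
  rw [Finset.sum_comm]
  exact Finset.sum_congr rfl fun ν _ => Finset.sum_congr rfl fun β _ => by ring

lemma electricPart_eq : electricPart g f N = fun z i j => contract4 (weyl g (f z))
    (tangentComp f z i) (fun μ => N z μ) (fun μ => N z μ) (tangentComp f z j) := by
  funext z i j
  exact restrict_eq_contract4 _ z i j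

lemma magneticPart_eq (s : ℤˣ) : (fun z => magneticPart g f N z s) = fun z i j =>
    contract4 (dualWeyl g (f z) s) (tangentComp f z i) (fun μ => N z μ) (fun μ => N z μ)
      (tangentComp f z j) := by
  funext z i j
  exact restrict_eq_contract4 _ z i j

lemma leviCivita_swap₀₂ (h : Coord 3 → Matrix (Fin 3) (Fin 3) ℝ) (z : Coord 3) (s : ℤˣ)
    (a b c : Fin 3) : leviCivita h z s ![a, b, c] = -leviCivita h z s ![c, b, a] := by
  have e : ![a, b, c] = ![c, b, a] ∘ Equiv.swap 0 2 := by
    ext i; fin_cases i <;> rfl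
  rw [leviCivita, leviCivita, e, permSymbol_comp_swap _ (by decide)]
  ring

/-- The algebra behind the divergence equation of the electric part: if
`B_dc = (1/2) X_d^{pq} ε_pqc` with `X` skew in its last two indices, then
`(K ∧ B)_j = -K^{kl} X_klj`. -/
lemma wedge_of_dual {h : Coord 3 → Matrix (Fin 3) (Fin 3) ℝ} {x : Coord 3}
    (hsym : ∀ y i j, h y i j = h y j i) (hpos : 0 < (h x).det) (s : ℤˣ) {K : Fin 3 → Fin 3 → ℝ}
    (hK : ∀ i j, K i j = K j i) {X : Fin 3 → Fin 3 → Fin 3 → ℝ} (hX : ∀ d a b, X d a b = -X d b a)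
    (j : Fin 3) :
    ∑ b, ∑ c, ∑ d, (∑ b', ∑ c', leviCivita h x s ![j, b', c'] * (h x)⁻¹ b' b * (h x)⁻¹ c' c)
        * (∑ e, K b e * (h x)⁻¹ e d)
        * ((1 / 2) * ∑ a, ∑ p, (h x)⁻¹ a p * ∑ r, ∑ q, (h x)⁻¹ r q
          * (X d a r * leviCivita h x s ![p, q, c]))
      = -∑ k, ∑ l, (∑ i, ∑ m, (h x)⁻¹ i k * (h x)⁻¹ l m * K i m) * X k l j := by
  have h1 : ∀ d c, (1 / 2) * ∑ a, ∑ p, (h x)⁻¹ a p * ∑ r, ∑ q, (h x)⁻¹ r q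
          * (X d a r * leviCivita h x s ![p, q, c])
      = (1 / 2) * ∑ p, ∑ q, (∑ a, ∑ r, (h x)⁻¹ a p * (h x)⁻¹ r q * X d a r)
          * leviCivita h x s ![p, q, c] := by
    intro d c
    simp only [Fin.sum_univ_three]
    ring
  -- Contraction of the two Levi-Civita tensors, `ε_jb'^c ε_pqc = h_jp h_b'q - h_jq h_b'p`.
  have h2 : ∀ (Z : Fin 3 → Fin 3 → ℝ) (b' : Fin 3),
      ∑ c, ∑ c', leviCivita h x s ![j, b', c'] * (h x)⁻¹ c' c
        * ((1 / 2) * ∑ p, ∑ q, Z p q * leviCivita h x s ![p, q, c])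
      = (1 / 2) * ∑ p, ∑ q, Z p q * (h x j p * h x b' q - h x j q * h x b' p) := by
    intro Z b'
    simp only [← sum_leviCivita_mul_leviCivita hsym hpos s]
    simp only [Fin.sum_univ_three]
    ring
  -- Lowering the indices raised before gives back `X`.
  have h3 : ∀ d b' j, ∑ p, ∑ q, (∑ a, ∑ r, (h x)⁻¹ a p * (h x)⁻¹ r q * X d a r)
      * (h x j p * h x b' q) = X d j b' := by
    intro d b' j
    have : ∑ p, ∑ q, (∑ a, ∑ r, (h x)⁻¹ a p * (h x)⁻¹ r q * X d a r) * (h x j p * h x b' q)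
        = ∑ a, ∑ r, (∑ p, (h x)⁻¹ a p * h x p j) * (∑ q, (h x)⁻¹ r q * h x q b') * X d a r := by
      simp only [hsym x j, hsym x b', Fin.sum_univ_three]
      ring
    rw [this]
    simp only [sum_inv_mul hpos.ne']
    simp
  have h4 : ∀ d b', ∑ c, ∑ c', leviCivita h x s ![j, b', c'] * (h x)⁻¹ c' c
      * ((1 / 2) * ∑ a, ∑ p, (h x)⁻¹ a p * ∑ r, ∑ q, (h x)⁻¹ r q
          * (X d a r * leviCivita h x s ![p, q, c])) = -X d b' j := by
    intro d b'
    simp only [h1, h2, mul_sub, Finset.sum_sub_distrib, h3]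
    have h5 := h3 d j b'
    have h6 : ∑ p, ∑ q, (∑ a, ∑ r, (h x)⁻¹ a p * (h x)⁻¹ r q * X d a r) * (h x j q * h x b' p)
        = X d b' j := by
      rw [← h5]
      exact Finset.sum_congr rfl fun _ _ => Finset.sum_congr rfl fun _ _ => by ring
    rw [h6, hX d j b']
    ring
  -- Collecting the factors of `K` and of the inverse metrics into `K^{kl}`.
  have h7 : ∀ B : Fin 3 → Fin 3 → ℝ, ∑ b, ∑ c, ∑ d,
      (∑ b', ∑ c', leviCivita h x s ![j, b', c'] * (h x)⁻¹ b' b * (h x)⁻¹ c' c)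
        * (∑ e, K b e * (h x)⁻¹ e d) * B d c
      = ∑ k, ∑ l, (∑ i, ∑ m, (h x)⁻¹ i k * (h x)⁻¹ l m * K i m)
        * ∑ c, ∑ c', leviCivita h x s ![j, l, c'] * (h x)⁻¹ c' c * B k c := by
    intro B
    have e : ∀ k l, ∑ i, ∑ m, (h x)⁻¹ i k * (h x)⁻¹ l m * K i m
        = ∑ b, (h x)⁻¹ l b * ∑ e, K b e * (h x)⁻¹ e k := by
      intro k l
      rw [Finset.sum_comm]
      simp only [Finset.mul_sum]
      exact Finset.sum_congr rfl fun m _ => Finset.sum_congr rfl fun i _ => by rw [hK i m]; ring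
    simp only [e]
    generalize leviCivita h x s = ε
    have e2 : ∀ b d, ∑ e, K b e * (h x)⁻¹ e d = (Matrix.of K * (h x)⁻¹) b d := fun b d => rfl
    simp only [e2]
    generalize Matrix.of K * (h x)⁻¹ = Q
    simp only [Fin.sum_univ_three]
    ring
  rw [h7]
  simp only [h4, mul_neg, Finset.sum_neg_distrib]

/-- The algebra behind the divergence equation of the magnetic part:
`(K ∧ E)_j = -K^{kl} E_k^b ε_blj`. -/
lemma wedge_eq {h : Coord 3 → Matrix (Fin 3) (Fin 3) ℝ} {x : Coord 3}
    (hsym : ∀ y i j, h y i j = h y j i) (s : ℤˣ) {K : Fin 3 → Fin 3 → ℝ}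
    (hK : ∀ i j, K i j = K j i) (E : Fin 3 → Fin 3 → ℝ) (j : Fin 3) :
    ∑ b, ∑ c, ∑ d, (∑ b', ∑ c', leviCivita h x s ![j, b', c'] * (h x)⁻¹ b' b * (h x)⁻¹ c' c)
        * (∑ e, K b e * (h x)⁻¹ e d) * E d c
      = -∑ k, ∑ l, (∑ i, ∑ m, (h x)⁻¹ i k * (h x)⁻¹ l m * K i m)
        * ∑ a, ∑ b, (h x)⁻¹ a b * (E k a * leviCivita h x s ![b, l, j]) := by
  have hinv : ∀ i j, (h x)⁻¹ i j = (h x)⁻¹ j i := inv_symm hsym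
  have e : ∀ k l, ∑ i, ∑ m, (h x)⁻¹ i k * (h x)⁻¹ l m * K i m
      = ∑ b, (h x)⁻¹ l b * ∑ e, K b e * (h x)⁻¹ e k := by
    intro k l
    rw [Finset.sum_comm]
    simp only [Finset.mul_sum]
    exact Finset.sum_congr rfl fun m _ => Finset.sum_congr rfl fun i _ => by rw [hK i m]; ring
  have e3 : ∀ k l, ∑ a, ∑ b, (h x)⁻¹ a b * (E k a * leviCivita h x s ![b, l, j])
      = -∑ c, ∑ c', leviCivita h x s ![j, l, c'] * (h x)⁻¹ c' c * E k c := by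
    intro k l
    simp only [← Finset.sum_neg_distrib]
    exact Finset.sum_congr rfl fun a _ => Finset.sum_congr rfl fun b _ => by
      rw [leviCivita_swap₀₂ h x s b l j, hinv a b]; ring
  simp only [e, e3]
  generalize leviCivita h x s = ε
  have e2 : ∀ b d, ∑ e, K b e * (h x)⁻¹ e d = (Matrix.of K * (h x)⁻¹) b d := fun b d => rfl
  simp only [e2]
  generalize Matrix.of K * (h x)⁻¹ = Q
  simp only [Fin.sum_univ_three]
  ring

namespace IsLocalHypersurface

variable (H : IsLocalHypersurface g f N x) {s₄ s₃ : ℤˣ} (hs : OrientationsCompatible f N x s₄ s₃)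

include H hs

/-- `B_kj = (1/2) W(e_k, n, e_a, e_c) ε^ac_j`. -/
lemma magnetic_frame (k j : Fin 3) :
    contract4 (dualWeyl g (f x) s₄) (tangentComp f x k) (fun μ => N x μ) (fun μ => N x μ)
        (tangentComp f x j)
      = (1 / 2) * ∑ a, ∑ b, (inducedMetric g f x)⁻¹ a b * ∑ c, ∑ d, (inducedMetric g f x)⁻¹ c d *
        (contract4 (weyl g (f x)) (tangentComp f x k) (fun μ => N x μ) (tangentComp f x a)
          (tangentComp f x c) * leviCivita (inducedMetric g f) x s₃ ![b, d, j]) := by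
  rw [H.contract4_dualWeyl_frame]
  simp only [contract4_leviCivita_eq_zero₁, contract4_leviCivita_eq_zero₂,
    H.contract4_leviCivita_normal_thd hs, mul_zero, Finset.sum_const_zero, neg_zero, add_zero,
    zero_add]

/-- `W*(e_k, n, e_l, e_j) = -E_k^b ε_blj`. -/
lemma dualWeyl_tangent_frame (k l j : Fin 3) :
    contract4 (dualWeyl g (f x) s₄) (tangentComp f x k) (fun μ => N x μ) (tangentComp f x l)
        (tangentComp f x j)
      = -∑ a, ∑ b, (inducedMetric g f x)⁻¹ a b *
        (contract4 (weyl g (f x)) (tangentComp f x k) (fun μ => N x μ) (fun μ => N x μ)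
          (tangentComp f x a) * leviCivita (inducedMetric g f) x s₃ ![b, l, j]) := by
  rw [H.contract4_dualWeyl_frame]
  have hW : ∀ a, contract4 (weyl g (f x)) (tangentComp f x k) (fun μ => N x μ) (tangentComp f x a)
      (fun μ => N x μ) = -contract4 (weyl g (f x)) (tangentComp f x k) (fun μ => N x μ)
        (fun μ => N x μ) (tangentComp f x a) :=
    fun a => contract4_antisymm_right _ _ _ _ (weyl_antisymm_right (g := g) (y := f x))
  simp only [contract4_leviCivita_eq_zero₃, contract4_leviCivita_tangent,
    H.contract4_leviCivita_normal_fst hs, H.contract4_leviCivita_normal_snd hs, hW, mul_zero,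
    Finset.sum_const_zero, neg_zero, add_zero, zero_add, neg_mul, mul_neg, neg_neg,
    Finset.sum_neg_distrib]
  ring

/-- The divergence equation for the electric part. -/
lemma divergence_electricPart {Λ : ℝ} (hvac : ∀ᶠ y in 𝓝 (f x), ∀ μ ν,
      ricci g y μ ν - (1 / 2) * scalarCurvature g y * g y μ ν + Λ * g y μ ν = 0) (j : Fin 3) :
    divergence (inducedMetric g f) x (electricPart g f N) j
      = wedge (inducedMetric g f) s₃ x (extrinsicCurvature g f N)
        (fun z => magneticPart g f N z s₄) j := by
  have hskew : ∀ᶠ y in 𝓝 (f x), ∀ α β μ ν, weyl g y α β μ ν = -weyl g y β α μ ν := by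
    filter_upwards [H.eventually_smooth_metric, eventually_det_ne_zero H.smooth_metric H.det_ne]
      with y h1 h2
    exact weyl_antisymm_left H.symm h2 h1
  rw [electricPart_eq, magneticPart_eq, H.divergence_electric
    (contDiffAt_weyl H.det_ne H.smooth_metric) hskew weyl_antisymm_right
    (div_weyl H.symm H.det_ne H.smooth_metric hvac)]
  simp only [wedge, H.magnetic_frame hs]
  exact (wedge_of_dual (inducedMetric_symm H.symm) H.det_inducedMetric_pos s₃
    H.extrinsicCurvature_symm (X := fun d a b => contract4 (weyl g (f x)) (tangentComp f x d)
      (fun μ => N x μ) (tangentComp f x a) (tangentComp f x b))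
    (fun d a b => contract4_antisymm_right _ _ _ _ weyl_antisymm_right) j).symm

/-- The divergence equation for the magnetic part. -/
lemma divergence_magneticPart {Λ : ℝ} (hvac : ∀ᶠ y in 𝓝 (f x), ∀ μ ν,
      ricci g y μ ν - (1 / 2) * scalarCurvature g y * g y μ ν + Λ * g y μ ν = 0) (j : Fin 3) :
    divergence (inducedMetric g f) x (fun z => magneticPart g f N z s₄) j
      = -wedge (inducedMetric g f) s₃ x (extrinsicCurvature g f N) (electricPart g f N) j := by
  have hskew : ∀ᶠ y in 𝓝 (f x), ∀ α β μ ν,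
      dualWeyl g y s₄ α β μ ν = -dualWeyl g y s₄ β α μ ν := by
    filter_upwards [H.eventually_smooth_metric, eventually_det_ne_zero H.smooth_metric H.det_ne]
      with y h1 h2
    exact dualWeyl_antisymm_left H.symm h2 h1 s₄
  have h := H.divergence_electric (T := fun y => dualWeyl g y s₄)
    (contDiffAt_dualWeyl H.symm H.det_ne H.smooth_metric s₄) hskew (dualWeyl_antisymm_right s₄)
    (div_dualWeyl H.symm H.det_ne H.smooth_metric hvac s₄) j
  rw [electricPart_eq, magneticPart_eq, h]
  simp only [wedge, H.dualWeyl_tangent_frame hs]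
  rw [wedge_eq (inducedMetric_symm H.symm) s₃ H.extrinsicCurvature_symm]
  simp only [mul_neg, Finset.sum_neg_distrib]

end IsLocalHypersurface

end coordinates

/-! ### From manifolds to coordinates -/

/-- A chart of the maximal atlas is a local diffeomorphism. -/
lemma mdifferentiable_of_mem_maximalAtlas {n : ℕ} {M : Type*} [TopologicalSpace M]
    [ChartedSpace (Coord n) M] {φ : OpenPartialHomeomorph M (Coord n)}
    (hφ : φ ∈ IsManifold.maximalAtlas (𝓡 n) ∞ M) :
    φ.MDifferentiable (𝓡 n) (𝓡 n) :=
  ⟨(contMDiffOn_of_mem_maximalAtlas hφ).mdifferentiableOn (by simp),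
    (contMDiffOn_symm_of_mem_maximalAtlas hφ).mdifferentiableOn (by simp)⟩

/-- A bilinear form pulled back by a linear map, from its components. -/
lemma sum_bilinear_single {n : ℕ} {F : Type*} [AddCommGroup F] [Module ℝ F] [TopologicalSpace F]
    [IsTopologicalAddGroup F] [ContinuousConstSMul ℝ F]
    (B : F →L[ℝ] F →L[ℝ] ℝ) (D : Coord n →L[ℝ] F) (v w : Coord n) :
    ∑ μ, ∑ ν, B (D (EuclideanSpace.single μ 1)) (D (EuclideanSpace.single ν 1)) * v μ * w ν
      = B (D v) (D w) := by
  have hv : ∀ v : Coord n, v = ∑ μ, v μ • EuclideanSpace.single μ (1 : ℝ) := by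
    intro v
    ext i
    simp [Pi.single_apply]
  conv_rhs => rw [hv v, hv w]
  simp only [map_sum, map_smul, sum_apply, smul_apply, smul_eq_mul, Finset.mul_sum]
  rw [Finset.sum_comm]
  exact Finset.sum_congr rfl fun _ _ => Finset.sum_congr rfl fun _ _ => by ring

section tangentMap

variable {n : ℕ} {M : Type*} [TopologicalSpace M] [ChartedSpace (Coord n) M]
  [IsManifold (𝓡 n) ∞ M] {φ : OpenPartialHomeomorph M (Coord n)}

/-- The tangent map of a map which is smooth on an open set is smooth over that set. -/
lemma contMDiffAt_tangentMap_of_contMDiffOn {m : ℕ} {N : Type*} [TopologicalSpace N]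
    [ChartedSpace (Coord m) N] [IsManifold (𝓡 m) ∞ N] {f : M → N} {s : Set M} (hs : IsOpen s)
    (hf : ContMDiffOn (𝓡 n) (𝓡 m) ∞ f s) (p : TangentBundle (𝓡 n) M) (hp : p.1 ∈ s) :
    ContMDiffAt (𝓡 n).tangent (𝓡 m).tangent ∞ (tangentMap (𝓡 n) (𝓡 m) f) p := by
  have h1 := hf.contMDiffOn_tangentMapWithin (m := ∞) (by simp) hs.uniqueMDiffOn
  have ho : IsOpen (Bundle.TotalSpace.proj ⁻¹' s : Set (TangentBundle (𝓡 n) M)) :=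
    hs.preimage (FiberBundle.continuous_proj _ _)
  have h2 := h1.contMDiffAt (ho.mem_nhds hp)
  refine h2.congr_of_eventuallyEq ?_
  filter_upwards [ho.mem_nhds hp] with q hq
  exact (tangentMapWithin_eq_tangentMap (hs.uniqueMDiffOn q.1 hq)
    ((hf.mdifferentiableOn (by simp)).mdifferentiableAt (hs.mem_nhds hq))).symm

/-- The coordinate vector fields of a chart are smooth. -/
lemma contMDiffAt_coordVector (hφ : φ ∈ IsManifold.maximalAtlas (𝓡 n) ∞ M) {y : Coord n}
    (hy : y ∈ φ.target) (v : Coord n) :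
    ContMDiffAt (𝓡 n) (𝓡 n).tangent ∞ (fun z => (⟨φ.symm z,
      mfderiv (𝓡 n) (𝓡 n) φ.symm z v⟩ : TangentBundle (𝓡 n) M)) y := by
  have h1 : ContMDiffAt (𝓡 n) (𝓡 n).tangent ∞
      (fun z => (⟨z, v⟩ : TangentBundle (𝓡 n) (Coord n))) y :=
    contMDiffAt_vectorSpace_iff_contDiffAt.mpr contDiffAt_const
  exact (contMDiffAt_tangentMap_of_contMDiffOn φ.open_target
    (contMDiffOn_symm_of_mem_maximalAtlas hφ) ⟨y, v⟩ hy).comp y h1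

end tangentMap

section metric

variable {M : Type*} [TopologicalSpace M] [ChartedSpace (Coord 4) M] [IsManifold (𝓡 4) ∞ M]
  (g : LorentzMetric M) {φ : OpenPartialHomeomorph M (Coord 4)}

namespace LorentzMetric

lemma comp_symm (y : Coord 4) (i j : Fin 4) : g.comp φ y i j = g.comp φ y j i :=
  g.symm _ _ _

lemma contDiffAt_comp (hφ : φ ∈ IsManifold.maximalAtlas (𝓡 4) ∞ M) {y : Coord 4}
    (hy : y ∈ φ.target) (μ ν : Fin 4) : ContDiffAt ℝ ∞ (fun z => g.comp φ z μ ν) y := by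
  rw [← contMDiffAt_iff_contDiffAt]
  have hb : ContMDiffAt (𝓡 4) (𝓡 4) ∞ φ.symm y := contMDiffAt_symm_of_mem_maximalAtlas hφ hy
  have : ContMDiffAt (𝓡 4) ((𝓡 4).prod 𝓘(ℝ)) ∞
      (fun z => Bundle.TotalSpace.mk' ℝ (E := Bundle.Trivial M ℝ) (φ.symm z)
        (g.comp φ z μ ν)) y := by
    apply ContMDiffAt.clm_bundle_apply₂ (F₁ := Coord 4) (F₂ := Coord 4)
    · exact g.smooth.contMDiffAt.comp y hb
    · exact contMDiffAt_coordVector hφ hy _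
    · exact contMDiffAt_coordVector hφ hy _
  rw [Bundle.contMDiffAt_totalSpace] at this
  exact this.2

/-- The metric on vectors given by their components. -/
lemma sum_comp (y : Coord 4) (v w : Coord 4) :
    ∑ μ, ∑ ν, g.comp φ y μ ν * v μ * w ν = g.val (φ.symm y) (mfderiv (𝓡 4) (𝓡 4) φ.symm y v)
      (mfderiv (𝓡 4) (𝓡 4) φ.symm y w) :=
  sum_bilinear_single (g.val (φ.symm y)) (mfderiv (𝓡 4) (𝓡 4) φ.symm y) v w

/-- The metric at a point of a chart domain, on vectors given by their components. -/
lemma sum_comp_mfderiv (hφ : φ ∈ IsManifold.maximalAtlas (𝓡 4) ∞ M) {p : M} (hp : p ∈ φ.source)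
    (V W : TangentSpace (𝓡 4) p) {v w : Coord 4} (hv : v = mfderiv (𝓡 4) (𝓡 4) φ p V)
    (hw : w = mfderiv (𝓡 4) (𝓡 4) φ p W) :
    ∑ μ, ∑ ν, g.comp φ (φ p) μ ν * v μ * w ν = g.val p V W := by
  have h1 : ∀ V : TangentSpace (𝓡 4) p, mfderiv (𝓡 4) (𝓡 4) φ.symm (φ p)
      (mfderiv (𝓡 4) (𝓡 4) φ p V) = V := fun V =>
    DFunLike.congr_fun ((mdifferentiable_of_mem_maximalAtlas hφ).symm_comp_deriv hp) V
  have h2 : ∀ q : M, q = p → ∀ V W : Coord 4, g.val q V W = g.val p V W := by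
    rintro q rfl V W; rfl
  subst hv hw
  refine (g.sum_comp (φ p) _ _).trans ((h2 _ (φ.left_inv hp) _ _).trans ?_)
  exact congrArg₂ (fun V W : TangentSpace (𝓡 4) p => g.val p V W) (h1 V) (h1 W)

/-- A metric of Lorentzian signature is nondegenerate. -/
lemma nondegenerate {p : M} {w : TangentSpace (𝓡 4) p} (hw : ∀ v, g.val p v w = 0) : w = 0 := by
  obtain ⟨b, hb⟩ := g.signature p
  rw [← b.sum_repr w]
  refine Finset.sum_eq_zero fun i _ => ?_
  have h1 := hw (b i)
  rw [← b.sum_repr w] at h1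
  simp only [map_sum, map_smul, hb, smul_eq_mul, mul_ite, mul_neg, mul_one, mul_zero,
    Finset.sum_ite_eq, Finset.mem_univ, if_true] at h1
  have : b.repr w i = 0 := by
    split_ifs at h1
    · linarith
    · exact h1
  rw [this, zero_smul]

/-- The component matrix of the metric is invertible. A kernel vector of the matrix is the component
vector of a tangent vector orthogonal to all others. -/
lemma det_comp_ne_zero (hφ : φ ∈ IsManifold.maximalAtlas (𝓡 4) ∞ M) {y : Coord 4}
    (hy : y ∈ φ.target) : (g.comp φ y).det ≠ 0 := by
  intro h0
  obtain ⟨w, hw0, hw⟩ := Matrix.exists_mulVec_eq_zero_iff.mpr h0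
  have hD := (mdifferentiable_of_mem_maximalAtlas hφ).symm
  have hzero : mfderiv (𝓡 4) (𝓡 4) φ.symm y (WithLp.toLp 2 w : Coord 4) = 0 := by
    refine g.nondegenerate fun v => ?_
    obtain ⟨(u : Coord 4), rfl⟩ := hD.mfderiv_surjective hy v
    refine (g.sum_comp y u (WithLp.toLp 2 w)).symm.trans (Finset.sum_eq_zero fun μ _ => ?_)
    have h1 : ∑ ν, g.comp φ y μ ν * w ν = 0 := congrFun hw μ
    have h2 : ∀ ν, g.comp φ y μ ν * u μ * w ν = u μ * (g.comp φ y μ ν * w ν) := fun ν => by ring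
    exact (Finset.sum_congr rfl fun ν _ => h2 ν).trans (by rw [← Finset.mul_sum, h1, mul_zero])
  have := hD.mfderiv_injective hy (hzero.trans (map_zero _).symm)
  exact hw0 (congrArg WithLp.ofLp this)

end LorentzMetric

namespace SpacelikeHypersurface

variable {g} {S : Type*} [TopologicalSpace S] [ChartedSpace (Coord 3) S] [IsManifold (𝓡 3) ∞ S]
  (H : SpacelikeHypersurface g S) {ψ : OpenPartialHomeomorph S (Coord 3)}

section

variable (hφ : φ ∈ IsManifold.maximalAtlas (𝓡 4) ∞ M)
  (hψ : ψ ∈ IsManifold.maximalAtlas (𝓡 3) ∞ S) {z : Coord 3} (hz : z ∈ ψ.target)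
  (hzφ : H.incl (ψ.symm z) ∈ φ.source)

include hφ hψ hz hzφ

lemma contDiffAt_param : ContDiffAt ℝ ∞ (H.param φ ψ) z := by
  rw [← contMDiffAt_iff_contDiffAt]
  have h1 : ContMDiffAt (𝓡 3) (𝓡 3) ∞ ψ.symm z := contMDiffAt_symm_of_mem_maximalAtlas hψ hz
  have h2 : ContMDiffAt (𝓡 4) (𝓡 4) ∞ φ (H.incl (ψ.symm z)) :=
    contMDiffAt_of_mem_maximalAtlas hφ hzφ
  exact h2.comp z ((H.smooth_incl.contMDiffAt).comp z h1)

lemma contDiffAt_normalComp : ContDiffAt ℝ ∞ (H.normalComp φ ψ) z := by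
  have h1 : ContMDiffAt (𝓡 3) (𝓡 3) ∞ ψ.symm z := contMDiffAt_symm_of_mem_maximalAtlas hψ hz
  have h2 : ContMDiffAt (𝓡 3) (𝓡 4).tangent ∞
      (fun z => (⟨H.incl (ψ.symm z), H.normal (ψ.symm z)⟩ : TangentBundle (𝓡 4) M)) z :=
    (H.smooth_normal.contMDiffAt).comp z h1
  have h3 : ContMDiffAt (𝓡 3) (𝓡 4).tangent ∞ (fun z => (⟨H.param φ ψ z, H.normalComp φ ψ z⟩ :
      TangentBundle (𝓡 4) (Coord 4))) z :=
    (contMDiffAt_tangentMap_of_contMDiffOn φ.open_source (contMDiffOn_of_mem_maximalAtlas hφ)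
      ⟨H.incl (ψ.symm z), H.normal (ψ.symm z)⟩ hzφ).comp z h2
  rw [Bundle.contMDiffAt_totalSpace] at h3
  rw [← contMDiffAt_iff_contDiffAt]
  simpa using h3.2

/-- The components of the coordinate tangent vectors. -/
lemma fderiv_param (v : Coord 3) : fderiv ℝ (H.param φ ψ) z v
    = mfderiv (𝓡 4) (𝓡 4) φ (H.incl (ψ.symm z)) (mfderiv (𝓡 3) (𝓡 4) H.incl (ψ.symm z)
      (mfderiv (𝓡 3) (𝓡 3) ψ.symm z v)) := by
  have h1 : MDifferentiableAt (𝓡 3) (𝓡 3) ψ.symm z :=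
    (mdifferentiable_of_mem_maximalAtlas hψ).mdifferentiableAt_symm hz
  have h2 : MDifferentiableAt (𝓡 4) (𝓡 4) φ (H.incl (ψ.symm z)) :=
    (mdifferentiable_of_mem_maximalAtlas hφ).mdifferentiableAt hzφ
  have h3 : MDifferentiableAt (𝓡 3) (𝓡 4) H.incl (ψ.symm z) :=
    H.smooth_incl.contMDiffAt.mdifferentiableAt (by simp)
  have h4 : mfderiv (𝓡 3) (𝓡 4) (φ ∘ (H.incl ∘ ψ.symm)) z = _ :=
    mfderiv_comp z h2 (h3.comp z h1)
  rw [mfderiv_comp z h3 h1] at h4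
  rw [← mfderiv_eq_fderiv]
  exact DFunLike.congr_fun h4 v

end

/-- In charts, a spacelike hypersurface of a spacetime is a hypersurface in coordinates. -/
lemma isLocalHypersurface (hφ : φ ∈ IsManifold.maximalAtlas (𝓡 4) ∞ M)
    (hψ : ψ ∈ IsManifold.maximalAtlas (𝓡 3) ∞ S) {x : Coord 3} (hx : x ∈ ψ.target)
    (hxφ : H.incl (ψ.symm x) ∈ φ.source) :
    IsLocalHypersurface (g.comp φ) (H.param φ ψ) (H.normalComp φ ψ) x := by
  -- The parameters for which the point lies in both chart domains form a neighbourhood of `x`.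
  have hev : ∀ᶠ z in 𝓝 x, z ∈ ψ.target ∧ H.incl (ψ.symm z) ∈ φ.source := by
    refine Filter.Eventually.and (ψ.open_target.mem_nhds hx) ?_
    exact (H.smooth_incl.continuous.continuousAt.comp (ψ.continuousAt_symm hx)).eventually
      (φ.open_source.mem_nhds hxφ)
  have htan : ∀ {z : Coord 3}, z ∈ ψ.target → H.incl (ψ.symm z) ∈ φ.source → ∀ i μ,
      tangentComp (H.param φ ψ) z i μ
        = fderiv ℝ (H.param φ ψ) z (EuclideanSpace.single i 1) μ := fun hz hzφ =>
    tangentComp_eq_fderiv ((H.contDiffAt_param hφ hψ hz hzφ).differentiableAt (by simp))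
  refine ⟨g.comp_symm, g.det_comp_ne_zero hφ (φ.map_source hxφ), ?_,
    contDiffAt_euclidean.mp (H.contDiffAt_param hφ hψ hx hxφ),
    contDiffAt_euclidean.mp (H.contDiffAt_normalComp hφ hψ hx hxφ), ?_, ?_, ?_⟩
  · filter_upwards [φ.open_target.mem_nhds (φ.map_source hxφ)] with y hy
    exact g.contDiffAt_comp hφ hy
  · filter_upwards [hev] with z hz
    exact (g.sum_comp_mfderiv hφ hz.2 _ _ rfl rfl).trans (H.normal_unit _)
  · filter_upwards [hev] with z hz i
    simp only [htan hz.1 hz.2]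
    exact (g.sum_comp_mfderiv hφ hz.2 _ _ rfl (H.fderiv_param hφ hψ hz.1 hz.2 _)).trans
      (H.normal_orthogonal _ _)
  · refine Matrix.PosDef.of_dotProduct_mulVec_pos ?_ fun v hv => ?_
    · exact Matrix.IsHermitian.ext fun i j => inducedMetric_symm g.comp_symm _ _ _
    · let D : Coord 3 →L[ℝ] TangentSpace (𝓡 4) (H.incl (ψ.symm x)) :=
        (mfderiv (𝓡 3) (𝓡 4) H.incl (ψ.symm x)).comp (mfderiv (𝓡 3) (𝓡 3) ψ.symm x)
      have h1 : ∀ i j, inducedMetric (g.comp φ) (H.param φ ψ) x i j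
          = g.val (H.incl (ψ.symm x)) (D (EuclideanSpace.single i 1))
            (D (EuclideanSpace.single j 1)) := fun i j => by
        rw [inducedMetric_apply, metricProd]
        simp only [htan hx hxφ]
        exact g.sum_comp_mfderiv hφ hxφ _ _ (H.fderiv_param hφ hψ hx hxφ _)
          (H.fderiv_param hφ hψ hx hxφ _)
      have h2 : v ⬝ᵥ (inducedMetric (g.comp φ) (H.param φ ψ) x).mulVec v
          = g.val (H.incl (ψ.symm x)) (D (WithLp.toLp 2 v)) (D (WithLp.toLp 2 v)) := by
        rw [← sum_bilinear_single]
        simp only [dotProduct, Matrix.mulVec, Finset.mul_sum, h1]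
        exact Finset.sum_congr rfl fun _ _ => Finset.sum_congr rfl fun _ _ => by ring
      rw [star_trivial, h2]
      refine H.spacelike _ _ fun h0 => hv ?_
      have := (mdifferentiable_of_mem_maximalAtlas hψ).symm.mfderiv_injective hx
        (h0.trans (map_zero _).symm)
      exact congrArg WithLp.ofLp this

end SpacelikeHypersurface

end metric

end GravitoEM

end

theorem theorem3p3
    {M : Type*} [TopologicalSpace M] [ChartedSpace (EuclideanSpace ℝ (Fin 4)) M]
    [IsManifold (𝓡 4) ∞ M]
    {S : Type*} [TopologicalSpace S] [ChartedSpace (EuclideanSpace ℝ (Fin 3)) S]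
    [IsManifold (𝓡 3) ∞ S]
    (g : GravitoEM.LorentzMetric M) (Λ : ℝ) (hvac : g.IsVacuum Λ)
    (H : GravitoEM.SpacelikeHypersurface g S)
    (φ : OpenPartialHomeomorph M (EuclideanSpace ℝ (Fin 4)))
    (hφ : φ ∈ IsManifold.maximalAtlas (𝓡 4) ∞ M)
    (ψ : OpenPartialHomeomorph S (EuclideanSpace ℝ (Fin 3)))
    (hψ : ψ ∈ IsManifold.maximalAtlas (𝓡 3) ∞ S)
    (x : EuclideanSpace ℝ (Fin 3)) (hx : x ∈ ψ.target) (hxφ : H.incl (ψ.symm x) ∈ φ.source)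
    (s₄ s₃ : ℤˣ)
    (hs : GravitoEM.OrientationsCompatible (H.param φ ψ) (H.normalComp φ ψ) x s₄ s₃)
    (j : Fin 3) :
    GravitoEM.divergence (H.γ φ ψ) x (H.E φ ψ) j
        = GravitoEM.wedge (H.γ φ ψ) s₃ x (H.K φ ψ) (H.B φ ψ s₄) j ∧
      GravitoEM.divergence (H.γ φ ψ) x (H.B φ ψ s₄) j
        = -GravitoEM.wedge (H.γ φ ψ) s₃ x (H.K φ ψ) (H.E φ ψ) j := by
  have hH := H.isLocalHypersurface hφ hψ hx hxφ
  have hvac' : ∀ᶠ y in nhds (H.param φ ψ x), ∀ μ ν : Fin 4,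
      GravitoEM.ricci (g.comp φ) y μ ν
        - (1 / 2) * GravitoEM.scalarCurvature (g.comp φ) y * g.comp φ y μ ν
        + Λ * g.comp φ y μ ν = 0 :=
    Filter.eventually_of_mem (φ.open_target.mem_nhds (φ.map_source hxφ)) (hvac φ hφ)
  exact ⟨hH.divergence_electricPart hs hvac' j, hH.divergence_magneticPart hs hvac' j⟩
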